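/- Let $M\subset\mathbb R^3$ be a subset. Then $M$ is a connected, complete, embedded rotational $C^2$-surface (without boundary) whose second fundamental form has constant positive length if and only if $M$ is a round sphere or a circular cylinder (of positive radius). Here the length $|A|$ of the second fundamental form is given by $|A|^2=\operatorname{tr}(A^2)$, where $A$ is the shape operator; rotational means invariant under all rotations about some line of $\mathbb R^3$; and complete means complete for the intrinsic (Riemannian) distance of $M$. -/

import Mathlib

open scoped ENNReal

namespace RotSurf

noncomputable section

/-- The parameter plane. -/
abbrev E2 : Type := EuclideanSpace ℝ (Fin 2)

/-- Euclidean 3-space. -/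
abbrev E3 : Type := EuclideanSpace ℝ (Fin 3)

/-! ### Regular surfaces in space -/

/-- `X : U → M` is a regular local parametrization of class `C²` of the set `M`: `U` is an open
subset of the plane, `X` is a `C²` immersion on `U`, a homeomorphism of `U` onto its image, and
that image is an open subset of `M` (for the topology that `M` inherits from space). -/
structure IsLocalParam (M : Set E3) (U : Set E2) (X : E2 → E3) : Prop where
  isOpen : IsOpen U
  contDiffOn : ContDiffOn ℝ 2 X U
  immersion : ∀ u ∈ U, Function.Injective (fderiv ℝ X u)
  isEmbedding : Topology.IsEmbedding (U.domRestrict X)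
  image_open : ∃ V : Set E3, IsOpen V ∧ X '' U = M ∩ V

/-- `M` is an embedded surface of class `C²` (without boundary): every point of `M` lies in the
image of a regular local parametrization. -/
def IsEmbeddedC2Surface (M : Set E3) : Prop :=
  ∀ p ∈ M, ∃ (U : Set E2) (X : E2 → E3), IsLocalParam M U X ∧ p ∈ X '' U

/-! ### The second fundamental form -/

/-- The first partial derivative `∂ᵢ X`. -/
def pd (X : E2 → E3) (i : Fin 2) (u : E2) : E3 :=
  fderiv ℝ X u (EuclideanSpace.single i 1)

/-- The unit normal `(∂₀ X × ∂₁ X) / |∂₀ X × ∂₁ X|`. -/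
def unitNormal (X : E2 → E3) (u : E2) : E3 :=
  let w : E3 := WithLp.toLp 2 (crossProduct (WithLp.ofLp (pd X 0 u)) (WithLp.ofLp (pd X 1 u)))
  ‖w‖⁻¹ • w

/-- The matrix `⟨∂ᵢ X, ∂ⱼ X⟩` of the first fundamental form. -/
def firstForm (X : E2 → E3) (u : E2) : Matrix (Fin 2) (Fin 2) ℝ :=
  Matrix.of fun i j => inner ℝ (pd X i u) (pd X j u)

/-- The matrix `⟨∂ᵢ ∂ⱼ X, N⟩` of the second fundamental form. -/
def secondForm (X : E2 → E3) (u : E2) : Matrix (Fin 2) (Fin 2) ℝ :=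
  Matrix.of fun i j => inner ℝ (pd (pd X j) i u) (unitNormal X u)

/-- The matrix of the shape operator in the basis `∂₀ X, ∂₁ X` of the tangent plane. -/
def shapeOperator (X : E2 → E3) (u : E2) : Matrix (Fin 2) (Fin 2) ℝ :=
  (firstForm X u)⁻¹ * secondForm X u

/-- The length `|A| = √(tr A²)` of the second fundamental form at the point `X u`. -/
def secondFormLength (X : E2 → E3) (u : E2) : ℝ :=
  √((shapeOperator X u * shapeOperator X u).trace)

/-- The second fundamental form of `M` has length `c` at every point of `M` (computed in any
regular local parametrization). -/
def HasSecondFormLength (M : Set E3) (c : ℝ) : Prop :=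
  ∀ (U : Set E2) (X : E2 → E3), IsLocalParam M U X → ∀ u ∈ U, secondFormLength X u = c

/-! ### Completeness -/

/-- `γ : [0, 1] → M` is a `C¹` curve in `M` from `p` to `q`. -/
structure IsCurveIn (M : Set E3) (p q : E3) (γ : ℝ → E3) : Prop where
  contDiffOn : ContDiffOn ℝ 1 γ (Set.Icc 0 1)
  mapsTo : Set.MapsTo γ (Set.Icc 0 1) M
  source : γ 0 = p
  target : γ 1 = q

/-- The length of a curve defined on `[0, 1]`. -/
def curveLength (γ : ℝ → E3) : ℝ≥0∞ :=
  ∫⁻ t in Set.Icc (0 : ℝ) 1, ‖derivWithin γ (Set.Icc 0 1) t‖ₑ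

/-- The intrinsic (Riemannian) distance of `M`: the infimum of the lengths of the curves in `M`
from `p` to `q`. -/
def intrinsicDist (M : Set E3) (p q : E3) : ℝ≥0∞ :=
  ⨅ (γ : ℝ → E3) (_ : IsCurveIn M p q γ), curveLength γ

/-- `M` is complete: every sequence in `M` that is Cauchy for the intrinsic distance converges,
for the intrinsic distance, to a point of `M`. -/
def IsIntrinsicallyComplete (M : Set E3) : Prop :=
  ∀ x : ℕ → E3, (∀ n, x n ∈ M) →
    (∀ ε : ℝ≥0∞, 0 < ε → ∃ N, ∀ m ≥ N, ∀ n ≥ N, intrinsicDist M (x m) (x n) < ε) →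
    ∃ p ∈ M, Filter.Tendsto (fun n => intrinsicDist M (x n) p) Filter.atTop (nhds 0)

/-! ### Rotational surfaces, spheres and cylinders -/

/-- `M` is rotational: it is invariant under all rotations about some line, here the line through
`a` with direction `b 0`, where `b` is an orthonormal basis of space. -/
def IsRotational (M : Set E3) : Prop :=
  ∃ (a : E3) (b : OrthonormalBasis (Fin 3) ℝ E3), ∀ t x y z : ℝ,
    a + x • b 0 + y • b 1 + z • b 2 ∈ M →
    a + x • b 0 + (Real.cos t * y - Real.sin t * z) • b 1
      + (Real.sin t * y + Real.cos t * z) • b 2 ∈ M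

/-- `M` is a round sphere of positive radius. -/
def IsRoundSphere (M : Set E3) : Prop :=
  ∃ (a : E3) (r : ℝ), 0 < r ∧ M = Metric.sphere a r

/-- `M` is a (full) circular cylinder of positive radius: the set of all points at distance `r`
from the line through `a` with unit direction `v`. -/
def IsCircularCylinder (M : Set E3) : Prop :=
  ∃ (a v : E3) (r : ℝ), ‖v‖ = 1 ∧ 0 < r ∧ M = {p : E3 | ‖(p - a) - inner ℝ v (p - a) • v‖ = r}

end

end RotSurf

/-!
Spheres and cylinders are quadrics `ε x² + y² + z² = r²` with `ε ∈ {0, 1}`. Differentiating the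
equation twice gives the second fundamental form in any local parametrization
(`secondFormLength_quadric`), and they are complete because they are closed in space and the
intrinsic distance dominates the Euclidean one.

For the converse, let `M` be rotational about the line through `a` in the direction `b 0`. Because
`b 2` is tangent to `M` along the plane of `b 0` and `b 1` (off the axis it is the velocity of the
rotation; on the axis the tangent plane is invariant under all rotations), `M` meets this plane in a
one-dimensional `C²` submanifold, the meridian set (`exists_chart_meridianSet`). Since `M` is
complete, every point of the meridian set lies on a unit speed curve in it that is defined for all
times (`exists_complete_meridian`). With radius `r`, height `z`, tangent angle `θ` and curvature
`κ = θ'`, the principal curvatures are `κ` and `sin θ / r`, so that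
`(r κ)² + sin² θ = c² r²` (`IsUnitArc.exists_isProfile`). This equation is not an ordinary
differential equation to which uniqueness applies: the sign of `κ` may change where `κ` vanishes,
and it degenerates on the axis.

* If the principal curvatures agree at one point of a meridian, in particular if it meets the axis,
  they agree along all of it and are constant (`IsProfile.umbilic`). The meridian is then a full
  circle centred on the axis. The sphere that it generates is closed, and open in `M`, hence is all
  of `M` (`isRoundSphere_of_umbilic`).
* Otherwise `r > 0` throughout, and, up to orientation, `κ < sin θ / r`. If `κ` vanishes identically,
  the meridian is a line parallel to the axis at distance `1 / c`. If it does not, then `κ ≤ 0`, and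
  the tangent turns through all angles between `π / 2` and `-π / 2`. At the angle `-η` the radius is
  larger than at the angle `η`, hence the curvature is stronger, and the meridian rises more than it
  falls (`IsProfile.height_gain`). So it starts, near the angle `π / 2`, below the horizontal line
  through its outermost point, and it is above that line before it comes back to it. The meridian is
  symmetric in this line by uniqueness away from the zeros of `κ` (`IsProfile.unique`), hence it
  crosses itself transversally (`IsProfile.straight_or_crossing`). This is impossible in a
  submanifold, where two unit speed curves through one point have the same tangent line
  (`IsUnitArc.deriv_eq_or_neg`). So all meridians are lines, and `M` is a cylinder.
-/

namespace RotSurf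

/-! ### The unit normal and the first form -/

/-- A vector of space orthogonal to `p` and `q`, of length one, spans the line of `p × q`. -/
lemma cross_eq_smul_of_orthogonal {p q n : E3} (hn : ‖n‖ = 1) (hp : inner ℝ p n = 0)
    (hq : inner ℝ q n = 0) :
    ∃ l : ℝ, (WithLp.toLp 2 (crossProduct (WithLp.ofLp p) (WithLp.ofLp q)) : E3) = l • n := by
  have hn' : inner ℝ n n = (1 : ℝ) := by rw [real_inner_self_eq_norm_sq, hn]; norm_num
  simp only [PiLp.inner_apply, Fin.sum_univ_three, RCLike.inner_apply, conj_trivial] at hp hq hn'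
  refine ⟨(p 1 * q 2 - p 2 * q 1) * n 0 + (p 2 * q 0 - p 0 * q 2) * n 1
    + (p 0 * q 1 - p 1 * q 0) * n 2, ?_⟩
  ext i
  fin_cases i <;> simp [cross_apply]
  · linear_combination (-(p 1 * q 2 - p 2 * q 1)) * hn' - (-(n 1 * q 2) + n 2 * q 1) * hp
      - (n 1 * p 2 - n 2 * p 1) * hq
  · linear_combination (-(p 2 * q 0 - p 0 * q 2)) * hn' - (-(n 2 * q 0) + n 0 * q 2) * hp
      - (n 2 * p 0 - n 0 * p 2) * hq
  · linear_combination (-(p 0 * q 1 - p 1 * q 0)) * hn' - (-(n 0 * q 1) + n 1 * q 0) * hp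
      - (n 0 * p 1 - n 1 * p 0) * hq

lemma linearIndependent_pd {X : E2 → E3} {u : E2} (h : Function.Injective (fderiv ℝ X u)) :
    LinearIndependent ℝ ![pd X 0 u, pd X 1 u] := by
  have h1 := (EuclideanSpace.basisFun (Fin 2) ℝ).toBasis.linearIndependent.map'
    (fderiv ℝ X u).toLinearMap (LinearMap.ker_eq_bot.2 h)
  have e : ![pd X 0 u, pd X 1 u] =
      (fderiv ℝ X u).toLinearMap ∘ (EuclideanSpace.basisFun (Fin 2) ℝ).toBasis := by
    ext i : 1
    fin_cases i <;> simp [pd]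
  rw [e]
  exact h1

/-- The unit normal is determined up to sign by its orthogonality to the partial derivatives. -/
lemma unitNormal_eq_or {X : E2 → E3} {u : E2} (h : Function.Injective (fderiv ℝ X u)) {n : E3}
    (hn : ‖n‖ = 1) (ho : ∀ i, inner ℝ (pd X i u) n = 0) :
    unitNormal X u = n ∨ unitNormal X u = -n := by
  obtain ⟨l, hl⟩ := cross_eq_smul_of_orthogonal hn (ho 0) (ho 1)
  have h0 : l ≠ 0 := by
    rintro rfl
    have hli := linearIndependent_pd h
    have h2 : LinearIndependent ℝ ![WithLp.ofLp (pd X 0 u), WithLp.ofLp (pd X 1 u)] := by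
      have := hli.map' (WithLp.linearEquiv 2 ℝ (Fin 3 → ℝ)).toLinearMap
        (LinearMap.ker_eq_bot.2 (WithLp.linearEquiv 2 ℝ (Fin 3 → ℝ)).injective)
      have e : ![WithLp.ofLp (pd X 0 u), WithLp.ofLp (pd X 1 u)] =
          (WithLp.linearEquiv 2 ℝ (Fin 3 → ℝ)).toLinearMap ∘ ![pd X 0 u, pd X 1 u] := by
        ext i : 1
        fin_cases i <;> simp
      rw [e]
      exact this
    apply crossProduct_ne_zero_iff_linearIndependent.2 h2
    rw [zero_smul] at hl
    simpa using congrArg WithLp.ofLp hl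
  unfold unitNormal
  simp only [hl, norm_smul, hn, mul_one, smul_smul, Real.norm_eq_abs]
  rcases lt_or_gt_of_ne h0 with h1 | h1
  · right; rw [abs_of_neg h1, inv_neg, neg_mul, inv_mul_cancel₀ h0, neg_one_smul]
  · left; rw [abs_of_pos h1, inv_mul_cancel₀ h0, one_smul]

/-- The length of the second fundamental form may be computed with either unit normal: `B` is
the matrix of second derivatives in the direction of an arbitrary unit normal `n`. -/
lemma secondFormLength_eq {X : E2 → E3} {u : E2} (h : Function.Injective (fderiv ℝ X u)) {n : E3}
    (hn : ‖n‖ = 1) (ho : ∀ i, inner ℝ (pd X i u) n = 0) (B : Matrix (Fin 2) (Fin 2) ℝ)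
    (hB : ∀ i j, B i j = inner ℝ (pd (pd X j) i u) n) :
    secondFormLength X u =
      √(((firstForm X u)⁻¹ * B * ((firstForm X u)⁻¹ * B)).trace) := by
  unfold secondFormLength shapeOperator
  rcases unitNormal_eq_or h hn ho with h1 | h1
  · have : secondForm X u = B := by ext i j; simp [secondForm, hB, h1]
    rw [this]
  · have : secondForm X u = -B := by ext i j; simp [secondForm, hB, h1]
    rw [this]; simp

lemma firstForm_det_pos {X : E2 → E3} {u : E2} (h : Function.Injective (fderiv ℝ X u)) :
    0 < inner ℝ (pd X 0 u) (pd X 0 u) * inner ℝ (pd X 1 u) (pd X 1 u)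
      - inner ℝ (pd X 0 u) (pd X 1 u) ^ 2 := by
  have hli := linearIndependent_pd h
  have h0 : pd X 0 u ≠ 0 := hli.ne_zero 0
  have h1 := real_inner_mul_inner_self_le (pd X 0 u) (pd X 1 u)
  have h2 := hli
  rw [LinearIndependent.pair_iff' h0] at h2
  have h3 : |inner ℝ (pd X 0 u) (pd X 1 u)| ≠ ‖pd X 0 u‖ * ‖pd X 1 u‖ := by
    intro he
    obtain ⟨r, hr⟩ := (abs_real_inner_div_norm_mul_norm_eq_one_iff (pd X 0 u) (pd X 1 u)).1 (by
      rw [abs_div, abs_of_nonneg (by positivity : 0 ≤ ‖pd X 0 u‖ * ‖pd X 1 u‖), he]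
      exact div_self (mul_ne_zero (norm_ne_zero_iff.2 h0) (norm_ne_zero_iff.2 (hli.ne_zero 1)))) |>.2
    exact h2 r hr.2.symm
  have h4 := lt_of_le_of_ne (abs_real_inner_le_norm (pd X 0 u) (pd X 1 u)) h3
  rw [real_inner_self_eq_norm_sq, real_inner_self_eq_norm_sq, ← sq_abs (inner ℝ _ _)]
  nlinarith [abs_nonneg (inner ℝ (pd X 0 u) (pd X 1 u)), norm_nonneg (pd X 0 u),
    norm_nonneg (pd X 1 u)]

/-! ### Local parametrizations with a differentiable left inverse -/

/-- A `C²` map with a differentiable left inverse is a regular local parametrization as soon as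
its image is open in `M`. -/
lemma IsLocalParam.of_leftInverse {M : Set E3} {U : Set E2} {X : E2 → E3} (hU : IsOpen U)
    (hX : ContDiffOn ℝ 2 X U) (L : E3 → E2) (hL : ∀ u ∈ U, DifferentiableAt ℝ L (X u))
    (hLX : ∀ u ∈ U, L (X u) = u) (himg : ∃ V : Set E3, IsOpen V ∧ X '' U = M ∩ V) :
    IsLocalParam M U X where
  isOpen := hU
  contDiffOn := hX
  immersion := by
    intro u hu
    have h1 : HasFDerivAt X (fderiv ℝ X u) u :=
      ((hX.contDiffAt (hU.mem_nhds hu)).differentiableAt (by norm_num)).hasFDerivAt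
    have h2 := (hL u hu).hasFDerivAt.comp u h1
    have h3 : HasFDerivAt (L ∘ X) (ContinuousLinearMap.id ℝ E2) u :=
      (hasFDerivAt_id u).congr_of_eventuallyEq
        (Filter.eventually_of_mem (hU.mem_nhds hu) fun v hv => hLX v hv)
    have h4 := h2.unique h3
    refine Function.LeftInverse.injective (g := fderiv ℝ L (X u)) fun v => ?_
    exact DFunLike.congr_fun h4 v
  isEmbedding := by
    have hc : Continuous (U.domRestrict X) := hX.continuousOn.domRestrict
    refine ⟨(Topology.isInducing_iff_nhds).2 fun u => le_antisymm
      (hc.tendsto u).le_comap ?_, ?_⟩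
    · rw [nhds_subtype, ← Filter.tendsto_iff_comap]
      have h1 : Filter.Tendsto L (nhds (X u)) (nhds u.1) := by
        have := (hL u u.2).continuousAt.tendsto
        rwa [hLX u u.2] at this
      have h2 := h1.comp (Filter.tendsto_comap (f := U.domRestrict X) (x := nhds (X u)))
      refine h2.congr fun v => ?_
      simp [hLX v v.2]
    · intro u v huv
      have := congrArg L huv
      simp only [Set.domRestrict_apply, hLX u u.2, hLX v v.2] at this
      exact Subtype.ext this
  image_open := himg

/-! ### Spheres and cylinders as quadrics -/

/-- The quadric `ε x² + y² + z² = r²` in the orthonormal coordinates `x, y, z` with origin `a` and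
axes `b`: a round sphere if `ε = 1`, a circular cylinder if `ε = 0`. -/
def quadric (ε r : ℝ) (a : E3) (b : OrthonormalBasis (Fin 3) ℝ E3) : Set E3 :=
  {p | ε * (inner ℝ (b 0) (p - a)) ^ 2 + (inner ℝ (b 1) (p - a)) ^ 2
    + (inner ℝ (b 2) (p - a)) ^ 2 = r ^ 2}

lemma norm_sq_eq_sum (b : OrthonormalBasis (Fin 3) ℝ E3) (w : E3) :
    ‖w‖ ^ 2 = (inner ℝ (b 0) w) ^ 2 + (inner ℝ (b 1) w) ^ 2 + (inner ℝ (b 2) w) ^ 2 := by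
  rw [← b.sum_sq_inner_right w, Fin.sum_univ_three]

lemma eq_sum_coords (b : OrthonormalBasis (Fin 3) ℝ E3) (w : E3) :
    w = inner ℝ (b 0) w • b 0 + inner ℝ (b 1) w • b 1 + inner ℝ (b 2) w • b 2 := by
  conv_lhs => rw [← b.sum_repr' w, Fin.sum_univ_three]

lemma inner_basis (b : OrthonormalBasis (Fin 3) ℝ E3) (i j : Fin 3) :
    inner ℝ (b i) (b j) = if i = j then (1 : ℝ) else 0 :=
  orthonormal_iff_ite.1 b.orthonormal i j

lemma sphere_eq_quadric {r : ℝ} (hr : 0 < r) (a : E3) (b : OrthonormalBasis (Fin 3) ℝ E3) :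
    Metric.sphere a r = quadric 1 r a b := by
  ext p
  rw [mem_sphere_iff_norm, quadric, Set.mem_ofPred_eq, one_mul, ← norm_sq_eq_sum,
    sq_eq_sq₀ (norm_nonneg _) hr.le]

lemma cylinder_eq_quadric {r : ℝ} (hr : 0 < r) (a : E3) (b : OrthonormalBasis (Fin 3) ℝ E3) :
    {p : E3 | ‖(p - a) - inner ℝ (b 0) (p - a) • b 0‖ = r} = quadric 0 r a b := by
  ext p
  rw [quadric, Set.mem_ofPred_eq, Set.mem_ofPred_eq, ← sq_eq_sq₀ (norm_nonneg _) hr.le,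
    norm_sq_eq_sum b]
  simp [inner_sub_right, inner_smul_right]

lemma exists_basis_zero_eq {v : E3} (hv : ‖v‖ = 1) :
    ∃ b : OrthonormalBasis (Fin 3) ℝ E3, b 0 = v := by
  have ho : Orthonormal ℝ (({0} : Set (Fin 3)).domRestrict fun _ => v) := by
    refine ⟨fun i => hv, fun i j hij => ?_⟩
    exact absurd (Subtype.ext (i.2.trans j.2.symm)) hij
  obtain ⟨b, hb⟩ := ho.exists_orthonormalBasis_extension_of_card_eq (by simp)
  exact ⟨b, hb 0 rfl⟩

/-- A quadric with weights `w` in `{0, 1}` is parametrized near a point with nonzero coordinate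
along `b k`, `w k = 1`, as a graph over the plane of the other two coordinates. -/
lemma isLocalParam_graph {w : Fin 3 → ℝ} {r : ℝ} {a : E3} {b : OrthonormalBasis (Fin 3) ℝ E3}
    {i j k : Fin 3} (hij : i ≠ j) (hik : i ≠ k) (hjk : j ≠ k) (hk : w k = 1)
    (hsum : ∀ x : E3, x = inner ℝ (b i) x • b i + inner ℝ (b j) x • b j + inner ℝ (b k) x • b k)
    {s : ℝ} (hs : s ^ 2 = 1) :
    IsLocalParam {p | w i * (inner ℝ (b i) (p - a)) ^ 2 + w j * (inner ℝ (b j) (p - a)) ^ 2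
        + w k * (inner ℝ (b k) (p - a)) ^ 2 = r ^ 2}
      {u | 0 < r ^ 2 - w i * (u 0) ^ 2 - w j * (u 1) ^ 2}
      (fun u => a + u 0 • b i + u 1 • b j
        + (s * √(r ^ 2 - w i * (u 0) ^ 2 - w j * (u 1) ^ 2)) • b k) := by
  have hLi : ∀ x y z : ℝ, inner ℝ (b i) (a + x • b i + y • b j + z • b k - a) = x := by
    intro x y z; simp [inner_sub_right, inner_add_right, inner_smul_right, hij, hik]
  have hLj : ∀ x y z : ℝ, inner ℝ (b j) (a + x • b i + y • b j + z • b k - a) = y := by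
    intro x y z
    simp [inner_sub_right, inner_add_right, inner_smul_right, hij.symm, hjk]
  have hLk : ∀ x y z : ℝ, inner ℝ (b k) (a + x • b i + y • b j + z • b k - a) = z := by
    intro x y z
    simp [inner_sub_right, inner_add_right, inner_smul_right, hik.symm, hjk.symm]
  refine IsLocalParam.of_leftInverse ?_ ?_
    (fun p => WithLp.toLp 2 ![inner ℝ (b i) (p - a), inner ℝ (b j) (p - a)]) ?_ ?_
    ⟨{p | 0 < s * inner ℝ (b k) (p - a)}, ?_, ?_⟩
  · exact isOpen_lt continuous_const (by fun_prop)
  · have h1 : ContDiffOn ℝ 2 (fun u : E2 => √(r ^ 2 - w i * (u 0) ^ 2 - w j * (u 1) ^ 2))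
        {u | 0 < r ^ 2 - w i * (u 0) ^ 2 - w j * (u 1) ^ 2} :=
      ContDiffOn.sqrt (by fun_prop) fun u hu => ne_of_gt hu
    exact ((ContDiff.contDiffOn (by fun_prop)).add
      ((contDiffOn_const.mul h1).smul contDiffOn_const))
  · intro u _
    rw [differentiableAt_euclidean]
    intro l
    fin_cases l
    · exact (differentiableAt_const _).inner ℝ (by fun_prop)
    · exact (differentiableAt_const _).inner ℝ (by fun_prop)
  · intro u _
    ext l
    fin_cases l
    · exact hLi _ _ _
    · exact hLj _ _ _
  · exact isOpen_lt continuous_const (by fun_prop)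
  · have hss : s * s = 1 := by rw [← hs]; ring
    ext p
    constructor
    · rintro ⟨u, hu, rfl⟩
      simp only [Set.mem_ofPred_eq] at hu
      refine ⟨?_, ?_⟩
      · simp only [Set.mem_ofPred_eq, hLi, hLj, hLk, hk, mul_pow, hs, Real.sq_sqrt hu.le]
        ring
      · simp only [Set.mem_ofPred_eq, hLk, ← mul_assoc, hss, one_mul]
        exact Real.sqrt_pos.2 hu
    · rintro ⟨hp, hpos⟩
      simp only [Set.mem_ofPred_eq, hk, one_mul] at hp hpos
      have h2 : r ^ 2 - w i * (inner ℝ (b i) (p - a)) ^ 2 - w j * (inner ℝ (b j) (p - a)) ^ 2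
          = (s * inner ℝ (b k) (p - a)) ^ 2 := by
        rw [mul_pow, hs]; linarith
      refine ⟨WithLp.toLp 2 ![inner ℝ (b i) (p - a), inner ℝ (b j) (p - a)], ?_, ?_⟩
      · simp only [Set.mem_ofPred_eq, Matrix.cons_val_zero, Matrix.cons_val_one, h2]
        positivity
      · simp only [Matrix.cons_val_zero, Matrix.cons_val_one, h2, Real.sqrt_sq hpos.le,
          ← mul_assoc, hss, one_mul]
        rw [add_assoc, add_assoc, ← add_assoc (_ • b i), ← hsum, add_sub_cancel]

lemma isEmbeddedC2Surface_quadric {ε r : ℝ} (hr : 0 < r) (hε : ε = 0 ∨ ε = 1) (a : E3)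
    (b : OrthonormalBasis (Fin 3) ℝ E3) : IsEmbeddedC2Surface (quadric ε r a b) := by
  intro p hp
  set w : Fin 3 → ℝ := ![ε, 1, 1] with hw
  -- A nonzero coordinate with nonzero weight, to be used as the height of the graph.
  obtain ⟨k, hk, hk0⟩ : ∃ k, w k = 1 ∧ inner ℝ (b k) (p - a) ≠ 0 := by
    by_contra hcon
    push Not at hcon
    simp only [quadric, Set.mem_ofPred_eq] at hp
    have h1 := hcon 1 rfl
    have h2 := hcon 2 rfl
    rw [h1, h2] at hp
    rcases hε with rfl | rfl
    · nlinarith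
    · rw [hcon 0 rfl] at hp; nlinarith
  obtain ⟨s, hs, hs0⟩ : ∃ s : ℝ, s ^ 2 = 1 ∧ 0 < s * inner ℝ (b k) (p - a) := by
    rcases lt_or_gt_of_ne hk0 with h | h
    · exact ⟨-1, by norm_num, by linarith⟩
    · exact ⟨1, by norm_num, by linarith⟩
  obtain ⟨i, j, hij, hik, hjk, hsum, hM⟩ : ∃ i j : Fin 3, i ≠ j ∧ i ≠ k ∧ j ≠ k ∧
      (∀ x : E3, x = inner ℝ (b i) x • b i + inner ℝ (b j) x • b j + inner ℝ (b k) x • b k) ∧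
      quadric ε r a b = {p | w i * (inner ℝ (b i) (p - a)) ^ 2
        + w j * (inner ℝ (b j) (p - a)) ^ 2 + w k * (inner ℝ (b k) (p - a)) ^ 2 = r ^ 2} := by
    fin_cases k
    · refine ⟨1, 2, by decide, by decide, by decide, fun x => ?_, ?_⟩
      · conv_lhs => rw [eq_sum_coords b x]
        simp only [Fin.zero_eta]; abel
      · ext q; simp only [quadric, hw, Set.mem_ofPred_eq]
        simp; constructor <;> intro h <;> linarith
    · refine ⟨0, 2, by decide, by decide, by decide, fun x => ?_, ?_⟩
      · conv_lhs => rw [eq_sum_coords b x]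
        simp only [Fin.mk_one]; abel
      · ext q; simp only [quadric, hw, Set.mem_ofPred_eq]
        simp; constructor <;> intro h <;> linarith
    · refine ⟨0, 1, by decide, by decide, by decide, fun x => eq_sum_coords b x, ?_⟩
      ext q; simp [quadric, hw]
  have hX := isLocalParam_graph (r := r) (a := a) (b := b) hij hik hjk hk hsum hs
  rw [← hM] at hX
  refine ⟨_, _, hX, ?_⟩
  rw [hM] at hp
  simp only [Set.mem_ofPred_eq, hk, one_mul] at hp
  have hss : s * s = 1 := by rw [← hs]; ring
  have h2 : r ^ 2 - w i * (inner ℝ (b i) (p - a)) ^ 2 - w j * (inner ℝ (b j) (p - a)) ^ 2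
      = (s * inner ℝ (b k) (p - a)) ^ 2 := by
    rw [mul_pow, hs]; linarith
  refine ⟨WithLp.toLp 2 ![inner ℝ (b i) (p - a), inner ℝ (b j) (p - a)], ?_, ?_⟩
  · simp only [Set.mem_ofPred_eq, Matrix.cons_val_zero, Matrix.cons_val_one, h2]
    positivity
  · simp only [Matrix.cons_val_zero, Matrix.cons_val_one, h2, Real.sqrt_sq hs0.le,
      ← mul_assoc, hss, one_mul]
    rw [add_assoc, add_assoc, ← add_assoc (_ • b i), ← hsum, add_sub_cancel]

lemma isRotational_quadric (ε r : ℝ) (a : E3) (b : OrthonormalBasis (Fin 3) ℝ E3) :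
    IsRotational (quadric ε r a b) := by
  refine ⟨a, b, fun t x y z h => ?_⟩
  simp only [quadric, Set.mem_ofPred_eq, add_assoc, add_sub_cancel_left, inner_add_right,
    inner_smul_right, inner_basis] at h ⊢
  simp at h ⊢
  linear_combination h + (y ^ 2 + z ^ 2) * Real.sin_sq_add_cos_sq t

lemma isClosed_quadric (ε r : ℝ) (a : E3) (b : OrthonormalBasis (Fin 3) ℝ E3) :
    IsClosed (quadric ε r a b) :=
  isClosed_eq (by fun_prop) continuous_const

lemma exists_polar (y z : ℝ) : ∃ t, y = √(y ^ 2 + z ^ 2) * Real.cos t ∧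
    z = √(y ^ 2 + z ^ 2) * Real.sin t := by
  have h : ‖(⟨y, z⟩ : ℂ)‖ = √(y ^ 2 + z ^ 2) := Complex.norm_eq_sqrt_sq_add_sq _
  exact ⟨Complex.arg ⟨y, z⟩, by rw [← h, Complex.norm_mul_cos_arg],
    by rw [← h, Complex.norm_mul_sin_arg]⟩

lemma isConnected_cylinder {r : ℝ} (hr : 0 < r) (a : E3) (b : OrthonormalBasis (Fin 3) ℝ E3) :
    IsConnected (quadric 0 r a b) := by
  have h : quadric 0 r a b = Set.range fun q : ℝ × ℝ =>
      a + (q.1 • b 0 + (r * Real.cos q.2) • b 1 + (r * Real.sin q.2) • b 2) := by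
    ext p
    constructor
    · intro hp
      simp only [quadric, Set.mem_ofPred_eq, zero_mul, zero_add] at hp
      obtain ⟨t, h1, h2⟩ := exists_polar (inner ℝ (b 1) (p - a)) (inner ℝ (b 2) (p - a))
      rw [hp, Real.sqrt_sq hr.le] at h1 h2
      refine ⟨(inner ℝ (b 0) (p - a), t), ?_⟩
      simp only [← h1, ← h2]
      rw [← eq_sum_coords, add_sub_cancel]
    · rintro ⟨q, rfl⟩
      simp only [quadric, Set.mem_ofPred_eq, add_sub_cancel_left, inner_add_right,
        inner_smul_right, inner_basis]
      simp
      linear_combination r ^ 2 * Real.sin_sq_add_cos_sq q.2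
  rw [h]
  exact isConnected_range (by fun_prop)

/-! ### The second fundamental form of spheres and cylinders -/

/-- `tr A²` for the shape operator `A = -r⁻¹ (1 - μ G⁻¹ v vᵀ)`, where `μ ∈ {0, 1}` and, if `μ = 1`,
`v` has length one for the inverse of the first form `G`. -/
lemma trace_shape_sq {E F H v₀ v₁ μ r : ℝ} (hd : E * H - F ^ 2 ≠ 0)
    (hv : μ * (H * v₀ ^ 2 - 2 * F * v₀ * v₁ + E * v₁ ^ 2) = μ * (E * H - F ^ 2))
    (hμ : μ * μ = μ) (hr : r ≠ 0) {G B : Matrix (Fin 2) (Fin 2) ℝ} (hG : G = !![E, F; F, H])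
    (hB : B = !![-(E - μ * (v₀ * v₀)) / r, -(F - μ * (v₀ * v₁)) / r;
      -(F - μ * (v₀ * v₁)) / r, -(H - μ * (v₁ * v₁)) / r]) :
    (G⁻¹ * B * (G⁻¹ * B)).trace = (2 - μ) / r ^ 2 := by
  have hd' : E * H - F * F ≠ 0 := by rwa [← sq]
  set Q := H * v₀ ^ 2 - 2 * F * v₀ * v₁ + E * v₁ ^ 2 with hQ
  have h1 : (G⁻¹ * B * (G⁻¹ * B)).trace
      = (2 * (E * H - F ^ 2) ^ 2 - 2 * μ * Q * (E * H - F ^ 2) + (μ * Q) ^ 2)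
        / ((E * H - F ^ 2) ^ 2 * r ^ 2) := by
    subst hG hB
    rw [Matrix.inv_def, Matrix.det_fin_two_of, Matrix.adjugate_fin_two_of,
      Ring.inverse_eq_inv']
    simp [Matrix.trace_fin_two]
    rw [hQ, show E * H - F ^ 2 = E * H - F * F by ring]
    field_simp
    ring
  rw [h1, mul_assoc 2 μ Q, hv]
  field_simp
  linear_combination hμ

lemma IsLocalParam.hasFDerivAt {M : Set E3} {U : Set E2} {X : E2 → E3} (h : IsLocalParam M U X)
    {u : E2} (hu : u ∈ U) : HasFDerivAt X (fderiv ℝ X u) u :=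
  ((h.contDiffOn.contDiffAt (h.isOpen.mem_nhds hu)).differentiableAt (by norm_num)).hasFDerivAt

lemma IsLocalParam.differentiableAt_pd {M : Set E3} {U : Set E2} {X : E2 → E3}
    (h : IsLocalParam M U X) {u : E2} (hu : u ∈ U) (i : Fin 2) :
    DifferentiableAt ℝ (pd X i) u := by
  have h1 : ContDiffAt ℝ 1 (fderiv ℝ X) u :=
    (h.contDiffOn.contDiffAt (h.isOpen.mem_nhds hu)).fderiv_right (by norm_num)
  exact (h1.differentiableAt (by norm_num)).clm_apply (differentiableAt_const _)

lemma IsLocalParam.image_subset {M : Set E3} {U : Set E2} {X : E2 → E3}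
    (h : IsLocalParam M U X) {u : E2} (hu : u ∈ U) : X u ∈ M := by
  obtain ⟨V, -, hV⟩ := h.image_open
  exact (hV ▸ Set.mem_image_of_mem X hu : X u ∈ M ∩ V).1

lemma secondFormLength_quadric {ε r : ℝ} (hr : 0 < r) (hε : ε = 0 ∨ ε = 1) (a : E3)
    (b : OrthonormalBasis (Fin 3) ℝ E3) {U : Set E2} {X : E2 → E3}
    (h : IsLocalParam (quadric ε r a b) U X) {u : E2} (hu : u ∈ U) :
    secondFormLength X u = √((1 + ε) / r ^ 2) := by
  obtain ⟨μ, rfl⟩ : ∃ μ, ε = 1 - μ := ⟨1 - ε, by ring⟩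
  have hμ : μ * μ = μ := by
    rcases hε with h | h
    · have : μ = 1 := by linarith
      simp [this]
    · have : μ = 0 := by linarith
      simp [this]
  -- The equation of the quadric, differentiated twice.
  have h0 : ∀ v ∈ U, inner ℝ (X v - a) (X v - a) - μ * (inner ℝ (b 0) (X v - a)
      * inner ℝ (b 0) (X v - a)) = r ^ 2 := by
    intro v hv
    have h1 := h.image_subset hv
    simp only [quadric, Set.mem_ofPred_eq] at h1
    rw [real_inner_self_eq_norm_sq, norm_sq_eq_sum b]
    linarith
  have h1 : ∀ v ∈ U, ∀ i, inner ℝ (X v - a) (pd X i v)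
      - μ * (inner ℝ (b 0) (X v - a) * inner ℝ (b 0) (pd X i v)) = 0 := by
    intro v hv i
    have hX := (h.hasFDerivAt hv).sub_const a
    have hb := (hasFDerivAt_const (𝕜 := ℝ) (b 0) v).inner ℝ hX
    have hd := (hX.inner ℝ hX).sub ((hb.mul hb).const_mul μ)
    have hd0 := (hasFDerivAt_const (𝕜 := ℝ) (r ^ 2) v).congr_of_eventuallyEq
      (Filter.eventually_of_mem (h.isOpen.mem_nhds hv) h0)
    have := DFunLike.congr_fun (hd.unique hd0) (EuclideanSpace.single i 1)
    simp [fderivInnerCLM_apply] at this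
    rw [real_inner_comm (X v - a)] at this
    unfold pd
    linarith
  have h2 : ∀ i j, inner ℝ (X u - a) (pd (pd X j) i u)
      - μ * (inner ℝ (b 0) (X u - a) * inner ℝ (b 0) (pd (pd X j) i u))
      = - (inner ℝ (pd X i u) (pd X j u)
        - μ * (inner ℝ (b 0) (pd X i u) * inner ℝ (b 0) (pd X j u))) := by
    intro i j
    have hX := (h.hasFDerivAt hu).sub_const a
    have hp := (h.differentiableAt_pd hu j).hasFDerivAt
    have hb := (hasFDerivAt_const (𝕜 := ℝ) (b 0) u).inner ℝ hX
    have hbp := (hasFDerivAt_const (𝕜 := ℝ) (b 0) u).inner ℝ hp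
    have hd := (hX.inner ℝ hp).sub ((hb.mul hbp).const_mul μ)
    have hd0 := (hasFDerivAt_const (𝕜 := ℝ) (0 : ℝ) u).congr_of_eventuallyEq
      (Filter.eventually_of_mem (h.isOpen.mem_nhds hu) fun v hv => h1 v hv j)
    have := DFunLike.congr_fun (hd.unique hd0) (EuclideanSpace.single i 1)
    simp [fderivInnerCLM_apply] at this
    simp only [pd] at this ⊢
    linarith
  have h0u := h0 u hu
  have h1u := h1 u hu
  clear h0 h1
  generalize X u - a = f at h0u h1u h2
  -- The unit normal.
  set n : E3 := r⁻¹ • (f - (μ * inner ℝ (b 0) f) • b 0) with hn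
  have hb0 : inner ℝ (b 0) (b 0) = (1 : ℝ) := by simp
  have hin : ∀ w : E3, inner ℝ w n
      = r⁻¹ * (inner ℝ f w - μ * (inner ℝ (b 0) f * inner ℝ (b 0) w)) := by
    intro w
    rw [hn, inner_smul_right, inner_sub_right, inner_smul_right, real_inner_comm w f,
      real_inner_comm w (b 0)]
    ring
  have hn1 : ‖n‖ = 1 := by
    have : ‖n‖ ^ 2 = 1 := by
      rw [← real_inner_self_eq_norm_sq, hin, hn, inner_smul_right, inner_sub_right,
        inner_smul_right, inner_smul_right, inner_sub_right, inner_smul_right, hb0,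
        real_inner_comm (b 0) f]
      field_simp
      linear_combination h0u + (inner ℝ (b 0) f) ^ 2 * hμ
    nlinarith [norm_nonneg n]
  have ho : ∀ i, inner ℝ (pd X i u) n = 0 := fun i => by rw [hin, h1u i, mul_zero]
  have hbn : μ * inner ℝ (b 0) n = 0 := by
    rw [hin, hb0, real_inner_comm (b 0) f]
    linear_combination (-r⁻¹ * inner ℝ (b 0) f) * hμ
  have hd := firstForm_det_pos (h.immersion u hu)
  set p := pd X 0 u
  set q := pd X 1 u
  -- The axis of a cylinder is tangent to it: the Gram determinant of `b 0, p, q` vanishes.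
  have hg : μ * (inner ℝ q q * (inner ℝ (b 0) p) ^ 2
      - 2 * inner ℝ p q * inner ℝ (b 0) p * inner ℝ (b 0) q
      + inner ℝ p p * (inner ℝ (b 0) q) ^ 2)
      = μ * (inner ℝ p p * inner ℝ q q - (inner ℝ p q) ^ 2) := by
    obtain ⟨l, hl⟩ := cross_eq_smul_of_orthogonal hn1 (ho 0) (ho 1)
    have hdet : μ * inner ℝ (b 0)
        (WithLp.toLp 2 (crossProduct (WithLp.ofLp p) (WithLp.ofLp q)) : E3) = 0 := by
      rw [hl, inner_smul_right]; linear_combination l * hbn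
    simp only [PiLp.inner_apply, Fin.sum_univ_three, RCLike.inner_apply, conj_trivial,
      cross_apply, Matrix.cons_val_zero, Matrix.cons_val_one, Matrix.cons_val] at hdet hb0 ⊢
    set e := b 0
    linear_combination (-((p 1 * q 2 - p 2 * q 1) * e 0 + (p 2 * q 0 - p 0 * q 2) * e 1
      + (p 0 * q 1 - p 1 * q 0) * e 2)) * hdet
      + μ * ((p 0 * p 0 + p 1 * p 1 + p 2 * p 2) * (q 0 * q 0 + q 1 * q 1 + q 2 * q 2)
        - (p 0 * q 0 + p 1 * q 1 + p 2 * q 2) ^ 2) * hb0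
  rw [secondFormLength_eq (h.immersion u hu) hn1 ho
    !![-(inner ℝ p p - μ * (inner ℝ (b 0) p * inner ℝ (b 0) p)) / r,
       -(inner ℝ p q - μ * (inner ℝ (b 0) p * inner ℝ (b 0) q)) / r;
       -(inner ℝ p q - μ * (inner ℝ (b 0) p * inner ℝ (b 0) q)) / r,
       -(inner ℝ q q - μ * (inner ℝ (b 0) q * inner ℝ (b 0) q)) / r] ?_,
    trace_shape_sq hd.ne' hg hμ hr.ne' ?_ rfl]
  · congr 2; ring
  · ext i j
    fin_cases i <;> fin_cases j <;> simp [firstForm, p, q, real_inner_comm]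
  · intro i j
    rw [hin, h2]
    fin_cases i <;> fin_cases j <;> simp [p, q, real_inner_comm] <;> ring

/-! ### Completeness of closed surfaces -/

lemma edist_le_intrinsicDist (M : Set E3) (p q : E3) : edist p q ≤ intrinsicDist M p q := by
  refine le_iInf₂ fun γ hγ => ?_
  rw [edist_comm, edist_eq_enorm_sub, ← hγ.source, ← hγ.target]
  exact enorm_sub_le_lintegral_derivWithin_Icc_of_contDiffOn_Icc hγ.contDiffOn zero_le_one

/-- A curve in `M` whose speed is at most `K` shows that its end points have intrinsic distance at
most `K`. -/
lemma intrinsicDist_le {M : Set E3} {p q : E3} {γ : ℝ → E3} (hγ : IsCurveIn M p q γ) {K : ℝ}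
    (hK : ∀ t ∈ Set.Icc (0 : ℝ) 1, ‖derivWithin γ (Set.Icc 0 1) t‖ ≤ K) :
    intrinsicDist M p q ≤ ENNReal.ofReal K := by
  refine (iInf₂_le γ hγ).trans ?_
  calc curveLength γ ≤ ∫⁻ _ in Set.Icc (0 : ℝ) 1, ENNReal.ofReal K := by
        refine MeasureTheory.setLIntegral_mono' measurableSet_Icc fun t ht => ?_
        rw [← ofReal_norm]
        exact ENNReal.ofReal_le_ofReal (hK t ht)
    _ = ENNReal.ofReal K := by simp

/-- A local parametrization identifies neighbourhoods in the plane and in `M`. -/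
lemma IsLocalParam.map_nhds {M : Set E3} {U : Set E2} {X : E2 → E3} (h : IsLocalParam M U X)
    {u : E2} (hu : u ∈ U) : Filter.map X (nhds u) = nhdsWithin (X u) M := by
  obtain ⟨V, hVo, hV⟩ := h.image_open
  have h1 := h.isEmbedding.map_nhds_eq ⟨u, hu⟩
  rw [Set.range_domRestrict, hV, Set.domRestrict_apply] at h1
  have h2 : X u ∈ V := (hV ▸ Set.mem_image_of_mem X hu : X u ∈ M ∩ V).2
  rw [nhdsWithin_inter_of_mem' (nhdsWithin_le_nhds (hVo.mem_nhds h2))] at h1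
  rw [← h1, ← h.isOpen.nhdsWithin_eq hu, nhdsWithin_eq_map_subtype_coe hu, Filter.map_map]
  rfl

lemma tendsto_intrinsicDist_param {M : Set E3} {U : Set E2} {X : E2 → E3}
    (h : IsLocalParam M U X) {u : E2} (hu : u ∈ U) :
    Filter.Tendsto (fun v => intrinsicDist M (X v) (X u)) (nhds u) (nhds 0) := by
  have h1 : ContDiffAt ℝ 1 (fderiv ℝ X) u :=
    (h.contDiffOn.contDiffAt (h.isOpen.mem_nhds hu)).fderiv_right (by norm_num)
  have hKe : ∀ᶠ v in nhds u, ‖fderiv ℝ X v‖ < ‖fderiv ℝ X u‖ + 1 :=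
    h1.continuousAt.norm.eventually_lt continuousAt_const (lt_add_one _)
  obtain ⟨ρ, hρ, hball⟩ := Metric.eventually_nhds_iff_ball.1
    (hKe.and (h.isOpen.mem_nhds hu))
  set K := ‖fderiv ℝ X u‖ + 1 with hKdef
  have hle : ∀ᶠ v in nhds u, intrinsicDist M (X v) (X u) ≤ ENNReal.ofReal (K * ‖u - v‖) := by
    filter_upwards [Metric.ball_mem_nhds u hρ] with v hv
    have hseg : ∀ t ∈ Set.Icc (0 : ℝ) 1, v + t • (u - v) ∈ Metric.ball u ρ := fun t ht =>
      (convex_ball u ρ).add_smul_sub_mem hv (Metric.mem_ball_self hρ) ht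
    refine intrinsicDist_le (γ := fun t => X (v + t • (u - v))) ⟨?_, ?_, by simp, by simp⟩ ?_
    · refine (h.contDiffOn.of_le (by norm_num)).comp (t := U) (ContDiff.contDiffOn (by fun_prop)) ?_
      exact fun t ht => (hball _ (hseg t ht)).2
    · exact fun t ht => h.image_subset (hball _ (hseg t ht)).2
    · intro t ht
      have hd : HasDerivAt (fun t : ℝ => v + t • (u - v)) (u - v) t := by
        simpa using ((hasDerivAt_id t).smul_const (u - v)).const_add v
      have hX := (h.hasFDerivAt (hball _ (hseg t ht)).2).comp_hasDerivAt t hd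
      rw [show (fun t : ℝ => X (v + t • (u - v))) = X ∘ fun t : ℝ => v + t • (u - v) from rfl,
        hX.hasDerivWithinAt.derivWithin (uniqueDiffOn_Icc zero_lt_one t ht)]
      exact (ContinuousLinearMap.le_opNorm _ _).trans
        (mul_le_mul_of_nonneg_right (hball _ (hseg t ht)).1.le (norm_nonneg _))
  refine tendsto_of_tendsto_of_tendsto_of_le_of_le' tendsto_const_nhds ?_
    (Filter.Eventually.of_forall fun _ => zero_le) hle
  have hc : Continuous fun v : E2 => ENNReal.ofReal (K * ‖u - v‖) :=
    ENNReal.continuous_ofReal.comp (by fun_prop)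
  have := hc.tendsto u
  simpa using this

/-- A surface which is closed in space is complete. -/
lemma isIntrinsicallyComplete_of_isClosed {M : Set E3} (hM : IsClosed M)
    (hs : IsEmbeddedC2Surface M) : IsIntrinsicallyComplete M := by
  intro x hx hC
  have hcs : CauchySeq x := by
    rw [EMetric.cauchySeq_iff]
    intro ε hε
    obtain ⟨N, hN⟩ := hC ε hε
    exact ⟨N, fun m hm n hn => (edist_le_intrinsicDist M _ _).trans_lt (hN m hm n hn)⟩
  obtain ⟨p, hp⟩ := cauchySeq_tendsto_of_complete hcs
  have hpM : p ∈ M := hM.mem_of_tendsto hp (Filter.Eventually.of_forall hx)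
  refine ⟨p, hpM, ?_⟩
  obtain ⟨U, X, hX, u, hu, rfl⟩ := hs p hpM
  have h1 : Filter.Tendsto x Filter.atTop (nhdsWithin (X u) M) :=
    tendsto_nhdsWithin_iff.2 ⟨hp, Filter.Eventually.of_forall hx⟩
  rw [← hX.map_nhds hu] at h1
  have h2 : Filter.Tendsto (fun q => intrinsicDist M q (X u)) (Filter.map X (nhds u))
      (nhds 0) := Filter.tendsto_map'_iff.2 (tendsto_intrinsicDist_param hX hu)
  exact h2.comp h1

/-- Round spheres and circular cylinders have all the properties of the classification. -/
theorem properties_of_sphere_or_cylinder {M : Set E3} (h : IsRoundSphere M ∨ IsCircularCylinder M) :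
    IsConnected M ∧ IsEmbeddedC2Surface M ∧ IsIntrinsicallyComplete M ∧
      IsRotational M ∧ ∃ c : ℝ, 0 < c ∧ HasSecondFormLength M c := by
  obtain ⟨ε, r, a, b, hr, hε, rfl, hc⟩ : ∃ (ε r : ℝ) (a : E3) (b : OrthonormalBasis (Fin 3) ℝ E3),
      0 < r ∧ (ε = 0 ∨ ε = 1) ∧ M = quadric ε r a b ∧ IsConnected M := by
    rcases h with ⟨a, r, hr, rfl⟩ | ⟨a, v, r, hv, hr, rfl⟩
    · refine ⟨1, r, a, EuclideanSpace.basisFun (Fin 3) ℝ, hr, Or.inr rfl,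
        sphere_eq_quadric hr _ _, isConnected_sphere ?_ a hr.le⟩
      rw [rank_eq_card_basis (EuclideanSpace.basisFun (Fin 3) ℝ).toBasis]
      norm_num
    · obtain ⟨b, rfl⟩ := exists_basis_zero_eq hv
      rw [cylinder_eq_quadric hr]
      exact ⟨0, r, a, b, hr, Or.inl rfl, rfl, isConnected_cylinder hr a b⟩
  have hs := isEmbeddedC2Surface_quadric hr hε a b
  refine ⟨hc, hs, isIntrinsicallyComplete_of_isClosed (isClosed_quadric ε r a b) hs,
    isRotational_quadric ε r a b, √((1 + ε) / r ^ 2), ?_, fun U X hX u hu =>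
      secondFormLength_quadric hr hε a b hX hu⟩
  have : 0 < 1 + ε := by rcases hε with rfl | rfl <;> norm_num
  positivity

/-! ### The profile equation: spheres -/

/-- The profile equation: the unit speed curve `(r, z)` has tangent angle `θ` and curvature
`κ = θ'`, and the surface of revolution with principal curvatures `κ` and `sin θ / r` that it
generates has second fundamental form of length `c`. The radius `r` may take any sign, and on the
axis `r = 0` the equation says that the curve is orthogonal to the axis. -/
structure IsProfile (c : ℝ) (r z θ κ : ℝ → ℝ) : Prop where
  deriv_r : ∀ s, HasDerivAt r (Real.cos (θ s)) s
  deriv_z : ∀ s, HasDerivAt z (Real.sin (θ s)) s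
  deriv_θ : ∀ s, HasDerivAt θ (κ s) s
  cont : Continuous κ
  eqn : ∀ s, (r s * κ s) ^ 2 + Real.sin (θ s) ^ 2 = c ^ 2 * r s ^ 2

namespace IsProfile

variable {c : ℝ} {r z θ κ : ℝ → ℝ}

lemma deriv_sin (h : IsProfile c r z θ κ) (s : ℝ) :
    HasDerivAt (fun s => Real.sin (θ s)) (Real.cos (θ s) * κ s) s :=
  (h.deriv_θ s).sin

lemma deriv_cos (h : IsProfile c r z θ κ) (s : ℝ) :
    HasDerivAt (fun s => Real.cos (θ s)) (-Real.sin (θ s) * κ s) s :=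
  (h.deriv_θ s).cos

lemma continuous_r (h : IsProfile c r z θ κ) : Continuous r :=
  continuous_iff_continuousAt.2 fun s => (h.deriv_r s).continuousAt

lemma continuous_z (h : IsProfile c r z θ κ) : Continuous z :=
  continuous_iff_continuousAt.2 fun s => (h.deriv_z s).continuousAt

lemma continuous_θ (h : IsProfile c r z θ κ) : Continuous θ :=
  continuous_iff_continuousAt.2 fun s => (h.deriv_θ s).continuousAt

lemma sin_eq_zero (h : IsProfile c r z θ κ) {s : ℝ} (hs : r s = 0) : Real.sin (θ s) = 0 := by
  have := h.eqn s
  rw [hs] at this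
  nlinarith

lemma cos_sq_eq_one (h : IsProfile c r z θ κ) {s : ℝ} (hs : r s = 0) :
    Real.cos (θ s) ^ 2 = 1 := by
  have := Real.sin_sq_add_cos_sq (θ s)
  rw [h.sin_eq_zero hs] at this
  linarith

/-- The two principal curvatures agree on the axis. -/
lemma two_mul_sq_of_axis (h : IsProfile c r z θ κ) {s : ℝ} (hs : r s = 0) :
    2 * κ s ^ 2 = c ^ 2 := by
  have h1 := hasDerivAt_iff_tendsto_slope.1 (h.deriv_sin s)
  have h2 := hasDerivAt_iff_tendsto_slope.1 (h.deriv_r s)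
  have h3 : Filter.Tendsto κ (nhdsWithin s {s}ᶜ) (nhds (κ s)) :=
    (h.cont.tendsto s).mono_left nhdsWithin_le_nhds
  have h4 := ((h2.mul h3).pow 2).add (h1.pow 2)
  have h5 := (h2.pow 2).const_mul (c ^ 2)
  have h6 := tendsto_nhds_unique_of_eventuallyEq h4 h5 (by
    filter_upwards [self_mem_nhdsWithin] with t ht
    have ht' : t - s ≠ 0 := sub_ne_zero.2 ht
    have := h.eqn t
    simp only [slope_def_field, hs, h.sin_eq_zero hs, sub_zero]
    field_simp
    linear_combination this)
  have h7 := h.cos_sq_eq_one hs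
  linear_combination h6 + (c ^ 2 - 2 * κ s ^ 2) * h7

/-- At a point with equal principal curvatures `k₀`, the principal curvatures agree nearby. The
defect `v = sin θ - k₀ r` satisfies `r² (κ + k₀) v' = - cos θ (sin θ + k₀ r) v`, a linear equation
which is regular off the axis, and which makes `v²` decrease away from the axis. -/
lemma eventually_umbilic (h : IsProfile c r z θ κ) {k₀ : ℝ} (hk : 2 * k₀ ^ 2 = c ^ 2)
    (hk0 : k₀ ≠ 0) {s : ℝ} (h1 : κ s = k₀) (h2 : Real.sin (θ s) = k₀ * r s) :
    ∀ᶠ t in nhds s, κ t = k₀ ∧ Real.sin (θ t) = k₀ * r t := by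
  set v : ℝ → ℝ := fun t => Real.sin (θ t) - k₀ * r t with hv
  have hv' : ∀ t, HasDerivAt v (Real.cos (θ t) * (κ t - k₀)) t := fun t =>
    ((h.deriv_sin t).sub ((h.deriv_r t).const_mul k₀)).congr_deriv (by ring)
  have hvs : v s = 0 := by simp [hv, h2]
  have key : ∀ t, r t ^ 2 * (κ t + k₀) * (κ t - k₀) = -v t * (Real.sin (θ t) + k₀ * r t) := by
    intro t
    linear_combination h.eqn t - r t ^ 2 * hk
  have hpos : ∀ᶠ t in nhds s, 0 < k₀ * (κ t + k₀) := by
    have hc : Continuous fun t => k₀ * (κ t + k₀) :=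
      continuous_const.mul (h.cont.add continuous_const)
    refine hc.continuousAt.eventually (lt_mem_nhds ?_)
    have : 0 < k₀ ^ 2 := by positivity
    simp only [h1]; nlinarith
  suffices hz : (∀ᶠ t in nhds s, v t = 0) ∧ ∀ᶠ t in nhds s, t = s ∨ r t ≠ 0 by
    filter_upwards [hz.1, hz.2, hpos] with t ht0 htr htp
    refine ⟨?_, sub_eq_zero.1 ht0⟩
    rcases htr with rfl | htr
    · exact h1
    · have := key t
      rw [ht0, neg_zero, zero_mul, mul_assoc] at this
      rcases mul_eq_zero.1 ((mul_eq_zero.1 this).resolve_left (pow_ne_zero 2 htr)) with h' | h'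
      · rw [h', mul_zero] at htp; exact absurd htp (lt_irrefl _)
      · exact sub_eq_zero.1 h'
  by_cases hr : r s = 0
  · have hsl1 := hasDerivAt_iff_tendsto_slope.1 (h.deriv_sin s)
    have hsl2 := hasDerivAt_iff_tendsto_slope.1 (h.deriv_r s)
    have hcos1 := h.cos_sq_eq_one hr
    have hrne : ∀ᶠ t in nhds s, t = s ∨ r t ≠ 0 := by
      have hne : Real.cos (θ s) ≠ 0 := by
        intro h0; rw [h0] at hcos1; norm_num at hcos1
      have := (h.deriv_r s).eventually_ne (c := 0) hne
      rw [eventually_nhdsWithin_iff] at this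
      filter_upwards [this] with t ht
      by_cases hts : t = s
      · exact Or.inl hts
      · exact Or.inr (ht hts)
    refine ⟨?_, hrne⟩
    have hsgn : ∀ᶠ t in nhds s, t = s ∨
        0 < k₀ * Real.cos (θ t) * (slope (fun s => Real.sin (θ s)) s t + k₀ * slope r s t) := by
      have hc : Filter.Tendsto (fun t => k₀ * Real.cos (θ t)) (nhdsWithin s {s}ᶜ)
          (nhds (k₀ * Real.cos (θ s))) :=
        ((continuous_const.mul (Real.continuous_cos.comp h.continuous_θ)).tendsto s).mono_left
          nhdsWithin_le_nhds
      have hl := hc.mul (hsl1.add (hsl2.const_mul k₀))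
      have : 0 < k₀ * Real.cos (θ s) * (Real.cos (θ s) * κ s + k₀ * Real.cos (θ s)) := by
        rw [h1]
        have : 0 < k₀ ^ 2 := by positivity
        nlinarith
      have := hl.eventually (lt_mem_nhds this)
      rw [eventually_nhdsWithin_iff] at this
      filter_upwards [this] with t ht
      by_cases hts : t = s
      · exact Or.inl hts
      · exact Or.inr (ht hts)
    obtain ⟨δ, hδ, hball⟩ := Metric.eventually_nhds_iff_ball.1 (hrne.and (hsgn.and hpos))
    -- The sign of the derivative of `v ^ 2` on either side of the axis.
    have hF : ∀ t, HasDerivAt (fun t => v t ^ 2)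
        (2 * v t * (Real.cos (θ t) * (κ t - k₀))) t := fun t =>
      ((hv' t).pow 2).congr_deriv (by simp)
    have hsign : ∀ t ∈ Metric.ball s δ, t ≠ s →
        2 * v t * (Real.cos (θ t) * (κ t - k₀)) * (t - s) ≤ 0 := by
      intro t ht hts
      obtain ⟨ha, hb, hp⟩ := hball t ht
      have ha := ha.resolve_left hts
      have hb := hb.resolve_left hts
      have hts' : t - s ≠ 0 := sub_ne_zero.2 hts
      simp only [slope_def_field, hr, h.sin_eq_zero hr, sub_zero] at hb
      have hb' : 0 < k₀ * Real.cos (θ t) * (Real.sin (θ t) + k₀ * r t) * (t - s) := by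
        have : k₀ * Real.cos (θ t) * (Real.sin (θ t) + k₀ * r t) * (t - s)
            = (t - s) ^ 2 * (k₀ * Real.cos (θ t) * (Real.sin (θ t) / (t - s)
              + k₀ * (r t / (t - s)))) := by field_simp
        rw [this]; positivity
      have hm : 0 < r t ^ 2 * (k₀ * (κ t + k₀)) := by positivity
      refine nonpos_of_mul_nonpos_right (a := r t ^ 2 * (k₀ * (κ t + k₀))) ?_ hm
      have e : r t ^ 2 * (k₀ * (κ t + k₀)) * (2 * v t * (Real.cos (θ t) * (κ t - k₀)) * (t - s))
          = -(2 * v t ^ 2 * (k₀ * Real.cos (θ t) * (Real.sin (θ t) + k₀ * r t) * (t - s))) := by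
        linear_combination (2 * k₀ * v t * Real.cos (θ t) * (t - s)) * key t
      rw [e]
      have : 0 ≤ 2 * v t ^ 2 := by positivity
      exact neg_nonpos.2 (mul_nonneg this hb'.le)
    have hcontF : Continuous fun t => v t ^ 2 :=
      continuous_iff_continuousAt.2 fun t => (hF t).continuousAt
    filter_upwards [Metric.ball_mem_nhds s hδ] with t ht
    rw [Metric.mem_ball, Real.dist_eq, abs_lt] at ht
    have hle : v t ^ 2 ≤ v s ^ 2 := by
      rcases le_total s t with hst | hst
      · refine antitoneOn_of_deriv_nonpos (convex_Icc s t) hcontF.continuousOn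
          (fun x _ => (hF x).differentiableAt.differentiableWithinAt) (fun x hx => ?_)
          (Set.left_mem_Icc.2 hst) (Set.right_mem_Icc.2 hst) hst
        rw [interior_Icc] at hx
        rw [(hF x).deriv]
        refine nonpos_of_mul_nonpos_left (hsign x ?_ hx.1.ne') (sub_pos.2 hx.1)
        rw [Metric.mem_ball, Real.dist_eq, abs_lt]
        constructor <;> linarith [hx.1, hx.2]
      · refine monotoneOn_of_deriv_nonneg (convex_Icc t s) hcontF.continuousOn
          (fun x _ => (hF x).differentiableAt.differentiableWithinAt) (fun x hx => ?_)
          (Set.left_mem_Icc.2 hst) (Set.right_mem_Icc.2 hst) hst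
        rw [interior_Icc] at hx
        rw [(hF x).deriv]
        have := hsign x (by
          rw [Metric.mem_ball, Real.dist_eq, abs_lt]
          constructor <;> linarith [hx.1, hx.2]) hx.2.ne
        by_contra hneg
        push Not at hneg
        nlinarith [mul_pos_of_neg_of_neg hneg (sub_neg.2 hx.2)]
    rw [hvs] at hle
    exact pow_eq_zero_iff (two_ne_zero) |>.1 (le_antisymm (by simpa using hle) (sq_nonneg _))
  · have hrne : ∀ᶠ t in nhds s, r t ≠ 0 := h.continuous_r.continuousAt.eventually_ne hr
    refine ⟨?_, hrne.mono fun t ht => Or.inr ht⟩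
    set g : ℝ → ℝ := fun t => -Real.cos (θ t) * (Real.sin (θ t) + k₀ * r t)
      / (r t ^ 2 * (κ t + k₀)) with hg
    have hκ2 : κ s + k₀ ≠ 0 := by rw [h1]; intro h0; apply hk0; linarith
    have hgc : ContinuousAt g s := by
      have a1 := h.continuous_r.continuousAt (x := s)
      have a2 := h.continuous_θ.continuousAt (x := s)
      have a3 := h.cont.continuousAt (x := s)
      exact ContinuousAt.div (by fun_prop) (by fun_prop)
        (mul_ne_zero (pow_ne_zero 2 hr) hκ2)
    have hgb : ∀ᶠ t in nhds s, ‖g t‖ < ‖g s‖ + 1 :=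
      hgc.norm.eventually_lt continuousAt_const (lt_add_one _)
    obtain ⟨δ, hδ, hball⟩ := Metric.eventually_nhds_iff_ball.1 (hgb.and (hpos.and hrne))
    rw [Real.ball_eq_Ioo] at hball
    have huniq : Set.EqOn v (fun _ => 0) (Set.Ioo (s - δ) (s + δ)) := by
      refine ODE_solution_unique_of_mem_Ioo (v := fun t x => g t * x) (s := fun _ => Set.univ)
        (K := (‖g s‖ + 1).toNNReal) (t₀ := s) ?_ ⟨by linarith, by linarith⟩ ?_ ?_ hvs
      · intro t ht
        refine LipschitzWith.lipschitzOnWith (LipschitzWith.of_dist_le_mul fun x y => ?_)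
        rw [Real.dist_eq, Real.dist_eq, ← mul_sub, abs_mul, Real.coe_toNNReal _ (by positivity)]
        exact mul_le_mul_of_nonneg_right (hball t ht).1.le (abs_nonneg _)
      · intro t ht
        refine ⟨(hv' t).congr_deriv ?_, Set.mem_univ _⟩
        obtain ⟨-, hp, hrt⟩ := hball t ht
        have hne : κ t + k₀ ≠ 0 := by rintro h0; rw [h0, mul_zero] at hp; exact lt_irrefl _ hp
        simp only [hg]
        field_simp
        linear_combination (Real.cos (θ t)) * key t
      · intro t _
        exact ⟨(hasDerivAt_const t (0 : ℝ)).congr_deriv (by simp), Set.mem_univ _⟩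
    exact Filter.eventually_of_mem (Ioo_mem_nhds (by linarith) (by linarith)) huniq

/-- If the principal curvatures agree at one point, or if the curve meets the axis, then they agree
everywhere and are constant. -/
lemma umbilic (h : IsProfile c r z θ κ) (hc : 0 < c) {s₀ : ℝ}
    (h0 : r s₀ * κ s₀ = Real.sin (θ s₀)) :
    ∃ k₀, 2 * k₀ ^ 2 = c ^ 2 ∧ ∀ s, κ s = k₀ ∧ Real.sin (θ s) = k₀ * r s := by
  have hk : 2 * κ s₀ ^ 2 = c ^ 2 := by
    by_cases hr : r s₀ = 0
    · exact h.two_mul_sq_of_axis hr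
    · have := h.eqn s₀
      rw [← h0] at this
      have h2 : r s₀ ^ 2 * (2 * κ s₀ ^ 2 - c ^ 2) = 0 := by linear_combination this
      linarith [(mul_eq_zero.1 h2).resolve_left (pow_ne_zero 2 hr)]
  refine ⟨κ s₀, hk, ?_⟩
  have hk0 : κ s₀ ≠ 0 := by
    intro h0; rw [h0] at hk; nlinarith
  have hcl : IsClopen {s | κ s = κ s₀ ∧ Real.sin (θ s) = κ s₀ * r s} := by
    refine ⟨(isClosed_eq h.cont continuous_const).inter
      (isClosed_eq (Real.continuous_sin.comp h.continuous_θ)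
        (continuous_const.mul h.continuous_r)), isOpen_iff_mem_nhds.2 fun s hs => ?_⟩
    exact h.eventually_umbilic hk hk0 hs.1 hs.2
  have huniv := hcl.eq_univ ⟨s₀, rfl, by rw [← h0, mul_comm]⟩
  exact fun s => (Set.eq_univ_iff_forall.1 huniv s)

end IsProfile

/-! ### The profile equation: cylinders and self-intersecting profiles -/

/-- A continuous function which is positive at `a` and not positive at `b` has a first zero. -/
lemma exists_first_zero {f : ℝ → ℝ} (hf : Continuous f) {a b : ℝ} (hab : a ≤ b) (ha : 0 < f a)
    (hb : f b ≤ 0) : ∃ t, a < t ∧ t ≤ b ∧ f t = 0 ∧ ∀ s, a ≤ s → s < t → 0 < f s := by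
  set A : Set ℝ := {t | a ≤ t ∧ f t ≤ 0} with hA
  have hcl : IsClosed A :=
    (isClosed_le continuous_const continuous_id).inter (isClosed_le hf continuous_const)
  have hbd : BddBelow A := ⟨a, fun t ht => ht.1⟩
  have hmem := hcl.csInf_mem ⟨b, hab, hb⟩ hbd
  have hpos : ∀ s, a ≤ s → s < sInf A → 0 < f s := by
    intro s has hs
    by_contra hcon
    exact absurd (csInf_le hbd ⟨has, not_lt.1 hcon⟩) (not_le.2 hs)
  have hne : a < sInf A := by
    refine lt_of_le_of_ne hmem.1 fun h => ?_
    have := hmem.2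
    rw [← h] at this
    linarith
  refine ⟨sInf A, hne, csInf_le hbd ⟨hab, hb⟩, le_antisymm hmem.2 ?_, hpos⟩
  have h1 : Filter.Tendsto f (nhdsWithin (sInf A) (Set.Iio (sInf A))) (nhds (f (sInf A))) :=
    (hf.tendsto _).mono_left nhdsWithin_le_nhds
  refine ge_of_tendsto h1 ?_
  filter_upwards [Ioo_mem_nhdsLT hne] with s hs
  exact (hpos s hs.1.le hs.2).le

/-- Integration of a lower bound of the derivative. -/
lemma add_mul_le_of_le_deriv {f f' : ℝ → ℝ} (hf : ∀ s, HasDerivAt f (f' s) s) {a b K : ℝ}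
    (hab : a ≤ b) (hK : ∀ s, a < s → s < b → K ≤ f' s) : f a + K * (b - a) ≤ f b := by
  have h := (convex_Icc a b).mul_sub_le_image_sub_of_le_deriv
    (fun x _ => (hf x).continuousAt.continuousWithinAt)
    (fun x _ => (hf x).differentiableAt.differentiableWithinAt)
    (C := K) (fun x hx => by
      rw [interior_Icc] at hx
      rw [(hf x).deriv]
      exact hK x hx.1 hx.2) a (Set.left_mem_Icc.2 hab) b (Set.right_mem_Icc.2 hab) hab
  linarith

/-- Integration of an upper bound of the derivative. -/
lemma le_add_mul_of_deriv_le {f f' : ℝ → ℝ} (hf : ∀ s, HasDerivAt f (f' s) s) {a b K : ℝ}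
    (hab : a ≤ b) (hK : ∀ s, a < s → s < b → f' s ≤ K) : f b ≤ f a + K * (b - a) := by
  have := add_mul_le_of_le_deriv (f := fun s => -f s) (K := -K) (fun s => (hf s).neg) hab
    (fun s h1 h2 => neg_le_neg (hK s h1 h2))
  linarith

namespace IsProfile

variable {c : ℝ} {r z θ κ : ℝ → ℝ}

/-! ### Symmetries of the profile equation -/

/-- Reflection in the line `z = 0`, with the parameter reversed. -/
lemma reflect (h : IsProfile c r z θ κ) : IsProfile c (fun s => r (-s)) (fun s => -z (-s))
    (fun s => -Real.pi - θ (-s)) (fun s => κ (-s)) where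
  deriv_r s := ((h.deriv_r (-s)).comp s (hasDerivAt_neg s)).congr_deriv (by
    rw [show -Real.pi - θ (-s) = -(θ (-s) + Real.pi) by ring, Real.cos_neg, Real.cos_add_pi]; ring)
  deriv_z s := ((h.deriv_z (-s)).comp s (hasDerivAt_neg s)).neg.congr_deriv (by
    rw [show -Real.pi - θ (-s) = -(θ (-s) + Real.pi) by ring, Real.sin_neg, Real.sin_add_pi]; ring)
  deriv_θ s := (((h.deriv_θ (-s)).comp s (hasDerivAt_neg s)).const_sub (-Real.pi)).congr_deriv
    (by ring)
  cont := h.cont.comp continuous_neg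
  eqn s := by
    rw [show -Real.pi - θ (-s) = -(θ (-s) + Real.pi) by ring, Real.sin_neg, Real.sin_add_pi,
      neg_neg]
    exact h.eqn (-s)

/-- The same curve with the opposite orientation. -/
lemma reverse (h : IsProfile c r z θ κ) : IsProfile c (fun s => r (-s)) (fun s => z (-s))
    (fun s => θ (-s) + Real.pi) (fun s => -κ (-s)) where
  deriv_r s := ((h.deriv_r (-s)).comp s (hasDerivAt_neg s)).congr_deriv (by
    rw [Real.cos_add_pi]; ring)
  deriv_z s := ((h.deriv_z (-s)).comp s (hasDerivAt_neg s)).congr_deriv (by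
    rw [Real.sin_add_pi]; ring)
  deriv_θ s := (((h.deriv_θ (-s)).comp s (hasDerivAt_neg s)).add_const Real.pi).congr_deriv
    (by ring)
  cont := (h.cont.comp continuous_neg).neg
  eqn s := by
    rw [Real.sin_add_pi, mul_neg, neg_sq, neg_sq]
    exact h.eqn (-s)

lemma translate (h : IsProfile c r z θ κ) (a : ℝ) : IsProfile c (fun s => r (s + a))
    (fun s => z (s + a)) (fun s => θ (s + a)) (fun s => κ (s + a)) where
  deriv_r s := (h.deriv_r (s + a)).comp_add_const s a
  deriv_z s := (h.deriv_z (s + a)).comp_add_const s a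
  deriv_θ s := (h.deriv_θ (s + a)).comp_add_const s a
  cont := h.cont.comp (continuous_add_const a)
  eqn s := h.eqn (s + a)

lemma shift_angle (h : IsProfile c r z θ κ) (m : ℤ) :
    IsProfile c r z (fun s => θ s + m * (2 * Real.pi)) κ where
  deriv_r s := (h.deriv_r s).congr_deriv (Real.cos_add_int_mul_two_pi _ _).symm
  deriv_z s := (h.deriv_z s).congr_deriv (Real.sin_add_int_mul_two_pi _ _).symm
  deriv_θ s := (h.deriv_θ s).add_const _
  cont := h.cont
  eqn s := by rw [Real.sin_add_int_mul_two_pi]; exact h.eqn s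

/-- Where the meridian is not curved, the other principal curvature is extremal, so that the
tangent is parallel to the axis. -/
lemma cos_eq_zero (h : IsProfile c r z θ κ) (hc : 0 < c) {s : ℝ} (hr : r s ≠ 0) (hs : κ s = 0) :
    Real.cos (θ s) = 0 := by
  have hF : HasDerivAt (fun t => c ^ 2 * r t ^ 2 - Real.sin (θ t) ^ 2)
      (2 * c ^ 2 * r s * Real.cos (θ s)) s :=
    ((((h.deriv_r s).pow 2).const_mul (c ^ 2)).sub ((h.deriv_sin s).pow 2)).congr_deriv (by
      rw [hs]; ring)
  have hmin : IsLocalMin (fun t => c ^ 2 * r t ^ 2 - Real.sin (θ t) ^ 2) s := by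
    refine Filter.Eventually.of_forall fun t => ?_
    have h1 := h.eqn s
    have h2 := h.eqn t
    rw [hs] at h1
    simp only
    nlinarith [sq_nonneg (r t * κ t)]
  have := hmin.hasDerivAt_eq_zero hF
  have hne : 2 * c ^ 2 * r s ≠ 0 := by positivity
  exact (mul_eq_zero.1 this).resolve_left hne

lemma sin_eq_one (h : IsProfile c r z θ κ) (hc : 0 < c) (hr : ∀ s, 0 < r s)
    (hlt : ∀ s, r s * κ s < Real.sin (θ s)) {s : ℝ} (hs : κ s = 0) : Real.sin (θ s) = 1 := by
  have h1 := h.cos_eq_zero hc (hr s).ne' hs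
  have h2 := hlt s
  rw [hs, mul_zero] at h2
  have h3 := Real.sin_sq_add_cos_sq (θ s)
  rw [h1] at h3
  nlinarith

/-- A meridian curving towards the axis while approaching it would reach it. -/
lemma not_curv_pos_of_cos_neg (h : IsProfile c r z θ κ) (hc : 0 < c) (hr : ∀ s, 0 < r s)
    (hlt : ∀ s, r s * κ s < Real.sin (θ s)) {s : ℝ} (hcos : Real.cos (θ s) < 0) : κ s ≤ 0 := by
  by_contra hκ
  push Not at hκ
  have hmono : ∀ t, s ≤ t → (∀ x, s ≤ x → x < t → 0 < κ x) →
      Real.cos (θ t) ≤ Real.cos (θ s) := by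
    intro t hst hx
    have := le_add_mul_of_deriv_le (K := 0) h.deriv_cos hst fun x h1 h2 => by
      have hp := hx x h1.le h2
      have := (mul_pos (hr x) hp).trans (hlt x)
      nlinarith [mul_pos this hp]
    linarith
  have hpos : ∀ t, s ≤ t → 0 < κ t := by
    intro t hst
    by_contra hcon
    obtain ⟨t', h1, -, h3, h4⟩ := exists_first_zero h.cont hst hκ (not_lt.1 hcon)
    have h5 := hmono t' h1.le h4
    rw [h.cos_eq_zero hc (hr t').ne' h3] at h5
    linarith
  have hlin : ∀ t, s ≤ t → r t ≤ r s + Real.cos (θ s) * (t - s) := fun t hst =>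
    le_add_mul_of_deriv_le h.deriv_r hst fun x h1 _ => hmono x h1.le fun y hy _ => hpos y hy
  have h6 := hlin (s + r s / (-Real.cos (θ s))) (by
    have : 0 < r s / (-Real.cos (θ s)) := div_pos (hr s) (neg_pos.2 hcos)
    linarith)
  have h7 : Real.cos (θ s) * (s + r s / (-Real.cos (θ s)) - s) = -r s := by
    rw [add_sub_cancel_left, div_neg, mul_neg, mul_div_cancel₀ _ hcos.ne]
  rw [h7] at h6
  linarith [hr (s + r s / (-Real.cos (θ s)))]

lemma curv_nonpos (h : IsProfile c r z θ κ) (hc : 0 < c) (hr : ∀ s, 0 < r s)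
    (hlt : ∀ s, r s * κ s < Real.sin (θ s)) (s : ℝ) : κ s ≤ 0 := by
  rcases lt_trichotomy (Real.cos (θ s)) 0 with hcos | hcos | hcos
  · exact h.not_curv_pos_of_cos_neg hc hr hlt hcos
  · by_contra hκ
    push Not at hκ
    have hsin : 0 < Real.sin (θ s) := (mul_pos (hr s) hκ).trans (hlt s)
    have h1 := (hasDerivAt_iff_tendsto_slope.1 (h.deriv_cos s)).eventually
      (gt_mem_nhds (show -Real.sin (θ s) * κ s < 0 by nlinarith))
    have h2 : ∀ᶠ t in nhdsWithin s (Set.Ioi s), slope (fun s => Real.cos (θ s)) s t < 0 :=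
      h1.filter_mono (nhdsWithin_mono s fun t ht => ne_of_gt ht)
    have h3 : ∀ᶠ t in nhdsWithin s (Set.Ioi s), 0 < κ t :=
      (h.cont.continuousAt.eventually (lt_mem_nhds hκ)).filter_mono nhdsWithin_le_nhds
    obtain ⟨t, ht1, ht2, ht3⟩ := (h2.and (h3.and self_mem_nhdsWithin)).exists
    rw [slope_def_field, hcos, sub_zero] at ht1
    have hts : 0 < t - s := sub_pos.2 ht3
    have := h.not_curv_pos_of_cos_neg hc hr hlt (s := t) (by
      by_contra hcon
      exact absurd ht1 (not_lt.2 (div_nonneg (not_lt.1 hcon) hts.le)))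
    linarith
  · have h1 := h.reflect.not_curv_pos_of_cos_neg hc (fun s => hr (-s)) (s := -s) (fun t => by
      rw [show -Real.pi - θ (-t) = -(θ (-t) + Real.pi) by ring, Real.sin_neg, Real.sin_add_pi,
        neg_neg]
      exact hlt (-t)) (by
      rw [neg_neg, show -Real.pi - θ s = -(θ s + Real.pi) by ring, Real.cos_neg, Real.cos_add_pi]
      linarith)
    simpa using h1

/-! ### Uniqueness for the profile equation -/

lemma abs_sin_div_le (h : IsProfile c r z θ κ) (hc : 0 < c) {s : ℝ} (hr : 0 < r s) :
    |Real.sin (θ s) / r s| ≤ c := by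
  rw [abs_div, abs_of_pos hr, div_le_iff₀ hr]
  refine abs_le_of_sq_le_sq (b := c * r s) ?_ (by positivity)
  have := h.eqn s
  nlinarith [sq_nonneg (r s * κ s)]

lemma curv_sq (h : IsProfile c r z θ κ) {s : ℝ} (hr : 0 < r s) :
    κ s ^ 2 = c ^ 2 - (Real.sin (θ s) / r s) ^ 2 := by
  have := h.eqn s
  field_simp
  linarith

/-- Uniqueness for the profile equation with `κ ≤ 0`, as long as `κ` does not vanish on one of the
two solutions. (At zeros of `κ` uniqueness fails.) -/
lemma unique {r' z' θ' κ' : ℝ → ℝ} (h : IsProfile c r z θ κ) (h' : IsProfile c r' z' θ' κ')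
    (hc : 0 < c) (hr : ∀ s, 0 < r s) (hr' : ∀ s, 0 < r' s) (hκ : ∀ s, κ s ≤ 0)
    {T : ℝ} (hκ' : ∀ s ∈ Set.Icc 0 T, κ' s < 0) (h0 : r 0 = r' 0) (h1 : θ 0 = θ' 0) :
    ∀ s ∈ Set.Icc 0 T, r s = r' s ∧ θ s = θ' s := by
  intro s₀ hs₀
  have hT : 0 ≤ T := hs₀.1.trans hs₀.2
  obtain ⟨x₁, hx₁, hδ⟩ := isCompact_Icc.exists_isMaxOn (Set.nonempty_Icc.2 hT)
    h'.cont.continuousOn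
  obtain ⟨x₂, hx₂, hρ⟩ := isCompact_Icc.exists_isMinOn (Set.nonempty_Icc.2 hT)
    h.continuous_r.continuousOn
  set δ := -κ' x₁ with hδdef
  set ρ := r x₂ with hρdef
  have hδ0 : 0 < δ := neg_pos.2 (hκ' x₁ hx₁)
  have hρ0 : 0 < ρ := hr x₂
  -- The right-hand side of the equation is Lipschitz where `κ'` is bounded away from `0`.
  have hcos : ∀ s, |Real.cos (θ s) - Real.cos (θ' s)| ≤ |θ s - θ' s| := fun s =>
    Real.abs_cos_sub_cos_le _ _
  set L := 2 * c * (1 + c) / (ρ * δ) with hL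
  have hLip : ∀ s ∈ Set.Icc 0 T, |κ s - κ' s| ≤ L * (|θ s - θ' s| + |r s - r' s|) := by
    intro s hs
    have hρs : ρ ≤ r s := hρ hs
    have hδs : δ ≤ -κ' s := by have := hδ hs; simp only [Set.mem_ofPred_eq] at this; linarith
    have e1 : |Real.sin (θ s) / r s - Real.sin (θ' s) / r' s|
        ≤ (|θ s - θ' s| + c * |r s - r' s|) / ρ := by
      have e : Real.sin (θ s) / r s - Real.sin (θ' s) / r' s
          = ((Real.sin (θ s) - Real.sin (θ' s))
            + (Real.sin (θ' s) / r' s) * (r' s - r s)) / r s := by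
        have := (hr s).ne'; have := (hr' s).ne'
        field_simp; ring
      rw [e, abs_div, abs_of_pos (hr s)]
      have a1 := abs_add_le (Real.sin (θ s) - Real.sin (θ' s))
        ((Real.sin (θ' s) / r' s) * (r' s - r s))
      have a2 : |Real.sin (θ s) - Real.sin (θ' s)| ≤ |θ s - θ' s| := Real.abs_sin_sub_sin_le _ _
      have a3 : |(Real.sin (θ' s) / r' s) * (r' s - r s)| ≤ c * |r s - r' s| := by
        rw [abs_mul, abs_sub_comm (r' s)]
        exact mul_le_mul_of_nonneg_right (h'.abs_sin_div_le hc (hr' s)) (abs_nonneg _)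
      exact div_le_div₀ (by positivity) (by linarith) hρ0 hρs
    have e2 : |κ s - κ' s| * δ ≤ 2 * c * |Real.sin (θ s) / r s - Real.sin (θ' s) / r' s| := by
      have b1 : |κ s - κ' s| * |κ s + κ' s| = |Real.sin (θ s) / r s - Real.sin (θ' s) / r' s|
          * |Real.sin (θ s) / r s + Real.sin (θ' s) / r' s| := by
        rw [← abs_mul, ← abs_mul, abs_eq_abs]
        right
        linear_combination h.curv_sq (hr s) - h'.curv_sq (hr' s)
      have b2 : δ ≤ |κ s + κ' s| := by
        rw [abs_of_nonpos (by linarith [hκ s])]; linarith [hκ s]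
      have b3 : |Real.sin (θ s) / r s + Real.sin (θ' s) / r' s| ≤ 2 * c := by
        have := abs_add_le (Real.sin (θ s) / r s) (Real.sin (θ' s) / r' s)
        linarith [h.abs_sin_div_le hc (hr s), h'.abs_sin_div_le hc (hr' s)]
      calc |κ s - κ' s| * δ ≤ |κ s - κ' s| * |κ s + κ' s| :=
            mul_le_mul_of_nonneg_left b2 (abs_nonneg _)
        _ ≤ _ := by
            rw [b1, mul_comm (2 * c)]
            exact mul_le_mul_of_nonneg_left b3 (abs_nonneg _)
    have e3 : |κ s - κ' s| ≤ 2 * c * ((|θ s - θ' s| + c * |r s - r' s|) / ρ) / δ := by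
      rw [le_div_iff₀ hδ0]
      exact e2.trans (mul_le_mul_of_nonneg_left e1 (by positivity))
    refine e3.trans ?_
    have e4 : 2 * c * ((|θ s - θ' s| + c * |r s - r' s|) / ρ) / δ
        = 2 * c * (|θ s - θ' s| + c * |r s - r' s|) / (ρ * δ) := by field_simp
    have e5 : L * (|θ s - θ' s| + |r s - r' s|)
        = 2 * c * ((1 + c) * (|θ s - θ' s| + |r s - r' s|)) / (ρ * δ) := by rw [hL]; ring
    rw [e4, e5]
    gcongr
    nlinarith [mul_nonneg hc.le (abs_nonneg (θ s - θ' s)), abs_nonneg (r s - r' s)]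
  have hL0 : 0 ≤ L := by positivity
  -- Gronwall for the squared distance.
  set K := 1 + 3 * L with hK
  set E : ℝ → ℝ := fun s => ((r s - r' s) ^ 2 + (θ s - θ' s) ^ 2) * Real.exp (-K * s) with hE
  have hE' : ∀ s, HasDerivAt E ((2 * (r s - r' s) * (Real.cos (θ s) - Real.cos (θ' s))
      + 2 * (θ s - θ' s) * (κ s - κ' s) - K * ((r s - r' s) ^ 2 + (θ s - θ' s) ^ 2))
      * Real.exp (-K * s)) s := by
    intro s
    have d1 := (((h.deriv_r s).sub (h'.deriv_r s)).pow 2).add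
      (((h.deriv_θ s).sub (h'.deriv_θ s)).pow 2)
    have d2 : HasDerivAt (fun s => Real.exp (-K * s)) (Real.exp (-K * s) * (-K)) s :=
      (((hasDerivAt_id s).const_mul (-K)).exp).congr_deriv (by simp)
    refine (d1.mul d2).congr_deriv ?_
    simp only [Pi.add_apply, Pi.pow_apply, Pi.sub_apply]
    ring
  have hanti : E s₀ ≤ E 0 := by
    have := le_add_mul_of_deriv_le (K := 0) hE' hs₀.1 fun s h2 h3 => by
      have hl := hLip s ⟨h2.le, h3.le.trans hs₀.2⟩
      have hcs := hcos s
      refine mul_nonpos_of_nonpos_of_nonneg ?_ (Real.exp_pos _).le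
      have f1 : (r s - r' s) * (Real.cos (θ s) - Real.cos (θ' s)) ≤ |r s - r' s| * |θ s - θ' s| :=
        (le_abs_self _).trans (by
          rw [abs_mul]; exact mul_le_mul_of_nonneg_left hcs (abs_nonneg _))
      have f2 : (θ s - θ' s) * (κ s - κ' s)
          ≤ |θ s - θ' s| * (L * (|θ s - θ' s| + |r s - r' s|)) :=
        (le_abs_self _).trans (by
          rw [abs_mul]; exact mul_le_mul_of_nonneg_left hl (abs_nonneg _))
      rw [← sq_abs (r s - r' s), ← sq_abs (θ s - θ' s)]
      have f3 := sq_nonneg (|r s - r' s| - |θ s - θ' s|)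
      have f4 := mul_nonneg hL0 f3
      have f5 := mul_nonneg hL0 (sq_nonneg (|r s - r' s|))
      rw [hK]
      nlinarith
    linarith
  have hE0 : E 0 = 0 := by simp [hE, h0, h1]
  rw [hE0] at hanti
  have hnn : (r s₀ - r' s₀) ^ 2 + (θ s₀ - θ' s₀) ^ 2 ≤ 0 :=
    nonpos_of_mul_nonpos_left hanti (Real.exp_pos _)
  constructor
  · nlinarith [sq_nonneg (r s₀ - r' s₀), sq_nonneg (θ s₀ - θ' s₀)]
  · nlinarith [sq_nonneg (r s₀ - r' s₀), sq_nonneg (θ s₀ - θ' s₀)]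

/-! ### The range of the tangent angle -/

lemma antitone_angle (h : IsProfile c r z θ κ) (hκ : ∀ s, κ s ≤ 0) : Antitone θ :=
  antitone_of_deriv_nonpos (fun s => (h.deriv_θ s).differentiableAt) fun s => by
    rw [(h.deriv_θ s).deriv]; exact hκ s

/-- The meridian is curved except where the tangent angle is `π / 2` modulo `2 π`. -/
lemma curv_neg (h : IsProfile c r z θ κ) (hc : 0 < c) (hr : ∀ s, 0 < r s)
    (hlt : ∀ s, r s * κ s < Real.sin (θ s)) {s : ℝ} (h1 : -(3 * Real.pi / 2) < θ s)
    (h2 : θ s < Real.pi / 2) : κ s < 0 := by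
  refine lt_of_le_of_ne (h.curv_nonpos hc hr hlt s) fun h0 => ?_
  have h3 := h.sin_eq_one hc hr hlt h0
  obtain ⟨k, hk⟩ := Real.sin_eq_one_iff.1 h3
  have hpi := Real.pi_pos
  have hk1 : (k : ℝ) < 0 := by nlinarith
  have hk2 : (-1 : ℝ) < k := by nlinarith
  have : k < 0 := by exact_mod_cast hk1
  have : -1 < k := by exact_mod_cast hk2
  omega

/-- The tangent angle is injective where it is not `π / 2` modulo `2 π`. -/
lemma angle_inj (h : IsProfile c r z θ κ) (hc : 0 < c) (hr : ∀ s, 0 < r s)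
    (hlt : ∀ s, r s * κ s < Real.sin (θ s)) {s t : ℝ} (h1 : -(3 * Real.pi / 2) < θ s)
    (h2 : θ s < Real.pi / 2) (hst : θ s = θ t) : s = t := by
  by_contra hne
  have hanti := h.antitone_angle (h.curv_nonpos hc hr hlt)
  wlog hlt' : s < t generalizing s t
  · exact this (hst ▸ h1) (hst ▸ h2) hst.symm (Ne.symm hne)
      (lt_of_le_of_ne (not_lt.1 hlt') (Ne.symm hne))
  obtain ⟨x, hx, hx'⟩ := exists_hasDerivAt_eq_zero hlt' h.continuous_θ.continuousOn hst
    fun x _ => h.deriv_θ x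
  have h3 : θ x = θ s := le_antisymm (hanti hx.1.le) (hst ▸ hanti hx.2.le)
  have := h.curv_neg hc hr hlt (h3 ▸ h1) (h3 ▸ h2)
  linarith

/-- Followed forward, the meridian turns until its tangent is parallel to the axis: otherwise the
radius would be unbounded or the curvature bounded away from zero. -/
lemma exists_angle_eq_neg_pi_div_two (h : IsProfile c r z θ κ) (hc : 0 < c) (hr : ∀ s, 0 < r s)
    (hlt : ∀ s, r s * κ s < Real.sin (θ s)) {s : ℝ} (h1 : -(Real.pi / 2) ≤ θ s)
    (h2 : θ s < Real.pi / 2) : ∃ t, θ t = -(Real.pi / 2) := by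
  by_contra hcon
  push Not at hcon
  have hpi := Real.pi_pos
  have hanti := h.antitone_angle (h.curv_nonpos hc hr hlt)
  have hgt : ∀ t, s ≤ t → -(Real.pi / 2) < θ t := by
    intro t hst
    by_contra hle
    obtain ⟨x, -, hx⟩ := intermediate_value_Icc' hst h.continuous_θ.continuousOn
      ⟨not_lt.1 hle, h1⟩
    exact hcon x hx
  obtain ⟨t, hst, ht⟩ : ∃ t, s ≤ t ∧ ∀ x, t ≤ x → κ x ≤ -(c / 2) := by
    by_cases hex : ∃ t, s ≤ t ∧ θ t ≤ 0
    · obtain ⟨t, hst, ht⟩ := hex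
      refine ⟨t, hst, fun x hx => ?_⟩
      have hsin : Real.sin (θ x) ≤ 0 := Real.sin_nonpos_of_nonpos_of_neg_pi_le
        ((hanti hx).trans ht) (by linarith [hgt x (hst.trans hx)])
      have e1 := h.eqn x
      have e2 := hlt x
      have e3 := hr x
      have e4 : Real.sin (θ x) ^ 2 ≤ (r x * κ x) ^ 2 := by nlinarith
      have e5 : c ^ 2 * r x ^ 2 ≤ 2 * (κ x ^ 2 * r x ^ 2) := by nlinarith
      have e6 : c ^ 2 ≤ 2 * κ x ^ 2 := by
        have : 0 < r x ^ 2 := by positivity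
        nlinarith
      have := h.curv_nonpos hc hr hlt x
      nlinarith
    · push Not at hex
      have hcosp : 0 < Real.cos (θ s) := Real.cos_pos_of_mem_Ioo ⟨hgt s le_rfl, h2⟩
      have hcos : ∀ x, s ≤ x → Real.cos (θ s) ≤ Real.cos (θ x) := fun x hx =>
        Real.cos_le_cos_of_nonneg_of_le_pi (hex x hx).le (by linarith) (hanti hx)
      have hwait : 0 < 2 / (c * Real.cos (θ s)) := by positivity
      refine ⟨s + 2 / (c * Real.cos (θ s)), by linarith, fun x hx => ?_⟩
      have hsx : s ≤ x := by linarith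
      have e1 := add_mul_le_of_le_deriv h.deriv_r hsx fun y hy _ => hcos y hy.le
      have e2 : 2 / c ≤ Real.cos (θ s) * (x - s) := by
        have : 2 / c = Real.cos (θ s) * (2 / (c * Real.cos (θ s))) := by field_simp
        rw [this]
        exact mul_le_mul_of_nonneg_left (by linarith) hcosp.le
      have e3 : 2 ≤ c * r x := by
        have := hr s
        have : 2 / c ≤ r x := by linarith
        rw [div_le_iff₀ hc] at this
        linarith
      have e4 := h.eqn x
      have e5 := Real.sin_sq_le_one (θ x)
      have e6 : c ^ 2 * r x ^ 2 ≤ 4 * (κ x ^ 2 * r x ^ 2) := by nlinarith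
      have e7 : c ^ 2 ≤ 4 * κ x ^ 2 := by
        have : 0 < r x ^ 2 := by have := hr x; positivity
        nlinarith
      have := h.curv_nonpos hc hr hlt x
      nlinarith
  have hpos : 0 < 2 * Real.pi / (c / 2) := by positivity
  have h3 := le_add_mul_of_deriv_le (b := t + 2 * Real.pi / (c / 2)) h.deriv_θ (by linarith)
    fun x hx _ => ht x hx.le
  have h4 : -(c / 2) * (t + 2 * Real.pi / (c / 2) - t) = -(2 * Real.pi) := by field_simp; ring
  rw [h4] at h3
  have h5 := hgt (t + 2 * Real.pi / (c / 2)) (by linarith)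
  have h6 := hanti hst
  linarith

/-- Followed backward from a point with tangent angle `-π / 2`, the meridian takes all tangent
angles up to `π / 2`: otherwise the radius would become negative. -/
lemma exists_angle_eq (h : IsProfile c r z θ κ) (hc : 0 < c) (hr : ∀ s, 0 < r s)
    (hlt : ∀ s, r s * κ s < Real.sin (θ s)) {s : ℝ} (hs : θ s = -(Real.pi / 2)) {η : ℝ}
    (h1 : -(Real.pi / 2) < η) (h2 : η < Real.pi / 2) : ∃ t, θ t = η := by
  have hpi := Real.pi_pos
  have hanti := h.antitone_angle (h.curv_nonpos hc hr hlt)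
  by_contra hcon
  push Not at hcon
  have hlt' : ∀ t, t ≤ s → θ t < η := by
    intro t ht
    by_contra hle
    obtain ⟨x, -, hx⟩ := intermediate_value_Icc' ht h.continuous_θ.continuousOn
      ⟨hs ▸ h1.le, not_lt.1 hle⟩
    exact hcon x hx
  have hs' : -(Real.pi / 2) < θ (s - 1) := by
    refine lt_of_le_of_ne (hs ▸ hanti (by linarith)) fun h0 => ?_
    have := h.angle_inj hc hr hlt (s := s) (t := s - 1) (by linarith) (by linarith)
      (hs.trans h0)
    linarith
  set e := min (Real.cos (θ (s - 1))) (Real.cos η) with he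
  have he0 : 0 < e := lt_min
    (Real.cos_pos_of_mem_Ioo ⟨hs', (hlt' (s - 1) (by linarith)).trans h2⟩)
    (Real.cos_pos_of_mem_Ioo ⟨h1, h2⟩)
  have hcos : ∀ x, x ≤ s - 1 → e ≤ Real.cos (θ x) := by
    intro x hx
    have a1 := hanti hx
    have a2 := hlt' x (by linarith)
    rcases le_total 0 (θ x) with h0 | h0
    · exact (min_le_right _ _).trans
        (Real.cos_le_cos_of_nonneg_of_le_pi h0 (by linarith) a2.le)
    · refine (min_le_left _ _).trans ?_
      rw [← Real.cos_neg, ← Real.cos_neg (θ x)]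
      exact Real.cos_le_cos_of_nonneg_of_le_pi (by linarith) (by linarith) (by linarith)
  have hpos : 0 < r (s - 1) / e := div_pos (hr _) he0
  have h3 := add_mul_le_of_le_deriv (a := s - 1 - r (s - 1) / e) h.deriv_r
    (by linarith : s - 1 - r (s - 1) / e ≤ s - 1) fun x _ hx => hcos x hx.le
  have h4 : e * (s - 1 - (s - 1 - r (s - 1) / e)) = r (s - 1) := by field_simp; ring
  rw [h4] at h3
  linarith [hr (s - 1 - r (s - 1) / e)]

/-! ### Comparison of heights -/

/-- A right inverse of the tangent angle is differentiable. -/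
lemma hasDerivAt_angle_inverse (h : IsProfile c r z θ κ) (hc : 0 < c) (hr : ∀ s, 0 < r s)
    (hlt : ∀ s, r s * κ s < Real.sin (θ s)) {S : ℝ → ℝ}
    (hS : ∀ η ∈ Set.Ioo (-(Real.pi / 2)) (Real.pi / 2), θ (S η) = η) {η : ℝ}
    (hη : η ∈ Set.Ioo (-(Real.pi / 2)) (Real.pi / 2)) : HasDerivAt S (κ (S η))⁻¹ η := by
  have hpi := Real.pi_pos
  have hanti := h.antitone_angle (h.curv_nonpos hc hr hlt)
  have hη' := hS η hη
  have h1 : -(3 * Real.pi / 2) < θ (S η) := by rw [hη']; linarith [hη.1]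
  have h2 : θ (S η) < Real.pi / 2 := by rw [hη']; exact hη.2
  have hκ := h.curv_neg hc hr hlt h1 h2
  have hcont : ContinuousAt S η := by
    rw [Metric.continuousAt_iff']
    intro ε hε
    have ha : η < θ (S η - ε) := by
      refine lt_of_le_of_ne (hη'.symm.le.trans (hanti (by linarith))) fun h0 => ?_
      have := h.angle_inj hc hr hlt h1 h2 (hη'.trans h0)
      linarith
    have hb : θ (S η + ε) < η := by
      refine lt_of_le_of_ne ((hanti (by linarith)).trans hη'.le) fun h0 => ?_
      have := h.angle_inj hc hr hlt h1 h2 (hη'.trans h0.symm)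
      linarith
    filter_upwards [Ioo_mem_nhds hb ha, Ioo_mem_nhds hη.1 hη.2] with y hy hy'
    rw [Real.dist_eq, abs_lt]
    constructor
    · by_contra hle
      have := hanti (show S y ≤ S η - ε by linarith)
      rw [hS y hy'] at this
      linarith [hy.2]
    · by_contra hle
      have := hanti (show S η + ε ≤ S y by linarith)
      rw [hS y hy'] at this
      linarith [hy.1]
  refine HasDerivAt.of_local_left_inverse hcont (h.deriv_θ (S η)) hκ.ne ?_
  filter_upwards [Ioo_mem_nhds hη.1 hη.2] with y hy using hS y hy

/-- The crucial comparison: between tangent angle `η` and tangent angle `-η` the meridian gains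
height, and the more so the larger `η` is. Indeed the radius is larger at `-η`, so that the
meridian is curved more strongly there and turns through the falling directions faster than
through the rising ones. -/
lemma height_gain (h : IsProfile c r z θ κ) (hc : 0 < c) (hr : ∀ s, 0 < r s)
    (hlt : ∀ s, r s * κ s < Real.sin (θ s)) {S : ℝ → ℝ}
    (hS : ∀ η ∈ Set.Ioo (-(Real.pi / 2)) (Real.pi / 2), θ (S η) = η) :
    StrictMonoOn (fun η => z (S (-η)) - z (S η)) (Set.Ico 0 (Real.pi / 2)) := by
  have hpi := Real.pi_pos
  have hanti := h.antitone_angle (h.curv_nonpos hc hr hlt)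
  have hd : ∀ η ∈ Set.Ioo (-(Real.pi / 2)) (Real.pi / 2),
      HasDerivAt (fun η => z (S (-η)) - z (S η))
        (Real.sin η * ((κ (S (-η)))⁻¹ - (κ (S η))⁻¹)) η := by
    intro η hη
    have hη' : -η ∈ Set.Ioo (-(Real.pi / 2)) (Real.pi / 2) :=
      ⟨by linarith [hη.2], by linarith [hη.1]⟩
    have d1 := (h.deriv_z (S η)).comp η (h.hasDerivAt_angle_inverse hc hr hlt hS hη)
    have d2 := (h.deriv_z (S (-η))).comp (-η) (h.hasDerivAt_angle_inverse hc hr hlt hS hη')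
    have d3 := d2.comp η (hasDerivAt_neg η)
    refine (d3.sub d1).congr_deriv ?_
    rw [hS η hη, hS (-η) hη', Real.sin_neg]
    ring
  have hsub : Set.Ico 0 (Real.pi / 2) ⊆ Set.Ioo (-(Real.pi / 2)) (Real.pi / 2) :=
    fun x hx => ⟨by linarith [hx.1], hx.2⟩
  refine strictMonoOn_of_deriv_pos (convex_Ico 0 (Real.pi / 2))
    (fun η hη => (hd η (hsub hη)).continuousAt.continuousWithinAt) fun η hη => ?_
  rw [interior_Ico] at hη
  have hη1 : η ∈ Set.Ioo (-(Real.pi / 2)) (Real.pi / 2) := hsub ⟨hη.1.le, hη.2⟩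
  have hη2 : -η ∈ Set.Ioo (-(Real.pi / 2)) (Real.pi / 2) :=
    ⟨by linarith [hη.2], by linarith [hη.1]⟩
  rw [(hd η hη1).deriv]
  refine mul_pos (Real.sin_pos_of_pos_of_lt_pi hη.1 (by linarith [hη.2])) (sub_pos.2 ?_)
  have hθ1 := hS η hη1
  have hθ2 := hS (-η) hη2
  have hκ1 := h.curv_neg hc hr hlt (s := S η) (by rw [hθ1]; linarith [hη1.1])
    (by rw [hθ1]; exact hη.2)
  have hκ2 := h.curv_neg hc hr hlt (s := S (-η)) (by rw [hθ2]; linarith [hη2.1])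
    (by rw [hθ2]; exact hη2.2)
  have hSlt : S η < S (-η) := by
    by_contra hle
    have := hanti (not_lt.1 hle)
    rw [hθ1, hθ2] at this
    linarith [hη.1]
  have hrlt : r (S η) < r (S (-η)) := by
    refine strictMonoOn_of_deriv_pos (convex_Icc (S η) (S (-η))) h.continuous_r.continuousOn
      (fun x hx => ?_) (Set.left_mem_Icc.2 hSlt.le) (Set.right_mem_Icc.2 hSlt.le) hSlt
    rw [interior_Icc] at hx
    rw [(h.deriv_r x).deriv]
    have a1 := hanti hx.1.le
    have a2 := hanti hx.2.le
    rw [hθ1] at a1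
    rw [hθ2] at a2
    exact Real.cos_pos_of_mem_Ioo ⟨by linarith [hη2.1], by linarith [hη.2]⟩
  have hk1 := h.curv_sq (hr (S η))
  have hk2 := h.curv_sq (hr (S (-η)))
  rw [hθ1] at hk1
  rw [hθ2, Real.sin_neg, neg_div, neg_sq] at hk2
  have hsin := Real.sin_pos_of_pos_of_lt_pi hη.1 (by linarith [hη.2])
  have hq : Real.sin η / r (S (-η)) < Real.sin η / r (S η) :=
    div_lt_div_of_pos_left hsin (hr _) hrlt
  have hq0 : 0 < Real.sin η / r (S (-η)) := div_pos hsin (hr _)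
  have hsq : κ (S η) ^ 2 < κ (S (-η)) ^ 2 := by rw [hk1, hk2]; nlinarith
  have hlt' : κ (S (-η)) < κ (S η) := by nlinarith
  exact (inv_lt_inv_of_neg hκ1 hκ2).2 hlt'

/-- A meridian which is not straight crosses itself: by reflection in the horizontal line through
its outermost point it suffices that it starts below and passes above this line. -/
lemma exists_crossing_of_angle (h : IsProfile c r z θ κ) (hc : 0 < c) (hr : ∀ s, 0 < r s)
    (hlt : ∀ s, r s * κ s < Real.sin (θ s)) (h0 : θ 0 = -(Real.pi / 2)) (hz : z 0 = 0) :
    ∃ s t, r s = r t ∧ z s = z t ∧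
      Real.cos (θ s) * Real.sin (θ t) - Real.sin (θ s) * Real.cos (θ t) ≠ 0 := by
  have hpi := Real.pi_gt_three
  have hκ := h.curv_nonpos hc hr hlt
  have hanti := h.antitone_angle hκ
  choose! S hS using fun η (hη : η ∈ Set.Ioo (-(Real.pi / 2)) (Real.pi / 2)) =>
    h.exists_angle_eq hc hr hlt h0 hη.1 hη.2
  have hSinj : ∀ s, -(Real.pi / 2) < θ s → θ s < Real.pi / 2 → S (θ s) = s := fun s h1 h2 =>
    (h.angle_inj hc hr hlt (by linarith) h2 (hS _ ⟨h1, h2⟩).symm).symm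
  have hneg : ∀ s, -(Real.pi / 2) < θ s → s < 0 := fun s hs => by
    by_contra hle
    have := hanti (not_lt.1 hle)
    linarith
  have hgain := h.height_gain hc hr hlt hS
  have h1mem : (1 : ℝ) ∈ Set.Ico 0 (Real.pi / 2) := ⟨by norm_num, by linarith⟩
  have h0mem : (0 : ℝ) ∈ Set.Ico 0 (Real.pi / 2) := ⟨le_rfl, by linarith⟩
  have hδ := hgain h0mem h1mem one_pos
  simp only [neg_zero, sub_self] at hδ
  -- A point close to the outermost one, where the tangent angle is `-η` with `η ≥ 1`.
  obtain ⟨s', hs'0, hs'z, hs'θ⟩ : ∃ s' < 0, z s' < z (S (-1)) - z (S 1) ∧ θ s' < -1 := by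
    have e1 : ∀ᶠ s in nhdsWithin (0 : ℝ) (Set.Iio 0), z s < z (S (-1)) - z (S 1) :=
      (h.continuous_z.continuousAt.eventually (gt_mem_nhds (by rw [hz]; exact hδ))).filter_mono
        nhdsWithin_le_nhds
    have e2 : ∀ᶠ s in nhdsWithin (0 : ℝ) (Set.Iio 0), θ s < -1 :=
      (h.continuous_θ.continuousAt.eventually (gt_mem_nhds (by rw [h0]; linarith))).filter_mono
        nhdsWithin_le_nhds
    obtain ⟨s', a1, a2, a3⟩ := (e1.and (e2.and self_mem_nhdsWithin)).exists
    exact ⟨s', a3, a1, a2⟩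
  have hs'θ2 : -(Real.pi / 2) < θ s' := by
    refine lt_of_le_of_ne (h0 ▸ hanti hs'0.le) fun heq => ?_
    have := h.angle_inj hc hr hlt (s := 0) (t := s') (by linarith) (by linarith) (h0.trans heq)
    linarith
  set η := -θ s' with hηdef
  have hη : η ∈ Set.Ico 0 (Real.pi / 2) := ⟨by linarith, by linarith⟩
  have hη' : η ∈ Set.Ioo (-(Real.pi / 2)) (Real.pi / 2) := ⟨by linarith, hη.2⟩
  have hlow : z (S η) < 0 := by
    have e1 := hgain.monotoneOn h1mem hη (by linarith)
    rw [show S (-η) = s' by rw [hηdef, neg_neg]; exact hSinj s' hs'θ2 (by linarith)] at e1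
    linarith
  have hS0 : θ (S 0) = 0 := hS 0 ⟨by linarith, by linarith⟩
  have hS0neg : S 0 < 0 := hneg _ (by rw [hS0]; linarith)
  have hhigh : 0 < z (S 0) := by
    have : z 0 < z (S 0) := by
      refine strictAntiOn_of_deriv_neg (convex_Icc (S 0) 0) h.continuous_z.continuousOn
        (fun x hx => ?_) (Set.left_mem_Icc.2 hS0neg.le) (Set.right_mem_Icc.2 hS0neg.le) hS0neg
      rw [interior_Icc] at hx
      rw [(h.deriv_z x).deriv]
      have a1 := hanti hx.1.le
      have a2 := hanti hx.2.le
      rw [hS0] at a1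
      rw [h0] at a2
      refine Real.sin_neg_of_neg_of_neg_pi_lt (lt_of_le_of_ne a1 fun heq => ?_) (by linarith)
      have := h.angle_inj hc hr hlt (s := S 0) (t := x) (by linarith) (by linarith)
        (hS0.trans heq.symm)
      linarith [hx.1]
    rwa [hz] at this
  have hSη := hS η hη'
  have hSle : S η ≤ S 0 := by
    by_contra hle
    have := hanti (not_le.1 hle).le
    rw [hSη, hS0] at this
    linarith
  obtain ⟨t, ht, htz⟩ := intermediate_value_Ioo hSle h.continuous_z.continuousOn
    (show (0 : ℝ) ∈ Set.Ioo (z (S η)) (z (S 0)) from ⟨hlow, hhigh⟩)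
  have ht0 : t < 0 := ht.2.trans hS0neg
  have htθ1 : θ t ≤ η := hSη ▸ hanti ht.1.le
  have htθ0 : 0 < θ t := by
    refine lt_of_le_of_ne (hS0 ▸ hanti ht.2.le) fun heq => ?_
    have := h.angle_inj hc hr hlt (s := S 0) (t := t) (by linarith) (by linarith)
      (hS0.trans heq)
    linarith [ht.2]
  -- The meridian is symmetric with respect to the horizontal line through its outermost point.
  have hsym := h.unique h.reflect hc hr (fun s => hr (-s)) hκ (T := -t)
    (fun s hs => h.curv_neg hc hr hlt (by
      have := hanti (show -s ≤ 0 by linarith [hs.1])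
      linarith) (by
      have := hanti (show t ≤ -s by linarith [hs.2])
      linarith [hη.2])) (by simp) (by simp only [neg_zero]; rw [h0]; ring)
  have hzsym : z (-t) = -z t := by
    have hd : ∀ s, HasDerivAt (fun s => z s + z (-s)) (Real.sin (θ s) - Real.sin (θ (-s))) s :=
      fun s => ((h.deriv_z s).add ((h.deriv_z (-s)).comp s (hasDerivAt_neg s))).congr_deriv
        (by ring)
    have hd0 : ∀ s, 0 < s → s < -t → Real.sin (θ s) - Real.sin (θ (-s)) = 0 := fun s h1 h2 => by
      rw [(hsym s ⟨h1.le, h2.le⟩).2, show -Real.pi - θ (-s) = -(θ (-s) + Real.pi) by ring,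
        Real.sin_neg, Real.sin_add_pi]
      ring
    have a1 := le_add_mul_of_deriv_le (a := 0) (b := -t) (K := 0) hd (by linarith)
      fun s h1 h2 => (hd0 s h1 h2).le
    have a2 := add_mul_le_of_le_deriv (a := 0) (b := -t) (K := 0) hd (by linarith)
      fun s h1 h2 => (hd0 s h1 h2).ge
    simp only [neg_zero, neg_neg, hz] at a1 a2
    linarith
  obtain ⟨hr1, hθ1⟩ := hsym (-t) ⟨by linarith, le_rfl⟩
  simp only [neg_neg] at hr1 hθ1
  refine ⟨t, -t, hr1.symm, by rw [hzsym, htz, neg_zero], ?_⟩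
  rw [hθ1, show -Real.pi - θ t = -(θ t + Real.pi) by ring, Real.sin_neg, Real.cos_neg,
    Real.sin_add_pi, Real.cos_add_pi]
  have hsin := Real.sin_pos_of_pos_of_lt_pi htθ0 (by linarith [hη.2])
  have hcos := Real.cos_pos_of_mem_Ioo (x := θ t) ⟨by linarith, by linarith [hη.2]⟩
  have := mul_pos hsin hcos
  intro hcon
  nlinarith

/-- The orientation in which the principal curvature of the meridian is the smaller one. -/
lemma straight_or_crossing_of_lt (h : IsProfile c r z θ κ) (hc : 0 < c) (hr : ∀ s, 0 < r s)
    (hlt : ∀ s, r s * κ s < Real.sin (θ s)) :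
    (∀ s, κ s = 0) ∨ ∃ s t, r s = r t ∧ z s = z t ∧
      Real.cos (θ s) * Real.sin (θ t) - Real.sin (θ s) * Real.cos (θ t) ≠ 0 := by
  rw [or_iff_not_imp_left]
  intro hne
  push Not at hne
  obtain ⟨s₀, hs₀⟩ := hne
  have hpi := Real.pi_pos
  -- A point where the tangent angle is not `π / 2` modulo `2 π`.
  obtain ⟨s₁, hs₁⟩ : ∃ s, Real.sin (θ s) ≠ 1 := by
    by_contra hcon
    push Not at hcon
    have hcos : ∀ s, Real.cos (θ s) = 0 := fun s => by
      have := Real.sin_sq_add_cos_sq (θ s)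
      rw [hcon s] at this
      nlinarith
    have hd := h.deriv_cos s₀
    simp only [hcos, hcon] at hd
    have := hd.unique (hasDerivAt_const s₀ (0 : ℝ))
    apply hs₀
    linarith
  -- Normalize the tangent angle to lie in `(-3π/2, π/2)`.
  obtain ⟨m, hm⟩ : ∃ m : ℤ, θ s₁ + m * (2 * Real.pi) ∈
      Set.Ico (-(3 * Real.pi / 2)) (-(3 * Real.pi / 2) + 2 * Real.pi) := by
    obtain ⟨m, hm, -⟩ := existsUnique_add_zsmul_mem_Ico (by positivity : 0 < 2 * Real.pi) (θ s₁)
      (-(3 * Real.pi / 2))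
    exact ⟨m, by simpa using hm⟩
  have hlt1 : ∀ s, r s * κ s < Real.sin (θ s + m * (2 * Real.pi)) := fun s => by
    rw [Real.sin_add_int_mul_two_pi]; exact hlt s
  have h1 := h.shift_angle m
  have hmne : θ s₁ + m * (2 * Real.pi) ≠ -(3 * Real.pi / 2) := by
    intro heq
    apply hs₁
    rw [← Real.sin_add_int_mul_two_pi _ m, heq,
      show -(3 * Real.pi / 2) = Real.pi / 2 - 2 * Real.pi by ring, Real.sin_sub_two_pi,
      Real.sin_pi_div_two]
  have hm1 : -(3 * Real.pi / 2) < θ s₁ + m * (2 * Real.pi) := lt_of_le_of_ne hm.1 hmne.symm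
  have hm2 : θ s₁ + m * (2 * Real.pi) < Real.pi / 2 := by linarith [hm.2]
  -- A point with tangent angle `-π / 2`, found forward or backward.
  obtain ⟨t, ht⟩ : ∃ t, θ t + m * (2 * Real.pi) = -(Real.pi / 2) := by
    rcases le_total (-(Real.pi / 2)) (θ s₁ + m * (2 * Real.pi)) with hle | hle
    · exact h1.exists_angle_eq_neg_pi_div_two hc hr hlt1 hle hm2
    · obtain ⟨t, ht⟩ := h1.reflect.exists_angle_eq_neg_pi_div_two hc (fun s => hr (-s))
        (fun s => by
          rw [show -Real.pi - (θ (-s) + m * (2 * Real.pi))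
            = -(θ (-s) + m * (2 * Real.pi) + Real.pi) by ring, Real.sin_neg, Real.sin_add_pi,
            neg_neg]
          exact hlt1 (-s)) (s := -s₁) (by rw [neg_neg]; linarith) (by rw [neg_neg]; linarith)
      exact ⟨-t, by linarith⟩
  have h2 := h1.translate t
  have h3 : IsProfile c (fun s => r (s + t)) (fun s => z (s + t) - z t)
      (fun s => θ (s + t) + m * (2 * Real.pi)) (fun s => κ (s + t)) :=
    ⟨h2.deriv_r, fun s => (h2.deriv_z s).sub_const _, h2.deriv_θ, h2.cont, h2.eqn⟩
  obtain ⟨x, y, hx1, hx2, hx3⟩ := h3.exists_crossing_of_angle hc (fun s => hr _)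
    (fun s => hlt1 _) (by simpa using ht) (by simp)
  refine ⟨x + t, y + t, hx1, by simpa using hx2, ?_⟩
  simpa only [Real.sin_add_int_mul_two_pi, Real.cos_add_int_mul_two_pi] using hx3

/-- A profile off the axis whose principal curvatures never agree is a straight line parallel to
the axis, or it crosses itself transversally. -/
theorem straight_or_crossing (h : IsProfile c r z θ κ) (hc : 0 < c) (hr : ∀ s, 0 < r s)
    (hne : ∀ s, r s * κ s ≠ Real.sin (θ s)) :
    (∀ s, Real.cos (θ s) = 0 ∧ c * r s = 1) ∨ ∃ s t, r s = r t ∧ z s = z t ∧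
      Real.cos (θ s) * Real.sin (θ t) - Real.sin (θ s) * Real.cos (θ t) ≠ 0 := by
  have hcont : Continuous fun s => Real.sin (θ s) - r s * κ s :=
    (Real.continuous_sin.comp h.continuous_θ).sub (h.continuous_r.mul h.cont)
  have key : (∀ s, κ s = 0) ∨ ∃ s t, r s = r t ∧ z s = z t ∧
      Real.cos (θ s) * Real.sin (θ t) - Real.sin (θ s) * Real.cos (θ t) ≠ 0 := by
    have hsign : (∀ s, 0 < Real.sin (θ s) - r s * κ s) ∨
        ∀ s, Real.sin (θ s) - r s * κ s < 0 := by
      by_contra hcon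
      push Not at hcon
      obtain ⟨⟨a, ha⟩, ⟨b, hb⟩⟩ := hcon
      obtain ⟨x, hx⟩ := mem_range_of_exists_le_of_exists_ge hcont ⟨a, ha⟩ ⟨b, hb⟩
      exact hne x (sub_eq_zero.1 hx).symm
    rcases hsign with hlt | hlt
    · exact h.straight_or_crossing_of_lt hc hr fun s => sub_pos.1 (hlt s)
    · rcases h.reverse.straight_or_crossing_of_lt hc (fun s => hr (-s)) (fun s => by
        rw [Real.sin_add_pi]; linarith [hlt (-s)]) with h1 | ⟨s, t, h1, h2, h3⟩
      · exact Or.inl fun s => by simpa using h1 (-s)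
      · refine Or.inr ⟨-s, -t, h1, h2, ?_⟩
        simpa only [Real.sin_add_pi, Real.cos_add_pi, neg_mul_neg] using h3
  refine key.imp_left fun hκ s => ⟨h.cos_eq_zero hc (hr s).ne' (hκ s), ?_⟩
  have h1 := h.eqn s
  have h2 := Real.sin_sq_add_cos_sq (θ s)
  rw [h.cos_eq_zero hc (hr s).ne' (hκ s)] at h2
  rw [hκ s] at h1
  have h3 : (c * r s) ^ 2 = 1 := by linarith
  have h4 : 0 < c * r s := mul_pos hc (hr s)
  nlinarith

end IsProfile

/-! ### Tangent vectors of a rotational surface -/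

/-- The velocity of a curve in `M` is orthogonal to every normal vector `m` of `M`. -/
lemma IsLocalParam.inner_velocity {M : Set E3} {U : Set E2} {X : E2 → E3}
    (h : IsLocalParam M U X) {u : E2} (hu : u ∈ U) {m : E3}
    (hm : ∀ w, inner ℝ m (fderiv ℝ X u w) = 0) {γ : ℝ → E3} {v : E3} (hγ : HasDerivAt γ v 0)
    (h0 : γ 0 = X u) (hγM : ∀ᶠ t in nhds (0 : ℝ), γ t ∈ M) : inner ℝ m v = 0 := by
  have hX := h.hasFDerivAt hu
  -- Along the surface, the displacement in the direction `m` is of second order.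
  have h1 : (fun y => inner ℝ m (X y - X u)) =o[nhds u] fun y => X y - X u := by
    have hanti : ∃ K > 0, ∀ w, ‖w‖ ≤ K * ‖fderiv ℝ X u w‖ := by
      obtain ⟨K, hK, hK'⟩ := (fderiv ℝ X u).toLinearMap.exists_antilipschitzWith
        (LinearMap.ker_eq_bot.2 (h.immersion u hu))
      refine ⟨K, hK, fun w => ?_⟩
      have := hK'.le_mul_dist w 0
      simpa using this
    obtain ⟨K, hK, hK'⟩ := hanti
    have h2 : (fun y => inner ℝ m (X y - X u)) =o[nhds u] fun y => y - u := by
      have h3 := (innerSL ℝ m).hasFDerivAt.comp u hX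
      have h4 := h3.isLittleO
      refine h4.congr_left fun y => ?_
      simp [hm, inner_sub_right]
    refine h2.trans_isBigO ?_
    have h5 := hX.isLittleO.def (show (0 : ℝ) < 1 / (2 * K) by positivity)
    refine Asymptotics.IsBigO.of_bound (2 * K) (h5.mono fun y hy => ?_)
    have h6 := hK' (y - u)
    have h7 : ‖fderiv ℝ X u (y - u)‖ ≤ ‖X y - X u‖ + 1 / (2 * K) * ‖y - u‖ := by
      have := norm_sub_le (X y - X u) (X y - X u - fderiv ℝ X u (y - u))
      rw [sub_sub_cancel] at this
      linarith
    have h8 : K * ‖fderiv ℝ X u (y - u)‖ ≤ K * ‖X y - X u‖ + ‖y - u‖ / 2 := by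
      calc K * ‖fderiv ℝ X u (y - u)‖ ≤ K * (‖X y - X u‖ + 1 / (2 * K) * ‖y - u‖) :=
            mul_le_mul_of_nonneg_left h7 hK.le
        _ = _ := by field_simp
    linarith
  have h2 : (fun p => inner ℝ m (p - X u)) =o[nhdsWithin (X u) M] fun p => p - X u := by
    rw [← h.map_nhds hu, Asymptotics.isLittleO_map]
    exact h1
  have h3 : Filter.Tendsto γ (nhds 0) (nhdsWithin (X u) M) :=
    tendsto_nhdsWithin_iff.2 ⟨h0 ▸ hγ.continuousAt.tendsto, hγM⟩
  have h3' : (fun t => γ t - X u) =O[nhds 0] fun t : ℝ => t - 0 := h0 ▸ hγ.isBigO_sub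
  have h4 := (h2.comp_tendsto h3).trans_isBigO h3'
  have h5 : HasDerivAt (fun t => inner ℝ m (γ t)) 0 0 := by
    rw [hasDerivAt_iff_isLittleO]
    refine h4.congr_left fun t => ?_
    simp [h0, inner_sub_right]
  have h6 := ((innerSL ℝ m).hasFDerivAt.comp_hasDerivAt (0 : ℝ) hγ).unique h5
  simpa using h6

/-- The linear rotation by the angle `t` about the axis `b 0`. -/
noncomputable def rot (b : OrthonormalBasis (Fin 3) ℝ E3) (t : ℝ) (w : E3) : E3 :=
  inner ℝ (b 0) w • b 0
    + (Real.cos t * inner ℝ (b 1) w - Real.sin t * inner ℝ (b 2) w) • b 1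
    + (Real.sin t * inner ℝ (b 1) w + Real.cos t * inner ℝ (b 2) w) • b 2

/-- `M` is invariant under the rotations about the line through `a` in the direction `b 0`. -/
def IsRotationalAbout (M : Set E3) (a : E3) (b : OrthonormalBasis (Fin 3) ℝ E3) : Prop :=
  ∀ t, ∀ p ∈ M, a + rot b t (p - a) ∈ M

lemma IsRotational.exists_axis {M : Set E3} (h : IsRotational M) :
    ∃ a b, IsRotationalAbout M a b := by
  obtain ⟨a, b, h⟩ := h
  refine ⟨a, b, fun t p hp => ?_⟩
  have := h t (inner ℝ (b 0) (p - a)) (inner ℝ (b 1) (p - a)) (inner ℝ (b 2) (p - a)) (by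
    rw [add_assoc, add_assoc, ← add_assoc (_ • b 0), ← eq_sum_coords, add_sub_cancel]
    exact hp)
  simpa only [rot, add_assoc] using this

/-- The tangent plane of a rotational surface at a point of the half-plane spanned by `b 0, b 1`
contains `b 2`: off the axis, `b 2` is the velocity of the rotation; on the axis, the tangent plane
is invariant under all rotations, hence is orthogonal to the axis. -/
lemma IsLocalParam.normal_of_rotational {M : Set E3} {U : Set E2} {X : E2 → E3}
    (h : IsLocalParam M U X) {a : E3} {b : OrthonormalBasis (Fin 3) ℝ E3}
    (hrot : IsRotationalAbout M a b) {u : E2} (hu : u ∈ U) (h2 : inner ℝ (b 2) (X u - a) = 0)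
    {m : E3} (hm : ∀ w, inner ℝ m (fderiv ℝ X u w) = 0) :
    inner ℝ m (b 2) = 0 ∧ (inner ℝ (b 1) (X u - a) = 0 → inner ℝ m (b 1) = 0) := by
  by_cases h1 : inner ℝ (b 1) (X u - a) = 0
  · -- On the axis.
    have key : ∀ t w, inner ℝ m (rot b t (fderiv ℝ X u w)) = 0 := by
      intro t w
      have hl : HasDerivAt (fun x : ℝ => u + x • w) w 0 := by
        simpa using ((hasDerivAt_id (0 : ℝ)).smul_const w).const_add u
      have hl0 : u + (0 : ℝ) • w = u := by simp
      have hX : HasDerivAt (fun x : ℝ => X (u + x • w)) (fderiv ℝ X u w) 0 := by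
        have := h.hasFDerivAt hu
        rw [← hl0] at this
        have h3 := this.comp_hasDerivAt (0 : ℝ) hl
        rw [hl0] at h3
        exact h3
      have hi : ∀ i, HasDerivAt (fun x : ℝ => inner ℝ (b i) (X (u + x • w) - a))
          (inner ℝ (b i) (fderiv ℝ X u w)) 0 := fun i =>
        ((innerSL ℝ (b i)).hasFDerivAt.comp_hasDerivAt (0 : ℝ) (hX.sub_const a))
      refine h.inner_velocity hu hm (γ := fun x => a + rot b t (X (u + x • w) - a)) ?_ ?_ ?_
      · exact (((((hi 0).smul_const (b 0)).add
          ((((hi 1).const_mul _).sub ((hi 2).const_mul _)).smul_const (b 1)))).add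
          ((((hi 1).const_mul _).add ((hi 2).const_mul _)).smul_const (b 2))).const_add a
      · simp only [zero_smul, add_zero, rot, h1, h2, mul_zero, sub_zero]
        have := eq_sum_coords b (X u - a)
        rw [h1, h2, zero_smul, add_zero, zero_smul, add_zero] at this
        rw [← this, add_sub_cancel]
      · have hc : Filter.Tendsto (fun x : ℝ => u + x • w) (nhds 0) (nhds u) := by
          have := hl.continuousAt.tendsto
          rwa [hl0] at this
        filter_upwards [hc.eventually (h.isOpen.mem_nhds hu)] with x hx
        exact hrot t _ (h.image_subset hx)
    -- Some tangent vector is not parallel to the axis.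
    obtain ⟨w, hw⟩ : ∃ w, inner ℝ (b 1) (fderiv ℝ X u w) ≠ 0
        ∨ inner ℝ (b 2) (fderiv ℝ X u w) ≠ 0 := by
      by_contra hcon
      push Not at hcon
      have hli := linearIndependent_pd (h.immersion u hu)
      rw [LinearIndependent.pair_iff] at hli
      have e : ∀ w, fderiv ℝ X u w = inner ℝ (b 0) (fderiv ℝ X u w) • b 0 := fun w => by
        conv_lhs => rw [eq_sum_coords b (fderiv ℝ X u w), (hcon w).1, (hcon w).2]
        simp
      have := hli (-inner ℝ (b 0) (pd X 1 u)) (inner ℝ (b 0) (pd X 0 u)) (by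
        unfold pd
        rw [e (EuclideanSpace.single 0 1), e (EuclideanSpace.single 1 1)]
        simp only [inner_smul_right, inner_basis, smul_smul, ← add_smul]
        simp [mul_comm])
      have h0 := (linearIndependent_pd (h.immersion u hu)).ne_zero 0
      apply h0
      have e0 := e (EuclideanSpace.single 0 1)
      simp only [pd] at this
      simp only [Matrix.cons_val_zero, pd]
      rw [e0, this.2, zero_smul]
    have k1 := key 0 w
    have k2 := key Real.pi w
    have k3 := key (Real.pi / 2) w
    have k4 := key (-(Real.pi / 2)) w
    simp [rot, inner_add_right, inner_smul_right] at k1 k2 k3 k4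
    set y := inner ℝ (b 1) (fderiv ℝ X u w)
    set z := inner ℝ (b 2) (fderiv ℝ X u w)
    set m1 := inner ℝ m (b 1)
    set m2 := inner ℝ m (b 2)
    have l1 : y * m1 + z * m2 = 0 := by linarith
    have l2 : y * m2 - z * m1 = 0 := by linarith
    have hpos : 0 < y ^ 2 + z ^ 2 := by
      rcases hw with hw | hw
      · have := sq_pos_of_ne_zero hw; nlinarith [sq_nonneg z]
      · have := sq_pos_of_ne_zero hw; nlinarith [sq_nonneg y]
    have l3 : (y ^ 2 + z ^ 2) * m1 = 0 := by linear_combination y * l1 - z * l2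
    have l4 : (y ^ 2 + z ^ 2) * m2 = 0 := by linear_combination z * l1 + y * l2
    exact ⟨(mul_eq_zero.1 l4).resolve_left hpos.ne', fun _ =>
      (mul_eq_zero.1 l3).resolve_left hpos.ne'⟩
  · refine ⟨?_, fun h => absurd h h1⟩
    have := h.inner_velocity hu hm (γ := fun t => a + rot b t (X u - a))
      (v := inner ℝ (b 1) (X u - a) • b 2) ?_ ?_ ?_
    · rw [inner_smul_right] at this
      exact (mul_eq_zero.1 this).resolve_left h1
    · simp only [rot, h2, mul_zero, sub_zero, add_zero]
      have hc := ((Real.hasDerivAt_cos 0).mul_const (inner ℝ (b 1) (X u - a))).smul_const (b 1)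
      have hs := ((Real.hasDerivAt_sin 0).mul_const (inner ℝ (b 1) (X u - a))).smul_const (b 2)
      refine (((hc.const_add (inner ℝ (b 0) (X u - a) • b 0)).add hs).const_add a).congr_deriv ?_
      simp
    · have := eq_sum_coords b (X u - a)
      simp only [rot, h2, Real.cos_zero, Real.sin_zero, one_mul, zero_mul, mul_zero, sub_zero,
        add_zero]
      rw [h2] at this
      rw [← this, add_sub_cancel]
    · exact Filter.Eventually.of_forall fun t => hrot t _ (h.image_subset hu)

/-! ### Charts of the meridian set -/

lemma exists_local_inverse {E F : Type*} [NormedAddCommGroup E] [NormedSpace ℝ E] [CompleteSpace E]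
    [NormedAddCommGroup F] [NormedSpace ℝ F] {f : E → F} {a : E} {f' : E ≃L[ℝ] F}
    (hf : ContDiffAt ℝ 2 f a) (hf' : HasFDerivAt f (f' : E →L[ℝ] F) a) :
    ∃ g : F → E, ContDiffAt ℝ 2 g (f a) ∧ g (f a) = a ∧ (∀ᶠ x in nhds a, g (f x) = x) ∧
      ∀ᶠ y in nhds (f a), f (g y) = y :=
  ⟨hf.localInverse hf' (by norm_num), hf.to_localInverse hf' (by norm_num),
    hf.localInverse_apply_image hf' (by norm_num),
    (hf.hasStrictFDerivAt' hf' (by norm_num)).eventually_left_inverse,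
    (hf.hasStrictFDerivAt' hf' (by norm_num)).eventually_right_inverse⟩

/-- A `C²` chart of a one-dimensional set `Q`: on the open set `W`, the set `Q` is parametrized by
`β : (-δ, δ) → Q ∩ W`, whose inverse is the restriction of a `C¹` function `σ` on `W`. -/
structure IsCurveChart (Q W : Set E3) (δ : ℝ) (β : ℝ → E3) (σ : E3 → ℝ) : Prop where
  pos : 0 < δ
  isOpen : IsOpen W
  contDiffOn : ContDiffOn ℝ 2 β (Set.Ioo (-δ) δ)
  contDiffOn_inv : ContDiffOn ℝ 1 σ W
  mem : ∀ x ∈ Set.Ioo (-δ) δ, β x ∈ Q ∩ W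
  left_inv : ∀ x ∈ Set.Ioo (-δ) δ, σ (β x) = x
  inv_mem : ∀ p ∈ Q ∩ W, σ p ∈ Set.Ioo (-δ) δ
  right_inv : ∀ p ∈ Q ∩ W, β (σ p) = p

lemma IsCurveChart.hasDerivAt {Q W : Set E3} {δ : ℝ} {β : ℝ → E3} {σ : E3 → ℝ}
    (h : IsCurveChart Q W δ β σ) {x : ℝ} (hx : x ∈ Set.Ioo (-δ) δ) :
    HasDerivAt β (deriv β x) x :=
  ((h.contDiffOn.contDiffAt (Ioo_mem_nhds hx.1 hx.2)).differentiableAt (by norm_num)).hasDerivAt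

lemma IsCurveChart.deriv_ne_zero {Q W : Set E3} {δ : ℝ} {β : ℝ → E3} {σ : E3 → ℝ}
    (h : IsCurveChart Q W δ β σ) {x : ℝ} (hx : x ∈ Set.Ioo (-δ) δ) : deriv β x ≠ 0 := by
  intro h0
  have h1 : DifferentiableAt ℝ σ (β x) :=
    (h.contDiffOn_inv.contDiffAt (h.isOpen.mem_nhds (h.mem x hx).2)).differentiableAt (by norm_num)
  have h2 := h1.hasFDerivAt.comp_hasDerivAt x (h.hasDerivAt hx)
  have h3 : HasDerivAt (σ ∘ β) 1 x := (hasDerivAt_id x).congr_of_eventuallyEq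
    (Filter.eventually_of_mem (Ioo_mem_nhds hx.1 hx.2) fun y hy => h.left_inv y hy)
  have := h2.unique h3
  rw [h0, map_zero] at this
  exact zero_ne_one this

/-- The points of `M` in the plane through the axis spanned by `b 0` and `b 1`. -/
def meridianSet (M : Set E3) (a : E3) (b : OrthonormalBasis (Fin 3) ℝ E3) : Set E3 :=
  {p | p ∈ M ∧ inner ℝ (b 2) (p - a) = 0}

/-- The meridian set of a rotational surface is a one-dimensional `C²` submanifold, and it meets
the axis orthogonally: near a point of it, the surface is a graph over its tangent plane, which
contains `b 2`. -/
lemma exists_chart_meridianSet {M : Set E3} (hs : IsEmbeddedC2Surface M) {a : E3}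
    {b : OrthonormalBasis (Fin 3) ℝ E3} (hrot : IsRotationalAbout M a b) {q : E3}
    (hq : q ∈ meridianSet M a b) :
    ∃ W δ β σ, IsCurveChart (meridianSet M a b) W δ β σ ∧ β 0 = q ∧
      (inner ℝ (b 1) (q - a) = 0 → inner ℝ (b 0) (deriv β 0) = 0) := by
  obtain ⟨hqM, hq2⟩ := hq
  obtain ⟨U, X, hX, u, hu, rfl⟩ := hs q hqM
  -- The unit normal at the point, and the unit tangent vector `e` in the plane.
  obtain ⟨n, hn, hn1⟩ : ∃ n : E3, (∀ w, inner ℝ n (fderiv ℝ X u w) = 0) ∧ ‖n‖ = 1 := by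
    have hlt : Module.finrank ℝ (LinearMap.range (fderiv ℝ X u).toLinearMap)
        < Module.finrank ℝ E3 := by
      refine (LinearMap.finrank_range_le _).trans_lt ?_
      simp
    have hne : (LinearMap.range (fderiv ℝ X u).toLinearMap)ᗮ ≠ ⊥ := by
      intro h0
      have := Submodule.finrank_add_finrank_orthogonal
        (LinearMap.range (fderiv ℝ X u).toLinearMap)
      rw [h0, finrank_bot] at this
      omega
    obtain ⟨m, hm, hm0⟩ := Submodule.exists_mem_ne_zero_of_ne_bot hne
    refine ⟨‖m‖⁻¹ • m, fun w => ?_, by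
      rw [norm_smul, norm_inv, norm_norm, inv_mul_cancel₀ (norm_ne_zero_iff.2 hm0)]⟩
    rw [inner_smul_left, real_inner_comm]
    have := (Submodule.mem_orthogonal _ _).1 hm (fderiv ℝ X u w) ⟨w, rfl⟩
    simp [this]
  obtain ⟨hnb2, hnb1⟩ := hX.normal_of_rotational hrot hu hq2 hn
  set n0 := inner ℝ (b 0) n with hn0
  set n1 := inner ℝ (b 1) n with hn1'
  have hn2 : inner ℝ (b 2) n = 0 := by rw [real_inner_comm]; exact hnb2
  have hnsq : n0 ^ 2 + n1 ^ 2 = 1 := by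
    have := norm_sq_eq_sum b n
    rw [hn1, hn2] at this
    linarith
  set e : E3 := (-n1) • b 0 + n0 • b 1 with he
  have hfr : ∀ v : E3, inner ℝ e v = 0 → inner ℝ n v = 0 → inner ℝ (b 2) v = 0 → v = 0 := by
    intro v h1 h2 h3
    have hnv : n = n0 • b 0 + n1 • b 1 := by
      conv_lhs => rw [eq_sum_coords b n, hn2, zero_smul, add_zero]
    rw [hnv, inner_add_left, real_inner_smul_left, real_inner_smul_left] at h2
    rw [he, inner_add_left, real_inner_smul_left, real_inner_smul_left] at h1
    have h4 : inner ℝ (b 0) v = 0 := by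
      linear_combination (-n1) * h1 + n0 * h2 - inner ℝ (b 0) v * hnsq
    have h5 : inner ℝ (b 1) v = 0 := by
      linear_combination n0 * h1 + n1 * h2 - inner ℝ (b 1) v * hnsq
    rw [eq_sum_coords b v, h3, h4, h5]
    simp
  -- The projection of the surface to the tangent plane.
  set P : E3 →L[ℝ] ℝ × ℝ := (innerSL ℝ e).prod (innerSL ℝ (b 2)) with hP
  have hPa : ∀ v, P v = (inner ℝ e v, inner ℝ (b 2) v) := fun v => rfl
  set f : E2 → ℝ × ℝ := fun w => P (X w - X u) with hf
  have hfX : HasFDerivAt f (P.comp (fderiv ℝ X u)) u :=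
    P.hasFDerivAt.comp u ((hX.hasFDerivAt hu).sub_const (X u))
  have hinj : Function.Injective (P.comp (fderiv ℝ X u)) := by
    rw [injective_iff_map_eq_zero]
    intro w hw
    rw [ContinuousLinearMap.comp_apply, hPa, Prod.mk_eq_zero] at hw
    have := hfr _ hw.1 (hn w) hw.2
    exact hX.immersion u hu (this.trans (map_zero _).symm)
  set f' : E2 ≃L[ℝ] ℝ × ℝ := (LinearEquiv.ofInjectiveOfFinrankEq
    (P.comp (fderiv ℝ X u)).toLinearMap hinj (by simp)).toContinuousLinearEquiv with hf'
  have hfC : ContDiffAt ℝ 2 f u := P.contDiff.contDiffAt.comp u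
    ((hX.contDiffOn.contDiffAt (hX.isOpen.mem_nhds hu)).sub contDiffAt_const)
  obtain ⟨g, hgC, hgu, hgl, hgr⟩ := exists_local_inverse (f' := f') hfC
    (hfX.congr_fderiv (by ext w : 1; rfl))
  have hfu : f u = (0, 0) := by simp [hf, Prod.zero_eq_mk]
  rw [hfu] at hgC hgu hgr
  set β : ℝ → E3 := fun x => X (g (x, 0)) with hβ
  have hβ0 : β 0 = X u := by simp only [hβ, hgu]
  have hι : ContDiff ℝ 2 fun x : ℝ => ((x, 0) : ℝ × ℝ) := by fun_prop
  have hβC : ContDiffAt ℝ 2 β 0 := by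
    have h1 : ContDiffAt ℝ 2 (fun x : ℝ => g (x, 0)) 0 :=
      ContDiffAt.comp (0 : ℝ) hgC hι.contDiffAt
    refine ContDiffAt.comp (0 : ℝ) ?_ h1
    simp only [hgu]
    exact hX.contDiffOn.contDiffAt (hX.isOpen.mem_nhds hu)
  -- The neighbourhood on which the points of `M` in the plane lie on the curve.
  have hW0 : ∀ᶠ p in nhdsWithin (X u) M,
      inner ℝ (b 2) (p - a) = 0 → β (inner ℝ e (p - X u)) = p := by
    rw [← hX.map_nhds hu, Filter.eventually_map]
    filter_upwards [hgl] with w hw hw2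
    have : f w = (inner ℝ e (X w - X u), 0) := by
      simp only [hf, hPa, Prod.mk.injEq, true_and]
      rw [← sub_sub_sub_cancel_right _ _ a, inner_sub_right, hw2, hq2, sub_zero]
    simp only [hβ]
    rw [← this, hw]
  obtain ⟨W₀, hW₀, hW₀o, hqW₀⟩ := eventually_nhds_iff.1 (eventually_nhdsWithin_iff.1 hW0)
  have hιt : Filter.Tendsto (fun x : ℝ => ((x, 0) : ℝ × ℝ)) (nhds 0) (nhds (0, 0)) :=
    hι.continuous.tendsto 0
  have hev : ∀ᶠ x in nhds (0 : ℝ), ContDiffAt ℝ 2 β x ∧ β x ∈ W₀ ∧ g (x, 0) ∈ U ∧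
      f (g (x, 0)) = (x, 0) := by
    refine (hβC.eventually (by norm_num)).and
      ((hβC.continuousAt.eventually (hW₀o.mem_nhds (hβ0 ▸ hqW₀))).and
      (Filter.Eventually.and ?_ (hιt.eventually hgr)))
    have h1 : ContinuousAt (fun x : ℝ => g (x, 0)) 0 :=
      ContinuousAt.comp (f := fun x : ℝ => ((x, 0) : ℝ × ℝ)) hgC.continuousAt hι.continuous.continuousAt
    refine h1.eventually (hX.isOpen.mem_nhds ?_)
    simp only [hgu]
    exact hu
  obtain ⟨δ, hδ, hball⟩ := Metric.eventually_nhds_iff_ball.1 hev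
  have hball' : ∀ x ∈ Set.Ioo (-δ) δ, ContDiffAt ℝ 2 β x ∧ β x ∈ W₀ ∧ g (x, 0) ∈ U ∧
      f (g (x, 0)) = (x, 0) := fun x hx => hball x (by
    rw [Metric.mem_ball, Real.dist_eq, sub_zero, abs_lt]; exact hx)
  have hβe : ∀ x ∈ Set.Ioo (-δ) δ, inner ℝ e (β x - X u) = x ∧
      inner ℝ (b 2) (β x - X u) = 0 := by
    intro x hx
    have := (hball' x hx).2.2.2
    simp only [hf, hPa, Prod.mk.injEq] at this
    exact this
  refine ⟨W₀ ∩ {p | inner ℝ e (p - X u) ∈ Set.Ioo (-δ) δ}, δ, β,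
    fun p => inner ℝ e (p - X u), ⟨hδ, ?_, ?_, ?_, ?_, ?_, ?_, ?_⟩, hβ0, ?_⟩
  · have hcont : Continuous fun p : E3 => inner ℝ e (p - X u) := by fun_prop
    exact hW₀o.inter (isOpen_Ioo.preimage hcont)
  · exact fun x hx => (hball' x hx).1.contDiffWithinAt
  · exact ((contDiff_const (c := e)).inner ℝ (contDiff_id.sub contDiff_const)).contDiffOn
  · intro x hx
    refine ⟨⟨hX.image_subset (hball' x hx).2.2.1, ?_⟩, (hball' x hx).2.1, ?_⟩
    · rw [← sub_add_sub_cancel _ (X u), inner_add_right, (hβe x hx).2, hq2, add_zero]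
    · rw [Set.mem_ofPred_eq, (hβe x hx).1]; exact hx
  · exact fun x hx => (hβe x hx).1
  · exact fun p hp => hp.2.2
  · exact fun p hp => hW₀ p hp.2.1 hp.1.1 hp.1.2
  · intro h1
    have hv := hX.inner_velocity hu hn
      (hβC.differentiableAt (by norm_num)).hasDerivAt hβ0 (by
        filter_upwards [hev] with x hx using hX.image_subset hx.2.2.1)
    have hn10 : n1 = 0 := by rw [hn1', real_inner_comm]; exact hnb1 h1
    have hnv : n = n0 • b 0 := by
      conv_lhs => rw [eq_sum_coords b n, hn2, zero_smul, add_zero, ← hn1', hn10, zero_smul,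
        add_zero]
    rw [hnv, real_inner_smul_left] at hv
    refine (mul_eq_zero.1 hv).resolve_left fun h0 => ?_
    rw [h0, hn10] at hnsq
    norm_num at hnsq

/-- Every chart can be parametrized by arc length near its centre. -/
lemma IsCurveChart.exists_unitSpeed {Q W : Set E3} {δ : ℝ} {β : ℝ → E3} {σ : E3 → ℝ}
    (h : IsCurveChart Q W δ β σ) :
    ∃ W' δ' β' σ', IsCurveChart Q W' δ' β' σ' ∧ β' 0 = β 0 ∧
      (∀ x ∈ Set.Ioo (-δ') δ', ‖deriv β' x‖ = 1) ∧ ∃ l : ℝ, deriv β' 0 = l • deriv β 0 := by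
  have h0mem : (0 : ℝ) ∈ Set.Ioo (-δ) δ := ⟨neg_lt_zero.2 h.pos, h.pos⟩
  -- The arc length function and its inverse.
  have hdC : ContDiffOn ℝ 1 (deriv β) (Set.Ioo (-δ) δ) :=
    ((contDiffOn_succ_iff_deriv_of_isOpen (n := 1) isOpen_Ioo).1
      (by simpa [one_add_one_eq_two] using h.contDiffOn)).2.2
  have hspeed : ContDiffOn ℝ 1 (fun x => ‖deriv β x‖) (Set.Ioo (-δ) δ) :=
    hdC.norm ℝ fun x hx => h.deriv_ne_zero hx
  set A : ℝ → ℝ := fun x => ∫ y in (0 : ℝ)..x, ‖deriv β y‖ with hA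
  have hA' : ∀ x ∈ Set.Ioo (-δ) δ, HasDerivAt A ‖deriv β x‖ x := by
    intro x hx
    have hsub : Set.uIcc 0 x ⊆ Set.Ioo (-δ) δ := Set.OrdConnected.uIcc_subset
      Set.ordConnected_Ioo h0mem hx
    refine intervalIntegral.integral_hasDerivAt_right
      ((hspeed.continuousOn.mono hsub).intervalIntegrable) ?_
      (hspeed.continuousOn.continuousAt (Ioo_mem_nhds hx.1 hx.2))
    exact hspeed.continuousOn.stronglyMeasurableAtFilter isOpen_Ioo x hx
  have hA0 : A 0 = 0 := by simp [hA]
  have hAC : ContDiffOn ℝ 2 A (Set.Ioo (-δ) δ) := by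
    rw [← one_add_one_eq_two, contDiffOn_succ_iff_deriv_of_isOpen isOpen_Ioo]
    refine ⟨fun x hx => (hA' x hx).differentiableAt.differentiableWithinAt, by simp, ?_⟩
    exact hspeed.congr fun x hx => (hA' x hx).deriv
  have hne : ‖deriv β 0‖ ≠ 0 := norm_ne_zero_iff.2 (h.deriv_ne_zero h0mem)
  obtain ⟨φ, hφC, hφ0, hφl, hφr⟩ := exists_local_inverse
    (f' := ContinuousLinearEquiv.unitsEquivAut ℝ (Units.mk0 _ hne))
    (hAC.contDiffAt (Ioo_mem_nhds h0mem.1 h0mem.2))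
    ((hA' 0 h0mem).hasFDerivAt.congr_fderiv (by ext; simp))
  rw [hA0] at hφC hφ0 hφr
  -- Intervals on which the two functions are inverse to each other.
  obtain ⟨η, hη, hballη⟩ := Metric.eventually_nhds_iff_ball.1
    (hφl.and (Ioo_mem_nhds h0mem.1 h0mem.2))
  rw [Real.ball_eq_Ioo, zero_sub, zero_add] at hballη
  have hev : ∀ᶠ t in nhds (0 : ℝ), ContDiffAt ℝ 2 φ t ∧ φ t ∈ Set.Ioo (-η) η ∧ A (φ t) = t := by
    refine (hφC.eventually (by norm_num)).and (Filter.Eventually.and ?_ hφr)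
    refine hφC.continuousAt.eventually (Ioo_mem_nhds ?_ ?_)
    · rw [hφ0]; linarith
    · rw [hφ0]; exact hη
  obtain ⟨ε, hε, hballε⟩ := Metric.eventually_nhds_iff_ball.1 hev
  rw [Real.ball_eq_Ioo, zero_sub, zero_add] at hballε
  have hφd : ∀ t ∈ Set.Ioo (-ε) ε, HasDerivAt φ ‖deriv β (φ t)‖⁻¹ t := by
    intro t ht
    obtain ⟨h1, h2, -⟩ := hballε t ht
    refine HasDerivAt.of_local_left_inverse h1.continuousAt (hA' _ (hballη _ h2).2)
      (norm_ne_zero_iff.2 (h.deriv_ne_zero (hballη _ h2).2)) ?_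
    filter_upwards [Ioo_mem_nhds ht.1 ht.2] with x hx using (hballε x hx).2.2
  have hβd : ∀ t ∈ Set.Ioo (-ε) ε,
      HasDerivAt (β ∘ φ) (‖deriv β (φ t)‖⁻¹ • deriv β (φ t)) t := fun t ht =>
    (h.hasDerivAt (hballη _ (hballε t ht).2.1).2).scomp t (hφd t ht)
  have hε0 : (0 : ℝ) ∈ Set.Ioo (-ε) ε := ⟨neg_lt_zero.2 hε, hε⟩
  have hσc := h.contDiffOn_inv.continuousOn
  refine ⟨(W ∩ σ ⁻¹' Set.Ioo (-η) η) ∩ (A ∘ σ) ⁻¹' Set.Ioo (-ε) ε, ε, β ∘ φ, A ∘ σ,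
    ⟨hε, ?_, ?_, ?_, ?_, ?_, ?_, ?_⟩, by simp [hφ0], ?_, ?_⟩
  · have h1 : IsOpen (W ∩ σ ⁻¹' Set.Ioo (-η) η) := hσc.isOpen_inter_preimage h.isOpen isOpen_Ioo
    refine ContinuousOn.isOpen_inter_preimage ?_ h1 isOpen_Ioo
    refine hAC.continuousOn.comp (hσc.mono Set.inter_subset_left) fun p hp => ?_
    exact (hballη _ hp.2).2
  · intro t ht
    exact (ContDiffAt.comp t (h.contDiffOn.contDiffAt (isOpen_Ioo.mem_nhds
      (hballη _ (hballε t ht).2.1).2)) (hballε t ht).1).contDiffWithinAt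
  · refine (hAC.of_le (by norm_num)).comp (h.contDiffOn_inv.mono ?_) ?_
    · exact fun p hp => hp.1.1
    · exact fun p hp => (hballη _ hp.1.2).2
  · intro t ht
    obtain ⟨-, h2, h3⟩ := hballε t ht
    have h4 := (hballη _ h2).2
    refine ⟨(h.mem _ h4).1, ⟨(h.mem _ h4).2, ?_⟩, ?_⟩
    · rw [Set.mem_preimage, Function.comp_apply, h.left_inv _ h4]; exact h2
    · rw [Set.mem_preimage, Function.comp_apply, Function.comp_apply, h.left_inv _ h4, h3]
      exact ht
  · intro t ht
    obtain ⟨-, h2, h3⟩ := hballε t ht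
    rw [Function.comp_apply, Function.comp_apply, h.left_inv _ (hballη _ h2).2, h3]
  · exact fun p hp => hp.2.2
  · intro p hp
    rw [Function.comp_apply, Function.comp_apply, (hballη _ hp.2.1.2).1]
    exact h.right_inv p ⟨hp.1, hp.2.1.1⟩
  · intro t ht
    rw [(hβd t ht).deriv]
    rw [norm_smul, norm_inv, norm_norm, inv_mul_cancel₀ (norm_ne_zero_iff.2
      (h.deriv_ne_zero (hballη _ (hballε t ht).2.1).2))]
  · exact ⟨_, by rw [(hβd 0 hε0).deriv, hφ0]⟩

/-! ### Unit speed curves in a one-dimensional set -/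

/-- `γ` is, on the open set `I` of parameters, a `C²` curve of unit speed in `Q`. -/
structure IsUnitArc (Q : Set E3) (I : Set ℝ) (γ : ℝ → E3) : Prop where
  contDiffOn : ContDiffOn ℝ 2 γ I
  mem : ∀ s ∈ I, γ s ∈ Q
  speed : ∀ s ∈ I, ‖deriv γ s‖ = 1

/-- Every point of `Q` is the centre of a chart that is parametrized by arc length. -/
def HasUnitCharts (Q : Set E3) : Prop :=
  ∀ q ∈ Q, ∃ W δ β σ, IsCurveChart Q W δ β σ ∧ (∀ x ∈ Set.Ioo (-δ) δ, ‖deriv β x‖ = 1) ∧ β 0 = q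

lemma IsUnitArc.hasDerivAt {Q : Set E3} {I : Set ℝ} {γ : ℝ → E3} (h : IsUnitArc Q I γ)
    (hI : IsOpen I) {s : ℝ} (hs : s ∈ I) : HasDerivAt γ (deriv γ s) s :=
  ((h.contDiffOn.contDiffAt (hI.mem_nhds hs)).differentiableAt (by norm_num)).hasDerivAt

lemma IsUnitArc.mono {Q : Set E3} {I J : Set ℝ} {γ : ℝ → E3} (h : IsUnitArc Q I γ) (hJ : J ⊆ I) :
    IsUnitArc Q J γ :=
  ⟨h.contDiffOn.mono hJ, fun s hs => h.mem s (hJ hs), fun s hs => h.speed s (hJ hs)⟩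

lemma IsUnitArc.congr {Q : Set E3} {I : Set ℝ} (hI : IsOpen I) {γ γ' : ℝ → E3}
    (h : IsUnitArc Q I γ) (he : Set.EqOn γ' γ I) : IsUnitArc Q I γ' := by
  refine ⟨h.contDiffOn.congr he, fun s hs => (he hs).symm ▸ h.mem s hs, fun s hs => ?_⟩
  rw [(he.eventuallyEq_of_mem (hI.mem_nhds hs)).deriv_eq]
  exact h.speed s hs

lemma IsUnitArc.union {Q : Set E3} {I J : Set ℝ} {γ : ℝ → E3} (hI : IsOpen I) (hJ : IsOpen J)
    (h : IsUnitArc Q I γ) (h' : IsUnitArc Q J γ) : IsUnitArc Q (I ∪ J) γ :=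
  ⟨h.contDiffOn.union_of_isOpen h'.contDiffOn hI hJ,
    fun s hs => hs.elim (h.mem s) (h'.mem s), fun s hs => hs.elim (h.speed s) (h'.speed s)⟩

/-- Affine changes of the parameter preserving the speed. -/
lemma IsUnitArc.comp_affine {Q : Set E3} {I J : Set ℝ} (hI : IsOpen I) {γ : ℝ → E3}
    (h : IsUnitArc Q I γ) {ε x₀ : ℝ} (hε : ε ^ 2 = 1) (hJ : ∀ s ∈ J, x₀ + ε * s ∈ I) :
    IsUnitArc Q J (fun s => γ (x₀ + ε * s)) := by
  refine ⟨h.contDiffOn.comp (ContDiff.contDiffOn (by fun_prop)) hJ, fun s hs => h.mem _ (hJ s hs),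
    fun s hs => ?_⟩
  have hd : HasDerivAt (fun s : ℝ => x₀ + ε * s) ε s := by
    simpa using ((hasDerivAt_id s).const_mul ε).const_add x₀
  have := (h.hasDerivAt hI (hJ s hs)).scomp s hd
  rw [show (fun s => γ (x₀ + ε * s)) = γ ∘ fun s : ℝ => x₀ + ε * s from rfl, this.deriv,
    norm_smul, h.speed _ (hJ s hs), mul_one, Real.norm_eq_abs]
  rcases sq_eq_one_iff.1 hε with h | h <;> simp [h]

lemma IsCurveChart.isUnitArc {Q W : Set E3} {δ : ℝ} {β : ℝ → E3} {σ : E3 → ℝ}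
    (h : IsCurveChart Q W δ β σ) (hu : ∀ x ∈ Set.Ioo (-δ) δ, ‖deriv β x‖ = 1) :
    IsUnitArc Q (Set.Ioo (-δ) δ) β :=
  ⟨h.contDiffOn, fun x hx => (h.mem x hx).1, hu⟩

/-- In a chart, a unit speed curve is an affine reparametrization of the chart. -/
lemma IsUnitArc.local_form {Q W : Set E3} {δ : ℝ} {β : ℝ → E3} {σ : E3 → ℝ}
    (hc : IsCurveChart Q W δ β σ) (hu : ∀ x ∈ Set.Ioo (-δ) δ, ‖deriv β x‖ = 1) {γ : ℝ → E3}
    {a b : ℝ} (h : IsUnitArc Q (Set.Ioo a b) γ) (hW : ∀ s ∈ Set.Ioo a b, γ s ∈ W) :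
    ∃ ε : ℝ, ε ^ 2 = 1 ∧ ∀ s ∈ Set.Ioo a b, ∀ t ∈ Set.Ioo a b,
      σ (γ t) = σ (γ s) + ε * (t - s) := by
  have hxC : ContDiffOn ℝ 1 (σ ∘ γ) (Set.Ioo a b) :=
    hc.contDiffOn_inv.comp (h.contDiffOn.of_le (by norm_num)) hW
  have hxd : ∀ s ∈ Set.Ioo a b, HasDerivAt (σ ∘ γ) (deriv (σ ∘ γ) s) s := fun s hs =>
    ((hxC.contDiffAt (isOpen_Ioo.mem_nhds hs)).differentiableAt (by norm_num)).hasDerivAt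
  have hsq : ∀ s ∈ Set.Ioo a b, (deriv (σ ∘ γ) s) ^ 2 = 1 := by
    intro s hs
    have hm : σ (γ s) ∈ Set.Ioo (-δ) δ := hc.inv_mem _ ⟨h.mem s hs, hW s hs⟩
    have h1 := (hc.hasDerivAt hm).scomp s (hxd s hs)
    have h2 : HasDerivAt γ (deriv (σ ∘ γ) s • deriv β (σ (γ s))) s := by
      refine h1.congr_of_eventuallyEq ?_
      filter_upwards [isOpen_Ioo.mem_nhds hs] with t ht
      exact (hc.right_inv _ ⟨h.mem t ht, hW t ht⟩).symm
    have h3 := h.speed s hs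
    rw [h2.deriv, norm_smul, hu _ hm, mul_one, Real.norm_eq_abs] at h3
    rw [← sq_abs, h3, one_pow]
  have hcont : ContinuousOn (deriv (σ ∘ γ)) (Set.Ioo a b) :=
    hxC.continuousOn_deriv_of_isOpen isOpen_Ioo le_rfl
  obtain ⟨ε, hε, hεd⟩ : ∃ ε : ℝ, ε ^ 2 = 1 ∧ ∀ s ∈ Set.Ioo a b, deriv (σ ∘ γ) s = ε := by
    rcases isPreconnected_Ioo.eq_one_or_eq_neg_one_of_sq_eq hcont (fun s hs => hsq s hs) with h1 | h1
    · exact ⟨1, by norm_num, h1⟩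
    · exact ⟨-1, by norm_num, h1⟩
  refine ⟨ε, hε, fun s hs t ht => ?_⟩
  have hF : ∀ x ∈ Set.Ioo a b, HasDerivAt (fun x => σ (γ x) - ε * x) 0 x := fun x hx =>
    ((hxd x hx).sub ((hasDerivAt_id x).const_mul ε)).congr_deriv (by rw [hεd x hx]; ring)
  have := isOpen_Ioo.is_const_of_deriv_eq_zero isPreconnected_Ioo
    (fun x hx => (hF x hx).differentiableAt.differentiableWithinAt)
    (fun x hx => (hF x hx).deriv) hs ht
  linarith

/-- Near each parameter, a unit speed curve is an affine reparametrization of a chart. -/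
lemma IsUnitArc.eventually_eq_chart {Q W : Set E3} {δ : ℝ} {β : ℝ → E3} {σ : E3 → ℝ}
    (hc : IsCurveChart Q W δ β σ) (hu : ∀ x ∈ Set.Ioo (-δ) δ, ‖deriv β x‖ = 1) {γ : ℝ → E3}
    {I : Set ℝ} (hI : IsOpen I) (h : IsUnitArc Q I γ) {s : ℝ} (hs : s ∈ I) (hW : γ s ∈ W) :
    ∃ ε : ℝ, ε ^ 2 = 1 ∧ (∀ᶠ t in nhds s, γ t ∈ W ∧ σ (γ t) = σ (γ s) + ε * (t - s)) ∧
      deriv γ s = ε • deriv β (σ (γ s)) := by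
  have hev : ∀ᶠ t in nhds s, γ t ∈ W ∧ t ∈ I :=
    ((h.hasDerivAt hI hs).continuousAt.eventually (hc.isOpen.mem_nhds hW)).and (hI.mem_nhds hs)
  obtain ⟨ρ, hρ, hball⟩ := Metric.eventually_nhds_iff_ball.1 hev
  rw [Real.ball_eq_Ioo] at hball
  have hsm : s ∈ Set.Ioo (s - ρ) (s + ρ) := ⟨by linarith, by linarith⟩
  obtain ⟨ε, hε, hlin⟩ := (h.mono fun t ht => (hball t ht).2).local_form hc hu
    fun t ht => (hball t ht).1
  refine ⟨ε, hε, ?_, ?_⟩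
  · filter_upwards [isOpen_Ioo.mem_nhds hsm] with t ht
    exact ⟨(hball t ht).1, hlin s hsm t ht⟩
  · have hm : σ (γ s) ∈ Set.Ioo (-δ) δ := hc.inv_mem _ ⟨h.mem s hs, hW⟩
    have hd : HasDerivAt (fun t : ℝ => σ (γ s) + ε * (t - s)) ε s := by
      simpa using (((hasDerivAt_id s).sub_const s).const_mul ε).const_add (σ (γ s))
    have h1 := (hc.hasDerivAt hm).scomp_of_eq s hd (by simp)
    refine HasDerivAt.deriv (h1.congr_of_eventuallyEq ?_)
    filter_upwards [isOpen_Ioo.mem_nhds hsm] with t ht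
    rw [Function.comp_apply, ← hlin s hsm t ht]
    exact (hc.right_inv _ ⟨h.mem t (hball t ht).2, (hball t ht).1⟩).symm

/-- At a common point, two unit speed curves have the same tangent line. -/
lemma IsUnitArc.deriv_eq_or_neg {Q : Set E3} (hQ : HasUnitCharts Q) {γ₁ γ₂ : ℝ → E3}
    {I₁ I₂ : Set ℝ} (hI₁ : IsOpen I₁) (hI₂ : IsOpen I₂) (h₁ : IsUnitArc Q I₁ γ₁)
    (h₂ : IsUnitArc Q I₂ γ₂) {s t : ℝ} (hs : s ∈ I₁) (ht : t ∈ I₂) (hst : γ₁ s = γ₂ t) :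
    deriv γ₁ s = deriv γ₂ t ∨ deriv γ₁ s = -deriv γ₂ t := by
  obtain ⟨W, δ, β, σ, hc, hu, hβ⟩ := hQ (γ₁ s) (h₁.mem s hs)
  have hW : γ₁ s ∈ W := by
    rw [← hβ]; exact (hc.mem 0 ⟨neg_lt_zero.2 hc.pos, hc.pos⟩).2
  obtain ⟨ε₁, hε₁, -, hd₁⟩ := h₁.eventually_eq_chart hc hu hI₁ hs hW
  obtain ⟨ε₂, hε₂, -, hd₂⟩ := h₂.eventually_eq_chart hc hu hI₂ ht (hst ▸ hW)
  rw [hd₁, hd₂, hst, ← neg_smul]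
  rcases sq_eq_one_iff.1 hε₁ with rfl | rfl <;>
    rcases sq_eq_one_iff.1 hε₂ with rfl | rfl <;> simp

/-- Two unit speed curves with the same position and velocity agree nearby. -/
lemma IsUnitArc.eventuallyEq {Q : Set E3} (hQ : HasUnitCharts Q) {γ₁ γ₂ : ℝ → E3} {I : Set ℝ}
    (hI : IsOpen I) (h₁ : IsUnitArc Q I γ₁) (h₂ : IsUnitArc Q I γ₂) {s : ℝ} (hs : s ∈ I)
    (hst : γ₁ s = γ₂ s) (hd : deriv γ₁ s = deriv γ₂ s) : γ₁ =ᶠ[nhds s] γ₂ := by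
  obtain ⟨W, δ, β, σ, hc, hu, hβ⟩ := hQ (γ₁ s) (h₁.mem s hs)
  have hW : γ₁ s ∈ W := by
    rw [← hβ]; exact (hc.mem 0 ⟨neg_lt_zero.2 hc.pos, hc.pos⟩).2
  obtain ⟨ε₁, -, he₁, hd₁⟩ := h₁.eventually_eq_chart hc hu hI hs hW
  obtain ⟨ε₂, -, he₂, hd₂⟩ := h₂.eventually_eq_chart hc hu hI hs (hst ▸ hW)
  have hm : σ (γ₁ s) ∈ Set.Ioo (-δ) δ := hc.inv_mem _ ⟨h₁.mem s hs, hW⟩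
  have hε : ε₁ = ε₂ := by
    rw [hd₁, hd₂, ← hst] at hd
    exact smul_left_injective ℝ (hc.deriv_ne_zero hm) hd
  filter_upwards [he₁, he₂, hI.mem_nhds hs] with t h1 h2 ht
  rw [← hc.right_inv _ ⟨h₁.mem t ht, h1.1⟩, ← hc.right_inv _ ⟨h₂.mem t ht, h2.1⟩, h1.2, h2.2,
    hst, hε]

lemma IsUnitArc.continuousAt_deriv {Q : Set E3} {I : Set ℝ} {γ : ℝ → E3} (h : IsUnitArc Q I γ)
    (hI : IsOpen I) {s : ℝ} (hs : s ∈ I) : ContinuousAt (deriv γ) s :=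
  (h.contDiffOn.continuousOn_deriv_of_isOpen hI (by norm_num)).continuousAt (hI.mem_nhds hs)

/-- Uniqueness of the unit speed curve with given position and velocity. -/
lemma IsUnitArc.eqOn {Q : Set E3} (hQ : HasUnitCharts Q) {γ₁ γ₂ : ℝ → E3} {a b : ℝ}
    (h₁ : IsUnitArc Q (Set.Ioo a b) γ₁) (h₂ : IsUnitArc Q (Set.Ioo a b) γ₂) {s : ℝ}
    (hs : s ∈ Set.Ioo a b) (hst : γ₁ s = γ₂ s) (hd : deriv γ₁ s = deriv γ₂ s) :
    Set.EqOn γ₁ γ₂ (Set.Ioo a b) := by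
  have hopen : IsOpen {t | γ₁ =ᶠ[nhds t] γ₂} :=
    isOpen_iff_mem_nhds.2 fun t ht => eventually_eventually_nhds.2 ht
  have hsub : Set.Ioo a b ⊆ {t | γ₁ =ᶠ[nhds t] γ₂} := by
    refine isPreconnected_Ioo.subset_of_closure_inter_subset hopen
      ⟨s, hs, h₁.eventuallyEq hQ isOpen_Ioo h₂ hs hst hd⟩ ?_
    rintro t ⟨htc, ht⟩
    set A := {t | γ₁ =ᶠ[nhds t] γ₂} with hA
    have hne : (nhdsWithin t A).NeBot := mem_closure_iff_nhdsWithin_neBot.1 htc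
    refine h₁.eventuallyEq hQ isOpen_Ioo h₂ ht ?_ ?_
    · refine tendsto_nhds_unique_of_eventuallyEq (l := nhdsWithin t A)
        ((h₁.hasDerivAt isOpen_Ioo ht).continuousAt.tendsto.mono_left nhdsWithin_le_nhds)
        ((h₂.hasDerivAt isOpen_Ioo ht).continuousAt.tendsto.mono_left nhdsWithin_le_nhds) ?_
      filter_upwards [self_mem_nhdsWithin] with x hx using Filter.EventuallyEq.eq_of_nhds hx
    · refine tendsto_nhds_unique_of_eventuallyEq (l := nhdsWithin t A)
        ((h₁.continuousAt_deriv isOpen_Ioo ht).tendsto.mono_left nhdsWithin_le_nhds)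
        ((h₂.continuousAt_deriv isOpen_Ioo ht).tendsto.mono_left nhdsWithin_le_nhds) ?_
      filter_upwards [self_mem_nhdsWithin] with x hx using Filter.EventuallyEq.deriv_eq hx
  exact fun t ht => Filter.EventuallyEq.eq_of_nhds (hsub ht)

/-! ### Completeness of the meridians -/

lemma IsUnitArc.intrinsicDist_le {M Q : Set E3} (hQM : Q ⊆ M) {l r : ℝ} {γ : ℝ → E3}
    (h : IsUnitArc Q (Set.Ioo l r) γ) {s t : ℝ} (hs : s ∈ Set.Ioo l r) (ht : t ∈ Set.Ioo l r) :
    intrinsicDist M (γ s) (γ t) ≤ edist s t := by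
  have hseg : ∀ x ∈ Set.Icc (0 : ℝ) 1, s + x * (t - s) ∈ Set.Ioo l r := fun x hx =>
    (convex_Ioo l r).add_smul_sub_mem hs ht hx
  rw [edist_dist, dist_comm, Real.dist_eq]
  refine RotSurf.intrinsicDist_le (γ := fun x => γ (s + x * (t - s)))
    ⟨?_, fun x hx => hQM (h.mem _ (hseg x hx)), by simp, by simp⟩ fun x hx => ?_
  · exact (h.contDiffOn.of_le (by norm_num)).comp (ContDiff.contDiffOn (by fun_prop)) hseg
  · have hd : HasDerivAt (fun x : ℝ => s + x * (t - s)) (t - s) x := by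
      simpa using ((hasDerivAt_id x).mul_const (t - s)).const_add s
    have := (h.hasDerivAt isOpen_Ioo (hseg x hx)).scomp x hd
    rw [show (fun x => γ (s + x * (t - s))) = γ ∘ fun x : ℝ => s + x * (t - s) from rfl,
      this.hasDerivWithinAt.derivWithin (uniqueDiffOn_Icc zero_lt_one x hx), norm_smul,
      h.speed _ (hseg x hx), mul_one, Real.norm_eq_abs]

/-- By completeness, a unit speed curve has an end point. -/
lemma IsUnitArc.exists_endpoint {M Q : Set E3} (hM : IsIntrinsicallyComplete M) (hQM : Q ⊆ M)
    {l r : ℝ} (hlr : l < r) {γ : ℝ → E3} (h : IsUnitArc Q (Set.Ioo l r) γ) :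
    ∃ p ∈ M, ∀ s ∈ Set.Ioo l r, dist (γ s) p ≤ r - s := by
  obtain ⟨x, -, hx, hxt⟩ := exists_seq_strictMono_tendsto' hlr
  obtain ⟨p, hpM, hp⟩ := hM (fun n => γ (x n)) (fun n => hQM (h.mem _ (hx n))) (by
    intro ε hε
    obtain ⟨N, hN⟩ := EMetric.cauchySeq_iff.1 hxt.cauchySeq ε hε
    exact ⟨N, fun m hm n hn => (h.intrinsicDist_le hQM (hx m) (hx n)).trans_lt (hN m hm n hn)⟩)
  have hp' : Filter.Tendsto (fun n => γ (x n)) Filter.atTop (nhds p) := by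
    rw [tendsto_iff_edist_tendsto_0]
    exact tendsto_of_tendsto_of_tendsto_of_le_of_le tendsto_const_nhds hp (fun _ => zero_le)
      fun n => edist_le_intrinsicDist M _ _
  refine ⟨p, hpM, fun s hs => ?_⟩
  have h1 : ∀ n, dist (γ s) (γ (x n)) ≤ dist s (x n) := fun n => by
    have := (edist_le_intrinsicDist M _ _).trans (h.intrinsicDist_le hQM hs (hx n))
    rwa [edist_dist, edist_dist, ENNReal.ofReal_le_ofReal_iff dist_nonneg] at this
  have h2 := le_of_tendsto_of_tendsto' (tendsto_const_nhds.dist hp') (tendsto_const_nhds.dist hxt) h1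
  rwa [dist_comm s r, Real.dist_eq, abs_of_pos (sub_pos.2 hs.2)] at h2

lemma IsUnitArc.extend_right {M : Set E3} {a : E3} {b : OrthonormalBasis (Fin 3) ℝ E3}
    (hM : IsIntrinsicallyComplete M) (hQ : HasUnitCharts (meridianSet M a b)) {l r : ℝ}
    (hlr : l < r) {γ : ℝ → E3} (h : IsUnitArc (meridianSet M a b) (Set.Ioo l r) γ) :
    ∃ r' > r, ∃ γ', IsUnitArc (meridianSet M a b) (Set.Ioo l r') γ' ∧
      Set.EqOn γ' γ (Set.Ioo l r) := by
  obtain ⟨p, hpM, hp⟩ := h.exists_endpoint hM (fun _ hq => hq.1) hlr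
  have hlim : Filter.Tendsto γ (nhdsWithin r (Set.Iio r)) (nhds p) := by
    rw [tendsto_iff_dist_tendsto_zero]
    have h0 : Filter.Tendsto (fun s => r - s) (nhdsWithin r (Set.Iio r)) (nhds 0) := by
      have : Continuous fun s : ℝ => r - s := by fun_prop
      have := (this.tendsto r).mono_left (nhdsWithin_le_nhds (s := Set.Iio r))
      rwa [sub_self] at this
    refine squeeze_zero' (Filter.Eventually.of_forall fun _ => dist_nonneg) ?_ h0
    filter_upwards [Ioo_mem_nhdsLT hlr] with s hs using hp s hs
  have hpQ : p ∈ meridianSet M a b := by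
    refine ⟨hpM, ?_⟩
    have hc : Continuous fun p : E3 => inner ℝ (b 2) (p - a) := by fun_prop
    refine tendsto_nhds_unique_of_eventuallyEq ((hc.tendsto p).comp hlim) tendsto_const_nhds ?_
    filter_upwards [Ioo_mem_nhdsLT hlr] with s hs using (h.mem s hs).2
  obtain ⟨W, δ, β, σ, hc, hu, hβ⟩ := hQ p hpQ
  have h0 : (0 : ℝ) ∈ Set.Ioo (-δ) δ := ⟨neg_lt_zero.2 hc.pos, hc.pos⟩
  have hpW : p ∈ W := hβ ▸ (hc.mem 0 h0).2
  have hσp : σ p = 0 := by rw [← hβ]; exact hc.left_inv 0 h0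
  obtain ⟨x, hx, hxW⟩ : ∃ x ∈ Set.Ico l r, ∀ s ∈ Set.Ioo x r, γ s ∈ W := by
    have := hlim.eventually (hc.isOpen.mem_nhds hpW)
    obtain ⟨x, hx, hx'⟩ := (mem_nhdsLT_iff_exists_mem_Ico_Ioo_subset hlr).1 this
    exact ⟨x, hx, fun s hs => hx' hs⟩
  obtain ⟨ε, hε, hlin⟩ := (h.mono (Set.Ioo_subset_Ioo_left hx.1)).local_form hc hu hxW
  -- The curve is the chart, traversed so as to reach its centre at the parameter `r`.
  have hγβ : ∀ s ∈ Set.Ioo x r, γ s = β (-(ε * r) + ε * s) := by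
    intro s hs
    have hσc : ContinuousAt σ p :=
      hc.contDiffOn_inv.continuousOn.continuousAt (hc.isOpen.mem_nhds hpW)
    have h1 : Filter.Tendsto (fun t => σ (γ t)) (nhdsWithin r (Set.Iio r)) (nhds 0) :=
      hσp ▸ hσc.tendsto.comp hlim
    have h2 : Filter.Tendsto (fun t => σ (γ s) + ε * (t - s)) (nhdsWithin r (Set.Iio r))
        (nhds (σ (γ s) + ε * (r - s))) := by
      have : Continuous fun t : ℝ => σ (γ s) + ε * (t - s) := by fun_prop
      exact (this.tendsto r).mono_left nhdsWithin_le_nhds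
    have h3 := tendsto_nhds_unique_of_eventuallyEq h1 h2 (by
      filter_upwards [Ioo_mem_nhdsLT hx.2] with t ht using hlin s hs t ht)
    rw [← hc.right_inv (γ s) ⟨h.mem s ⟨hx.1.trans_lt hs.1, hs.2⟩, hxW s hs⟩]
    congr 1
    linarith
  set γ' : ℝ → E3 := fun s => if s < r then γ s else β (-(ε * r) + ε * s) with hγ'
  have hγ'1 : Set.EqOn γ' γ (Set.Ioo l r) := fun s hs => if_pos hs.2
  set y := max x (r - δ) with hy
  have hyr : y < r := max_lt hx.2 (by linarith [hc.pos])
  have hγ'2 : Set.EqOn γ' (fun s => β (-(ε * r) + ε * s)) (Set.Ioo y (r + δ)) := by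
    intro s hs
    simp only [hγ']
    split_ifs with hsr
    · exact hγβ s ⟨(le_max_left _ _).trans_lt hs.1, hsr⟩
    · rfl
  have harc : IsUnitArc (meridianSet M a b) (Set.Ioo y (r + δ))
      (fun s => β (-(ε * r) + ε * s)) := by
    refine (hc.isUnitArc hu).comp_affine isOpen_Ioo hε fun s hs => ?_
    have h1 : r - δ < s := (le_max_right _ _).trans_lt hs.1
    have h2 := hs.2
    rcases sq_eq_one_iff.1 hε with rfl | rfl <;> constructor <;> linarith
  refine ⟨r + δ, by linarith [hc.pos], γ', ?_, hγ'1⟩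
  refine ((h.congr isOpen_Ioo hγ'1).union isOpen_Ioo isOpen_Ioo
    (harc.congr isOpen_Ioo hγ'2)).mono fun s hs => ?_
  rcases lt_or_ge s r with hsr | hsr
  · exact Or.inl ⟨hs.1, hsr⟩
  · exact Or.inr ⟨hyr.trans_le hsr, hs.2⟩

lemma IsUnitArc.extend {M : Set E3} {a : E3} {b : OrthonormalBasis (Fin 3) ℝ E3}
    (hM : IsIntrinsicallyComplete M) (hQ : HasUnitCharts (meridianSet M a b)) {T : ℝ}
    (hT : 0 < T) {γ : ℝ → E3} (h : IsUnitArc (meridianSet M a b) (Set.Ioo (-T) T) γ) :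
    ∃ T' > T, ∃ γ', IsUnitArc (meridianSet M a b) (Set.Ioo (-T') T') γ' ∧
      Set.EqOn γ' γ (Set.Ioo (-T) T) := by
  obtain ⟨r, hr, γ₁, h₁, he₁⟩ := h.extend_right hM hQ (by linarith)
  have h₂ : IsUnitArc (meridianSet M a b) (Set.Ioo (-r) T) (fun s => γ₁ (0 + -1 * s)) :=
    h₁.comp_affine isOpen_Ioo (by norm_num) fun s hs => ⟨by linarith [hs.2], by linarith [hs.1]⟩
  obtain ⟨r', hr', γ₂, h₃, he₂⟩ := h₂.extend_right hM hQ (by linarith)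
  refine ⟨min r r', lt_min hr hr', fun s => γ₂ (0 + -1 * s), ?_, fun s hs => ?_⟩
  · refine h₃.comp_affine isOpen_Ioo (by norm_num) fun s hs => ⟨?_, ?_⟩
    · linarith [hs.2, min_le_left r r']
    · linarith [hs.1, min_le_right r r']
  · have := he₂ (show 0 + -1 * s ∈ Set.Ioo (-r) T from ⟨by linarith [hs.2], by linarith [hs.1]⟩)
    simp only at this ⊢
    rw [this, show 0 + -1 * (0 + -1 * s) = s by ring]
    exact he₁ hs

/-- On a complete surface, meridians are defined for all parameters. -/
lemma exists_complete_meridian {M : Set E3} {a : E3} {b : OrthonormalBasis (Fin 3) ℝ E3}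
    (hM : IsIntrinsicallyComplete M) (hQ : HasUnitCharts (meridianSet M a b)) {q : E3}
    (hq : q ∈ meridianSet M a b) : ∃ γ, IsUnitArc (meridianSet M a b) Set.univ γ ∧ γ 0 = q := by
  obtain ⟨W, δ, β, σ, hc, hu, hβ⟩ := hQ q hq
  set A : Set ℝ := {T | 0 < T ∧ ∃ γ, IsUnitArc (meridianSet M a b) (Set.Ioo (-T) T) γ ∧
    γ 0 = q ∧ deriv γ 0 = deriv β 0} with hA
  have hAδ : δ ∈ A := ⟨hc.pos, β, hc.isUnitArc hu, hβ, rfl⟩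
  -- By uniqueness the curves on all these intervals fit together.
  choose! Γ hΓ using fun T (hT : T ∈ A) => hT.2
  have hcompat : ∀ T ∈ A, ∀ T' ∈ A, ∀ s, |s| < T → |s| < T' → Γ T s = Γ T' s := by
    intro T hT T' hT' s hs hs'
    wlog hle : T ≤ T' generalizing T T'
    · exact (this T' hT' T hT hs' hs (le_of_not_ge hle)).symm
    obtain ⟨a1, a2, a3⟩ := hΓ T hT
    obtain ⟨b1, b2, b3⟩ := hΓ T' hT'
    exact a1.eqOn hQ (b1.mono (Set.Ioo_subset_Ioo (by linarith) hle)) ⟨by linarith [hT.1], hT.1⟩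
      (a2.trans b2.symm) (a3.trans b3.symm) (abs_lt.1 hs)
  set γ : ℝ → E3 := fun s => open Classical in
    if h : ∃ T ∈ A, |s| < T then Γ h.choose s else q with hγ
  have hγe : ∀ T ∈ A, Set.EqOn γ (Γ T) (Set.Ioo (-T) T) := by
    intro T hT s hs
    have hex : ∃ T ∈ A, |s| < T := ⟨T, hT, abs_lt.2 hs⟩
    simp only [hγ]
    rw [dif_pos hex]
    exact hcompat _ hex.choose_spec.1 T hT s hex.choose_spec.2 (abs_lt.2 hs)
  have harc : ∀ T ∈ A, IsUnitArc (meridianSet M a b) (Set.Ioo (-T) T) γ := fun T hT =>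
    (hΓ T hT).1.congr isOpen_Ioo (hγe T hT)
  have hglue : ∀ I : Set ℝ, (∀ s ∈ I, ∃ T ∈ A, |s| < T) →
      IsUnitArc (meridianSet M a b) I γ := by
    intro I hI
    refine ⟨fun s hs => ?_, fun s hs => ?_, fun s hs => ?_⟩ <;> obtain ⟨T, hT, hsT⟩ := hI s hs
    · exact ((harc T hT).contDiffOn.contDiffAt
        (isOpen_Ioo.mem_nhds (abs_lt.1 hsT))).contDiffWithinAt
    · exact (harc T hT).mem s (abs_lt.1 hsT)
    · exact (harc T hT).speed s (abs_lt.1 hsT)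
  have h0 : (0 : ℝ) ∈ Set.Ioo (-δ) δ := ⟨neg_lt_zero.2 hc.pos, hc.pos⟩
  have hγ0 : γ 0 = q := (hγe δ hAδ h0).trans (hΓ δ hAδ).2.1
  have hγd : deriv γ 0 = deriv β 0 :=
    ((hγe δ hAδ).eventuallyEq_of_mem (isOpen_Ioo.mem_nhds h0)).deriv_eq.trans (hΓ δ hAδ).2.2
  -- The supremum of the intervals is infinite, by extension of the curve past a finite one.
  have hunb : ¬ BddAbove A := by
    intro hbdd
    have hpos : 0 < sSup A := hc.pos.trans_le (le_csSup hbdd hAδ)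
    have h1 : IsUnitArc (meridianSet M a b) (Set.Ioo (-sSup A) (sSup A)) γ :=
      hglue _ fun s hs => exists_lt_of_lt_csSup ⟨δ, hAδ⟩ (abs_lt.2 hs)
    obtain ⟨T', hT', γ', h2, he⟩ := h1.extend hM hQ hpos
    have h0' : (0 : ℝ) ∈ Set.Ioo (-sSup A) (sSup A) := ⟨neg_lt_zero.2 hpos, hpos⟩
    have : T' ∈ A := ⟨hpos.trans hT', γ', h2, (he h0').trans hγ0,
      (he.eventuallyEq_of_mem (isOpen_Ioo.mem_nhds h0')).deriv_eq.trans hγd⟩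
    exact absurd (le_csSup hbdd this) (not_le.2 hT')
  refine ⟨γ, hglue _ fun s _ => ?_, hγ0⟩
  obtain ⟨T, hT, hsT⟩ := not_bddAbove_iff.1 hunb |s|
  exact ⟨T, hT, hsT⟩

/-! ### The profile equation of a meridian -/

lemma hasUnitCharts_meridianSet {M : Set E3} (hs : IsEmbeddedC2Surface M) {a : E3}
    {b : OrthonormalBasis (Fin 3) ℝ E3} (hrot : IsRotationalAbout M a b) :
    HasUnitCharts (meridianSet M a b) := by
  intro q hq
  obtain ⟨W, δ, β, σ, hc, hβ, -⟩ := exists_chart_meridianSet hs hrot hq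
  obtain ⟨W', δ', β', σ', hc', hβ', hu, -⟩ := hc.exists_unitSpeed
  exact ⟨W', δ', β', σ', hc', hu, hβ'.trans hβ⟩

/-- Meridians meet the axis orthogonally. -/
lemma IsUnitArc.inner_deriv_of_axis {M : Set E3} (hs : IsEmbeddedC2Surface M) {a : E3}
    {b : OrthonormalBasis (Fin 3) ℝ E3} (hrot : IsRotationalAbout M a b) {γ : ℝ → E3}
    (h : IsUnitArc (meridianSet M a b) Set.univ γ) {s : ℝ}
    (h1 : inner ℝ (b 1) (γ s - a) = 0) : inner ℝ (b 0) (deriv γ s) = 0 := by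
  obtain ⟨W, δ, β, σ, hc, hβ, hax⟩ := exists_chart_meridianSet hs hrot (h.mem s trivial)
  obtain ⟨W', δ', β', σ', hc', hβ', hu, l, hl⟩ := hc.exists_unitSpeed
  have h0 : (0 : ℝ) ∈ Set.Ioo (-δ') δ' := ⟨neg_lt_zero.2 hc'.pos, hc'.pos⟩
  have hγ : γ s = β' 0 := (hβ'.trans hβ).symm
  obtain ⟨ε, -, -, hd⟩ := h.eventually_eq_chart hc' hu isOpen_univ (s := s) trivial
    (hγ ▸ (hc'.mem 0 h0).2)
  rw [hd, hγ, hc'.left_inv 0 h0, hl, inner_smul_right, inner_smul_right, hax h1, mul_zero,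
    mul_zero]

/-- A `C¹` curve in the unit circle has a `C¹` angle. -/
lemma exists_angle {u v : ℝ → ℝ} (hu : ContDiff ℝ 1 u) (hv : ContDiff ℝ 1 v)
    (h : ∀ s, u s ^ 2 + v s ^ 2 = 1) : ∃ θ κ : ℝ → ℝ, Continuous κ ∧
      (∀ s, HasDerivAt θ (κ s) s) ∧ ∀ s, u s = Real.cos (θ s) ∧ v s = Real.sin (θ s) := by
  have hud : ∀ s, HasDerivAt u (deriv u s) s := fun s =>
    (hu.differentiable (by norm_num) s).hasDerivAt
  have hvd : ∀ s, HasDerivAt v (deriv v s) s := fun s =>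
    (hv.differentiable (by norm_num) s).hasDerivAt
  set κ : ℝ → ℝ := fun s => u s * deriv v s - v s * deriv u s with hκ
  have hκc : Continuous κ := (hu.continuous.mul (hv.continuous_deriv le_rfl)).sub
    (hv.continuous.mul (hu.continuous_deriv le_rfl))
  have horth : ∀ s, u s * deriv u s + v s * deriv v s = 0 := by
    intro s
    have h1 := ((hud s).pow 2).add ((hvd s).pow 2)
    have h2 := (hasDerivAt_const s (1 : ℝ)).congr_of_eventuallyEq
      (Filter.Eventually.of_forall h)
    have h3 := h1.unique h2
    simp only [Nat.cast_ofNat, Nat.add_one_sub_one, pow_one] at h3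
    linarith
  have hu' : ∀ s, HasDerivAt u (-(κ s * v s)) s := fun s => (hud s).congr_deriv (by
    simp only [hκ]
    linear_combination (-deriv u s) * h s + u s * horth s)
  have hv' : ∀ s, HasDerivAt v (κ s * u s) s := fun s => (hvd s).congr_deriv (by
    simp only [hκ]
    linear_combination (-deriv v s) * h s + v s * horth s)
  obtain ⟨θ₀, h1, h2⟩ := exists_polar (u 0) (v 0)
  rw [h 0, Real.sqrt_one, one_mul] at h1 h2
  set θ : ℝ → ℝ := fun s => θ₀ + ∫ x in (0 : ℝ)..s, κ x with hθ
  have hθ' : ∀ s, HasDerivAt θ (κ s) s := fun s =>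
    (intervalIntegral.integral_hasDerivAt_right (hκc.intervalIntegrable _ _)
      hκc.stronglyMeasurable.stronglyMeasurableAtFilter hκc.continuousAt).const_add θ₀
  have hθ0 : θ 0 = θ₀ := by simp [hθ]
  have hf : ∀ s, u s * Real.cos (θ s) + v s * Real.sin (θ s) = 1 := by
    have hd : ∀ s, HasDerivAt (fun s => u s * Real.cos (θ s) + v s * Real.sin (θ s)) 0 s :=
      fun s => (((hu' s).mul (hθ' s).cos).add ((hv' s).mul (hθ' s).sin)).congr_deriv (by ring)
    intro s
    have := is_const_of_deriv_eq_zero (fun s => (hd s).differentiableAt) (fun s => (hd s).deriv) s 0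
    rw [this, hθ0, h1, h2]
    linarith [Real.sin_sq_add_cos_sq θ₀]
  have hg : ∀ s, v s * Real.cos (θ s) - u s * Real.sin (θ s) = 0 := by
    have hd : ∀ s, HasDerivAt (fun s => v s * Real.cos (θ s) - u s * Real.sin (θ s)) 0 s :=
      fun s => (((hv' s).mul (hθ' s).cos).sub ((hu' s).mul (hθ' s).sin)).congr_deriv (by ring)
    intro s
    have := is_const_of_deriv_eq_zero (fun s => (hd s).differentiableAt) (fun s => (hd s).deriv) s 0
    rw [this, hθ0, h1, h2]
    ring
  refine ⟨θ, κ, hκc, hθ', fun s => ⟨?_, ?_⟩⟩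
  · linear_combination Real.cos (θ s) * hf s - Real.sin (θ s) * hg s
      - u s * Real.sin_sq_add_cos_sq (θ s)
  · linear_combination Real.sin (θ s) * hf s + Real.cos (θ s) * hg s
      - v s * Real.sin_sq_add_cos_sq (θ s)

/-- The surface of revolution generated by the plane curve `(r, z)`. -/
noncomputable def revolution (a : E3) (b : OrthonormalBasis (Fin 3) ℝ E3) (r z : ℝ → ℝ) (w : E2) :
    E3 :=
  a + (z (w 0) • b 0 + (r (w 0) * Real.cos (w 1)) • b 1 + (r (w 0) * Real.sin (w 1)) • b 2)

/-- Rotation into the half-plane through the axis that contains `b 1`. -/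
noncomputable def toHalfPlane (a : E3) (b : OrthonormalBasis (Fin 3) ℝ E3) (p : E3) : E3 :=
  a + (inner ℝ (b 0) (p - a) • b 0
    + √(inner ℝ (b 1) (p - a) ^ 2 + inner ℝ (b 2) (p - a) ^ 2) • b 1)

lemma continuous_toHalfPlane (a : E3) (b : OrthonormalBasis (Fin 3) ℝ E3) :
    Continuous (toHalfPlane a b) := by
  unfold toHalfPlane
  fun_prop

lemma inner_toHalfPlane (a : E3) (b : OrthonormalBasis (Fin 3) ℝ E3) (p : E3) :
    inner ℝ (b 0) (toHalfPlane a b p - a) = inner ℝ (b 0) (p - a) ∧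
    inner ℝ (b 1) (toHalfPlane a b p - a)
      = √(inner ℝ (b 1) (p - a) ^ 2 + inner ℝ (b 2) (p - a) ^ 2) ∧
    inner ℝ (b 2) (toHalfPlane a b p - a) = 0 := by
  simp [toHalfPlane, inner_add_right, inner_smul_right]

lemma toHalfPlane_mem {M : Set E3} {a : E3} {b : OrthonormalBasis (Fin 3) ℝ E3}
    (hrot : IsRotationalAbout M a b) {p : E3} (hp : p ∈ M) :
    toHalfPlane a b p ∈ meridianSet M a b := by
  refine ⟨?_, (inner_toHalfPlane a b p).2.2⟩
  obtain ⟨t, h1, h2⟩ := exists_polar (inner ℝ (b 1) (p - a)) (inner ℝ (b 2) (p - a))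
  convert hrot (-t) p hp using 1
  rw [toHalfPlane, rot]
  set ρ := √(inner ℝ (b 1) (p - a) ^ 2 + inner ℝ (b 2) (p - a) ^ 2)
  rw [Real.cos_neg, Real.sin_neg]
  have e1 : Real.cos t * inner ℝ (b 1) (p - a) - -Real.sin t * inner ℝ (b 2) (p - a) = ρ := by
    rw [h1, h2]; linear_combination ρ * Real.sin_sq_add_cos_sq t
  have e2 : -Real.sin t * inner ℝ (b 1) (p - a) + Real.cos t * inner ℝ (b 2) (p - a) = 0 := by
    rw [h1, h2]; ring
  rw [e1, e2, zero_smul, add_zero]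

lemma revolution_mem {M : Set E3} {a : E3} {b : OrthonormalBasis (Fin 3) ℝ E3}
    (hrot : IsRotationalAbout M a b) {r z : ℝ → ℝ} {w : E2}
    (h : a + (z (w 0) • b 0 + r (w 0) • b 1) ∈ M) : revolution a b r z w ∈ M := by
  convert hrot (w 1) _ h using 1
  simp [revolution, rot, inner_add_right, inner_smul_right, mul_comm]

lemma inner_revolution (a : E3) (b : OrthonormalBasis (Fin 3) ℝ E3) (r z : ℝ → ℝ) (w : E2) :
    inner ℝ (b 0) (revolution a b r z w - a) = z (w 0) ∧
    inner ℝ (b 1) (revolution a b r z w - a) = r (w 0) * Real.cos (w 1) ∧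
    inner ℝ (b 2) (revolution a b r z w - a) = r (w 0) * Real.sin (w 1) := by
  simp [revolution, inner_add_right, inner_smul_right]

lemma toHalfPlane_revolution (a : E3) (b : OrthonormalBasis (Fin 3) ℝ E3) {r z : ℝ → ℝ} {w : E2}
    (hr : 0 ≤ r (w 0)) :
    toHalfPlane a b (revolution a b r z w) = a + (z (w 0) • b 0 + r (w 0) • b 1) := by
  obtain ⟨h0, h1, h2⟩ := inner_revolution a b r z w
  rw [toHalfPlane, h0, h1, h2]
  have : (r (w 0) * Real.cos (w 1)) ^ 2 + (r (w 0) * Real.sin (w 1)) ^ 2 = r (w 0) ^ 2 := by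
    linear_combination r (w 0) ^ 2 * Real.sin_sq_add_cos_sq (w 1)
  rw [this, Real.sqrt_sq hr]

/-- Polar coordinates in the half-plane `y > 0`. -/
lemma sqrt_mul_cos_arctan {y z : ℝ} (hy : 0 < y) :
    √(y ^ 2 + z ^ 2) * Real.cos (Real.arctan (z / y)) = y ∧
    √(y ^ 2 + z ^ 2) * Real.sin (Real.arctan (z / y)) = z := by
  have h1 : √(1 + (z / y) ^ 2) = √(y ^ 2 + z ^ 2) / y := by
    rw [show 1 + (z / y) ^ 2 = (y ^ 2 + z ^ 2) / y ^ 2 by field_simp,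
      Real.sqrt_div (by positivity), Real.sqrt_sq hy.le]
  have h2 : √(y ^ 2 + z ^ 2) ≠ 0 := by positivity
  rw [Real.cos_arctan, Real.sin_arctan, h1]
  constructor <;> field_simp

/-- Near a meridian off the axis, the surface is parametrized by arc length of the meridian and
angle of rotation. -/
lemma exists_isLocalParam_revolution {M : Set E3} (hs : IsEmbeddedC2Surface M) {a : E3}
    {b : OrthonormalBasis (Fin 3) ℝ E3} (hrot : IsRotationalAbout M a b) {r z : ℝ → ℝ}
    (hrC : ContDiff ℝ 2 r) (hzC : ContDiff ℝ 2 z)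
    (h : IsUnitArc (meridianSet M a b) Set.univ fun s => a + (z s • b 0 + r s • b 1)) {s₀ : ℝ}
    (hr : 0 < r s₀) :
    ∃ U, IsLocalParam M U (revolution a b r z) ∧ (WithLp.toLp 2 ![s₀, 0] : E2) ∈ U := by
  set γ : ℝ → E3 := fun s => a + (z s • b 0 + r s • b 1) with hγ
  obtain ⟨W, δ, β, σ, hc, hu, hβ⟩ := hasUnitCharts_meridianSet hs hrot _ (h.mem s₀ trivial)
  have hW : γ s₀ ∈ W := by
    rw [← hβ]; exact (hc.mem 0 ⟨neg_lt_zero.2 hc.pos, hc.pos⟩).2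
  obtain ⟨ε, hε, hev, -⟩ := h.eventually_eq_chart hc hu isOpen_univ (s := s₀) trivial hW
  obtain ⟨ρ, hρ, hball⟩ := Metric.eventually_nhds_iff_ball.1
    (hev.and (hrC.continuous.continuousAt.eventually (lt_mem_nhds hr)))
  rw [Real.ball_eq_Ioo] at hball
  set U : Set E2 := {w | w 0 ∈ Set.Ioo (s₀ - ρ) (s₀ + ρ) ∧ w 1 ∈ Set.Ioo (-1 : ℝ) 1} with hU
  have hX : ContDiff ℝ 2 (revolution a b r z) := by
    have h0 : ContDiff ℝ 2 fun w : E2 => w 0 := by fun_prop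
    have h1 : ContDiff ℝ 2 fun w : E2 => w 1 := by fun_prop
    have hz0 := hzC.comp h0
    have hr0 := hrC.comp h0
    exact contDiff_const.add (((hz0.smul contDiff_const).add
      ((hr0.mul (Real.contDiff_cos.comp h1)).smul contDiff_const)).add
      ((hr0.mul (Real.contDiff_sin.comp h1)).smul contDiff_const))
  have hpi := Real.pi_gt_three
  have hcos : ∀ w ∈ U, 0 < Real.cos (w 1) := fun w hw =>
    Real.cos_pos_of_mem_Ioo ⟨by linarith [hw.2.1], by linarith [hw.2.2]⟩
  have hΦ : ∀ w ∈ U, toHalfPlane a b (revolution a b r z w) = γ (w 0) := fun w hw =>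
    toHalfPlane_revolution a b (hball _ hw.1).2.le
  have harg : ∀ w ∈ U, Real.arctan (inner ℝ (b 2) (revolution a b r z w - a)
      / inner ℝ (b 1) (revolution a b r z w - a)) = w 1 := by
    intro w hw
    obtain ⟨-, h1, h2⟩ := inner_revolution a b r z w
    rw [h1, h2, mul_div_mul_left _ _ (hball _ hw.1).2.ne', ← Real.tan_eq_sin_div_cos,
      Real.arctan_tan (by linarith [hw.2.1]) (by linarith [hw.2.2])]
  have hεε : ε * ε = 1 := by rw [← hε]; ring
  refine ⟨U, IsLocalParam.of_leftInverse ?_ hX.contDiffOn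
    (fun p => WithLp.toLp 2 ![s₀ + ε * (σ (toHalfPlane a b p) - σ (γ s₀)),
      Real.arctan (inner ℝ (b 2) (p - a) / inner ℝ (b 1) (p - a))]) ?_ ?_
    ⟨({p | 0 < inner ℝ (b 1) (p - a)} ∩
      (fun p => Real.arctan (inner ℝ (b 2) (p - a) / inner ℝ (b 1) (p - a))) ⁻¹'
        Set.Ioo (-1 : ℝ) 1) ∩
      toHalfPlane a b ⁻¹' (W ∩ σ ⁻¹' Set.Ioo (σ (γ s₀) - ρ) (σ (γ s₀) + ρ)), ?_, ?_⟩, ?_⟩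
  · have h0 : Continuous fun w : E2 => w 0 := by fun_prop
    have h1 : Continuous fun w : E2 => w 1 := by fun_prop
    exact (isOpen_Ioo.preimage h0).inter (isOpen_Ioo.preimage h1)
  · intro w hw
    obtain ⟨-, h1, h2⟩ := inner_revolution a b r z w
    have hb : ∀ i, DifferentiableAt ℝ (fun p : E3 => inner ℝ (b i) (p - a))
        (revolution a b r z w) := fun i =>
      (differentiableAt_const _).inner ℝ (differentiableAt_id.sub_const a)
    have hy : 0 < inner ℝ (b 1) (revolution a b r z w - a) := by
      rw [h1]; exact mul_pos (hball _ hw.1).2 (hcos w hw)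
    rw [differentiableAt_euclidean]
    intro l
    fin_cases l
    · have hΦd : DifferentiableAt ℝ (toHalfPlane a b) (revolution a b r z w) := by
        have hsq : DifferentiableAt ℝ (fun p : E3 => √(inner ℝ (b 1) (p - a) ^ 2
            + inner ℝ (b 2) (p - a) ^ 2)) (revolution a b r z w) :=
          (((hb 1).pow 2).add ((hb 2).pow 2)).sqrt
            (add_pos_of_pos_of_nonneg (pow_pos hy 2) (sq_nonneg _)).ne'
        exact (((hb 0).smul_const _).add (hsq.smul_const _)).const_add a
      have hσd : DifferentiableAt ℝ σ (toHalfPlane a b (revolution a b r z w)) := by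
        rw [hΦ w hw]
        exact (hc.contDiffOn_inv.contDiffAt (hc.isOpen.mem_nhds
          (hball _ hw.1).1.1)).differentiableAt (by norm_num)
      exact (((hσd.comp _ hΦd).sub_const _).const_mul ε).const_add s₀
    · have hy' : (fun p : E3 => inner ℝ (b 1) (p - a)) (revolution a b r z w) ≠ 0 := hy.ne'
      have hq := (hb 2).mul ((hb 1).inv hy')
      exact hq.arctan
  · intro w hw
    ext l
    fin_cases l
    · change s₀ + ε * (σ (toHalfPlane a b (revolution a b r z w)) - σ (γ s₀)) = w 0
      rw [hΦ w hw, (hball _ hw.1).1.2]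
      linear_combination (w 0 - s₀) * hεε
    · exact harg w hw
  · have hb : ∀ i, Continuous fun p : E3 => inner ℝ (b i) (p - a) := fun i => by fun_prop
    refine (ContinuousOn.isOpen_inter_preimage ?_ (isOpen_lt continuous_const (hb 1))
      isOpen_Ioo).inter ((hc.contDiffOn_inv.continuousOn.isOpen_inter_preimage hc.isOpen
        isOpen_Ioo).preimage (continuous_toHalfPlane a b))
    exact Real.continuous_arctan.comp_continuousOn
      ((hb 2).continuousOn.div (hb 1).continuousOn fun p hp => ne_of_gt hp)
  · ext p
    constructor
    · rintro ⟨w, hw, rfl⟩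
      obtain ⟨-, h1, -⟩ := inner_revolution a b r z w
      refine ⟨revolution_mem hrot (h.mem (w 0) trivial).1, ⟨?_, ?_⟩, ?_⟩
      · rw [Set.mem_ofPred_eq, h1]; exact mul_pos (hball _ hw.1).2 (hcos w hw)
      · rw [Set.mem_preimage, harg w hw]; exact hw.2
      · rw [Set.mem_preimage, hΦ w hw]
        refine ⟨(hball _ hw.1).1.1, ?_⟩
        rw [Set.mem_preimage, (hball _ hw.1).1.2]
        have h2 := hw.1.1
        have h3 := hw.1.2
        rcases sq_eq_one_iff.1 hε with rfl | rfl <;> constructor <;> linarith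
    · rintro ⟨hp, ⟨hy, harc⟩, hpW, hpσ⟩
      simp only [Set.mem_ofPred_eq, Set.mem_preimage] at hy harc hpσ
      set s := s₀ + ε * (σ (toHalfPlane a b p) - σ (γ s₀)) with hsdef
      have hsm : s ∈ Set.Ioo (s₀ - ρ) (s₀ + ρ) := by
        have h2 := hpσ.1
        have h3 := hpσ.2
        rw [hsdef]
        rcases sq_eq_one_iff.1 hε with rfl | rfl <;> constructor <;> linarith
      have hγp : γ s = toHalfPlane a b p := by
        rw [← hc.right_inv _ ⟨toHalfPlane_mem hrot hp, hpW⟩,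
          ← hc.right_inv (γ s) ⟨h.mem s trivial, (hball s hsm).1.1⟩, (hball s hsm).1.2]
        congr 1
        rw [hsdef]
        linear_combination (σ (toHalfPlane a b p) - σ (γ s₀)) * hεε
      obtain ⟨e0, e1, -⟩ := inner_toHalfPlane a b p
      rw [← hγp] at e0 e1
      have e0' : z s = inner ℝ (b 0) (p - a) := by
        rw [← e0]; simp [hγ, inner_add_right, inner_smul_right]
      have e1' : r s = √(inner ℝ (b 1) (p - a) ^ 2 + inner ℝ (b 2) (p - a) ^ 2) := by
        rw [← e1]; simp [hγ, inner_add_right, inner_smul_right]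
      refine ⟨WithLp.toLp 2 ![s, Real.arctan (inner ℝ (b 2) (p - a) / inner ℝ (b 1) (p - a))],
        ⟨hsm, harc⟩, ?_⟩
      obtain ⟨f1, f2⟩ := sqrt_mul_cos_arctan (z := inner ℝ (b 2) (p - a)) hy
      simp only [revolution, Matrix.cons_val_zero, Matrix.cons_val_one, e0', e1', f1, f2]
      rw [← eq_sum_coords, add_sub_cancel]
  · constructor <;> simp [hρ]

/-! ### The second fundamental form of a surface of revolution -/

lemma pd_eq_of_hasDerivAt {X : E2 → E3} {i : Fin 2} {w : E2} {v : E3}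
    (hX : DifferentiableAt ℝ X w)
    (h : HasDerivAt (fun x : ℝ => X (w + x • EuclideanSpace.single i 1)) v 0) : pd X i w = v := by
  have hl : HasDerivAt (fun x : ℝ => w + x • (EuclideanSpace.single i 1 : E2))
      (EuclideanSpace.single i 1) 0 := by
    simpa using ((hasDerivAt_id (0 : ℝ)).smul_const (EuclideanSpace.single i 1 : E2)).const_add w
  exact (hX.hasFDerivAt.comp_hasDerivAt_of_eq (0 : ℝ) hl (by simp)).unique h

/-- Partial derivatives of a map given in cylindrical coordinates by products of functions of one
variable. -/
lemma pd_cylindrical (a : E3) (b : OrthonormalBasis (Fin 3) ℝ E3) {A B C D : ℝ → ℝ} {w : E2}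
    {A' B' C' D' : ℝ} (hd : DifferentiableAt ℝ (fun w : E2 => a + (A (w 0) • b 0
      + (B (w 0) * C (w 1)) • b 1 + (B (w 0) * D (w 1)) • b 2)) w)
    (hA : HasDerivAt A A' (w 0)) (hB : HasDerivAt B B' (w 0)) (hC : HasDerivAt C C' (w 1))
    (hD : HasDerivAt D D' (w 1)) :
    pd (fun w : E2 => a + (A (w 0) • b 0 + (B (w 0) * C (w 1)) • b 1
        + (B (w 0) * D (w 1)) • b 2)) 0 w
      = A' • b 0 + (B' * C (w 1)) • b 1 + (B' * D (w 1)) • b 2 ∧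
    pd (fun w : E2 => a + (A (w 0) • b 0 + (B (w 0) * C (w 1)) • b 1
        + (B (w 0) * D (w 1)) • b 2)) 1 w
      = (B (w 0) * C') • b 1 + (B (w 0) * D') • b 2 := by
  have hs : ∀ {f : ℝ → ℝ} {f' y : ℝ}, HasDerivAt f f' y →
      HasDerivAt (fun x => f (y + x)) f' 0 := fun {f f' y} h =>
    HasDerivAt.comp_const_add y 0 (by rwa [add_zero])
  constructor
  · refine pd_eq_of_hasDerivAt hd ?_
    simpa using ((((hs hA).smul_const (b 0)).add (((hs hB).mul_const (C (w 1))).smul_const (b 1))).add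
      (((hs hB).mul_const (D (w 1))).smul_const (b 2))).const_add a
  · refine pd_eq_of_hasDerivAt hd ?_
    have := ((((hasDerivAt_const (0 : ℝ) (A (w 0))).smul_const (b 0)).add
      (((hs hC).const_mul (B (w 0))).smul_const (b 1))).add
      (((hs hD).const_mul (B (w 0))).smul_const (b 2))).const_add a
    simpa using this

lemma differentiable_revolution (a : E3) (b : OrthonormalBasis (Fin 3) ℝ E3) {r z : ℝ → ℝ}
    (hr : Differentiable ℝ r) (hz : Differentiable ℝ z) :
    Differentiable ℝ (revolution a b r z) := by
  have h0 : Differentiable ℝ fun w : E2 => w 0 := by fun_prop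
  have h1 : Differentiable ℝ fun w : E2 => w 1 := by fun_prop
  have hz0 := hz.comp h0
  have hr0 := hr.comp h0
  exact (((hz0.smul_const _).add ((hr0.mul h1.cos).smul_const _)).add
    ((hr0.mul h1.sin).smul_const _)).const_add a

/-- First and second partial derivatives of a surface of revolution with unit speed profile of
angle `θ`, along the meridian in the plane of `b 0` and `b 1`. -/
lemma pd_revolution {M : Set E3} {U : Set E2} {a : E3}
    {b : OrthonormalBasis (Fin 3) ℝ E3} {r z θ κ : ℝ → ℝ}
    (h : IsLocalParam M U (revolution a b r z))
    (hr : ∀ s, HasDerivAt r (Real.cos (θ s)) s) (hz : ∀ s, HasDerivAt z (Real.sin (θ s)) s)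
    (hθ : ∀ s, HasDerivAt θ (κ s) s) {s : ℝ} (hs : (WithLp.toLp 2 ![s, 0] : E2) ∈ U) :
    (pd (revolution a b r z) 0 (WithLp.toLp 2 ![s, 0])
        = Real.sin (θ s) • b 0 + Real.cos (θ s) • b 1 ∧
      pd (revolution a b r z) 1 (WithLp.toLp 2 ![s, 0]) = r s • b 2) ∧
    (pd (pd (revolution a b r z) 0) 0 (WithLp.toLp 2 ![s, 0])
        = (Real.cos (θ s) * κ s) • b 0 + (-Real.sin (θ s) * κ s) • b 1 ∧
      pd (pd (revolution a b r z) 0) 1 (WithLp.toLp 2 ![s, 0]) = Real.cos (θ s) • b 2) ∧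
    (pd (pd (revolution a b r z) 1) 0 (WithLp.toLp 2 ![s, 0]) = Real.cos (θ s) • b 2 ∧
      pd (pd (revolution a b r z) 1) 1 (WithLp.toLp 2 ![s, 0]) = (r s * -1) • b 1) := by
  have hX : Differentiable ℝ (revolution a b r z) :=
    differentiable_revolution a b (fun s => (hr s).differentiableAt)
      fun s => (hz s).differentiableAt
  have hp0 : pd (revolution a b r z) 0 = fun w : E2 => (0 : E3) + (Real.sin (θ (w 0)) • b 0
      + (Real.cos (θ (w 0)) * Real.cos (w 1)) • b 1
      + (Real.cos (θ (w 0)) * Real.sin (w 1)) • b 2) := by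
    funext w
    rw [zero_add]
    exact (pd_cylindrical a b (hX w) (hz _) (hr _) (Real.hasDerivAt_cos _)
      (Real.hasDerivAt_sin _)).1
  have hp1 : pd (revolution a b r z) 1 = fun w : E2 => (0 : E3) + ((0 : ℝ) • b 0
      + (r (w 0) * -Real.sin (w 1)) • b 1 + (r (w 0) * Real.cos (w 1)) • b 2) := by
    funext w
    rw [zero_add, zero_smul, zero_add]
    exact (pd_cylindrical a b (hX w) (hz _) (hr _) (Real.hasDerivAt_cos _)
      (Real.hasDerivAt_sin _)).2
  have hd0 := h.differentiableAt_pd hs 0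
  have hd1 := h.differentiableAt_pd hs 1
  have e0 := congrFun hp0 (WithLp.toLp 2 ![s, 0])
  have e1 := congrFun hp1 (WithLp.toLp 2 ![s, 0])
  rw [hp0] at hd0
  rw [hp1] at hd1
  have hq0 := pd_cylindrical (A := fun s => Real.sin (θ s)) (B := fun s => Real.cos (θ s))
    (C := Real.cos) (D := Real.sin) 0 b hd0 (hθ _).sin (hθ _).cos
    (Real.hasDerivAt_cos _) (Real.hasDerivAt_sin _)
  have hq1 := pd_cylindrical (A := fun _ => (0 : ℝ)) (B := r) (C := fun t => -Real.sin t)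
    (D := Real.cos) 0 b hd1 (hasDerivAt_const _ (0 : ℝ)) (hr _) (Real.hasDerivAt_sin _).neg
    (Real.hasDerivAt_cos _)
  rw [← hp0] at hq0
  rw [← hp1] at hq1
  refine ⟨⟨?_, ?_⟩, ⟨?_, ?_⟩, ⟨?_, ?_⟩⟩
  · simpa using e0
  · simpa using e1
  · simpa using hq0.1
  · simpa using hq0.2
  · simpa using hq1.1
  · simpa using hq1.2

/-- The principal curvatures of a surface of revolution with unit speed profile `(r, z)` of angle
`θ` are `θ'` and `sin θ / r`. -/
lemma secondFormLength_revolution {M : Set E3} {U : Set E2} {a : E3}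
    {b : OrthonormalBasis (Fin 3) ℝ E3} {r z θ κ : ℝ → ℝ}
    (h : IsLocalParam M U (revolution a b r z))
    (hr : ∀ s, HasDerivAt r (Real.cos (θ s)) s) (hz : ∀ s, HasDerivAt z (Real.sin (θ s)) s)
    (hθ : ∀ s, HasDerivAt θ (κ s) s) {s : ℝ} (hs : (WithLp.toLp 2 ![s, 0] : E2) ∈ U)
    (h0 : 0 < r s) :
    secondFormLength (revolution a b r z) (WithLp.toLp 2 ![s, 0])
      = √(κ s ^ 2 + (Real.sin (θ s) / r s) ^ 2) := by
  obtain ⟨⟨e0, e1⟩, ⟨e00, e10⟩, ⟨e01, e11⟩⟩ := pd_revolution h hr hz hθ hs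
  have hi := h.immersion _ hs
  generalize (WithLp.toLp 2 ![s, 0] : E2) = u at *
  have hsc := Real.sin_sq_add_cos_sq (θ s)
  have hr0 : r s ≠ 0 := h0.ne'
  rw [secondFormLength_eq hi (n := Real.cos (θ s) • b 0 - Real.sin (θ s) • b 1)
    (B := !![κ s, 0; 0, r s * Real.sin (θ s)])]
  · have hG : firstForm (revolution a b r z) u = !![1, 0; 0, r s ^ 2] := by
      ext i j
      fin_cases i <;> fin_cases j <;>
        simp only [firstForm, Matrix.of_apply, Fin.zero_eta, Fin.mk_one, e0, e1, inner_add_left,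
          inner_add_right, inner_smul_left, inner_smul_right, inner_basis] <;> simp
      · linear_combination hsc
      · ring
    rw [hG, Matrix.inv_def, Matrix.det_fin_two_of, Matrix.adjugate_fin_two_of,
      Ring.inverse_eq_inv']
    congr 1
    simp [Matrix.trace_fin_two]
    field_simp
  · rw [norm_eq_sqrt_real_inner]
    simp only [inner_sub_left, inner_sub_right, inner_smul_left, inner_smul_right, inner_basis]
    simp
    linear_combination hsc
  · intro i
    fin_cases i <;> simp [e0, e1, inner_sub_right, inner_add_left, inner_smul_left,
      inner_smul_right]
    ring
  · intro i j
    fin_cases i <;> fin_cases j <;> simp [e00, e01, e10, e11, inner_sub_right, inner_add_left,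
      inner_smul_left, inner_smul_right]
    · linear_combination (-κ s) * hsc
    · ring

/-- Reflection in the axis maps meridians to meridians. -/
lemma IsUnitArc.reflect {M : Set E3} {a : E3} {b : OrthonormalBasis (Fin 3) ℝ E3}
    (hrot : IsRotationalAbout M a b) {r z : ℝ → ℝ} (hrC : ContDiff ℝ 2 r) (hzC : ContDiff ℝ 2 z)
    (h : IsUnitArc (meridianSet M a b) Set.univ fun s => a + (z s • b 0 + r s • b 1)) :
    IsUnitArc (meridianSet M a b) Set.univ fun s => a + (z s • b 0 + (-r s) • b 1) := by
  have hd : ∀ {f : ℝ → ℝ}, ContDiff ℝ 2 f → ∀ s, HasDerivAt (fun s => a + (z s • b 0 + f s • b 1))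
      (deriv z s • b 0 + deriv f s • b 1) s := fun {f} hf s =>
    ((((hzC.differentiable (by norm_num)) s).hasDerivAt.smul_const (b 0)).add
      (((hf.differentiable (by norm_num)) s).hasDerivAt.smul_const (b 1))).const_add a
  have hn : ∀ x y : ℝ, ‖x • b 0 + (-y) • b 1‖ = ‖x • b 0 + y • b 1‖ := fun x y => by
    rw [@norm_eq_sqrt_real_inner E3, @norm_eq_sqrt_real_inner E3, inner_add_left, inner_add_left]
    simp only [inner_add_right, inner_smul_left, inner_smul_right, inner_basis]
    simp
  refine ⟨?_, fun s _ => ⟨?_, ?_⟩, fun s _ => ?_⟩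
  · exact (contDiff_const.add ((hzC.smul contDiff_const).add
      (hrC.neg.smul contDiff_const))).contDiffOn
  · convert hrot Real.pi _ (h.mem s trivial).1 using 1
    simp [rot, inner_add_right, inner_smul_right]
  · simp [inner_add_right, inner_smul_right]
  · have h1 := h.speed s trivial
    rw [(hd hrC s).deriv] at h1
    rw [(hd hrC.neg s).deriv, show deriv (fun s => -r s) s = -deriv r s from deriv.fun_neg, hn, h1]

/-- The profile of a complete meridian solves the equation of constant length of the second
fundamental form. -/
lemma IsUnitArc.exists_isProfile {M : Set E3} (hs : IsEmbeddedC2Surface M) {a : E3}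
    {b : OrthonormalBasis (Fin 3) ℝ E3} (hrot : IsRotationalAbout M a b) {c : ℝ}
    (hA : HasSecondFormLength M c) {γ : ℝ → E3}
    (h : IsUnitArc (meridianSet M a b) Set.univ γ) :
    ∃ r z θ κ, IsProfile c r z θ κ ∧ ∀ s, γ s = a + (z s • b 0 + r s • b 1) := by
  have hγ : ContDiff ℝ 2 γ := contDiffOn_univ.1 h.contDiffOn
  have hC : ∀ i, ContDiff ℝ 2 fun s => inner ℝ (b i) (γ s - a) := fun i =>
    contDiff_const.inner ℝ (hγ.sub contDiff_const)
  set r : ℝ → ℝ := fun s => inner ℝ (b 1) (γ s - a) with hr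
  set z : ℝ → ℝ := fun s => inner ℝ (b 0) (γ s - a) with hz
  have hrC : ContDiff ℝ 2 r := hC 1
  have hzC : ContDiff ℝ 2 z := hC 0
  have e : ∀ s, γ s = a + (z s • b 0 + r s • b 1) := by
    intro s
    have h1 := eq_sum_coords b (γ s - a)
    rw [(h.mem s trivial).2, zero_smul, add_zero] at h1
    rw [hz, hr, ← h1, add_sub_cancel]
  have hi : ∀ i s, HasDerivAt (fun s => inner ℝ (b i) (γ s - a)) (inner ℝ (b i) (deriv γ s)) s :=
    fun i s => (innerSL ℝ (b i)).hasFDerivAt.comp_hasDerivAt s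
      ((h.hasDerivAt isOpen_univ trivial).sub_const a)
  have hd : ∀ s, deriv γ s = deriv z s • b 0 + deriv r s • b 1 := by
    intro s
    have h1 := eq_sum_coords b (deriv γ s)
    have h2 : inner ℝ (b 2) (deriv γ s) = 0 := by
      have h3 : (fun s => inner ℝ (b 2) (γ s - a)) = fun _ => (0 : ℝ) :=
        funext fun s => (h.mem s trivial).2
      have h4 := hi 2 s
      rw [h3] at h4
      exact h4.unique (hasDerivAt_const s 0)
    rw [h2, zero_smul, add_zero] at h1
    rw [(hi 0 s).deriv, (hi 1 s).deriv, ← h1]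
  have hunit : ∀ s, deriv r s ^ 2 + deriv z s ^ 2 = 1 := by
    intro s
    have h1 := h.speed s trivial
    have h2 := norm_sq_eq_sum b (deriv γ s)
    rw [h1, hd s] at h2
    simp [inner_add_right, inner_smul_right] at h2
    linarith
  obtain ⟨θ, κ, hκ, hθ, hang⟩ := exists_angle (hrC.deriv' (n := 1)) (hzC.deriv' (n := 1)) hunit
  have hr' : ∀ s, HasDerivAt r (Real.cos (θ s)) s := fun s =>
    (hang s).1 ▸ (hrC.differentiable (by norm_num) s).hasDerivAt
  have hz' : ∀ s, HasDerivAt z (Real.sin (θ s)) s := fun s =>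
    (hang s).2 ▸ (hzC.differentiable (by norm_num) s).hasDerivAt
  have h' : IsUnitArc (meridianSet M a b) Set.univ fun s => a + (z s • b 0 + r s • b 1) := by
    rw [← funext e]; exact h
  have hsq : ∀ {x y ρ : ℝ}, ρ ≠ 0 → √(x ^ 2 + (y / ρ) ^ 2) = c →
      (ρ * x) ^ 2 + y ^ 2 = c ^ 2 * ρ ^ 2 := fun {x y ρ} hρ hx => by
    have h1 := Real.sq_sqrt (by positivity : 0 ≤ x ^ 2 + (y / ρ) ^ 2)
    rw [hx] at h1
    rw [h1]
    field_simp
  refine ⟨r, z, θ, κ, ⟨hr', hz', hθ, hκ, fun s => ?_⟩, e⟩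
  rcases lt_trichotomy (r s) 0 with h0 | h0 | h0
  · -- Reflect the meridian; the angle becomes `π - θ`.
    obtain ⟨U, hU, hsU⟩ := exists_isLocalParam_revolution hs hrot hrC.neg hzC
      (h'.reflect hrot hrC hzC) (s₀ := s) (neg_pos.2 h0)
    have h1 := secondFormLength_revolution (θ := fun s => Real.pi - θ s) (κ := fun s => -κ s) hU
      (fun s => by rw [Real.cos_pi_sub]; exact (hr' s).neg)
      (fun s => by rw [Real.sin_pi_sub]; exact hz' s)
      (fun s => by simpa using (hθ s).const_sub Real.pi) hsU (neg_pos.2 h0)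
    rw [hA U _ hU _ hsU, Real.sin_pi_sub] at h1
    have h2 := hsq (neg_ne_zero.2 h0.ne) h1.symm
    linarith
  · have h1 := h.inner_deriv_of_axis hs hrot (s := s) h0
    rw [← (hi 0 s).deriv, ← hz, (hang s).2] at h1
    rw [h1, h0]
    ring
  · obtain ⟨U, hU, hsU⟩ := exists_isLocalParam_revolution hs hrot hrC hzC h' (s₀ := s) h0
    have h1 := secondFormLength_revolution hU hr' hz' hθ hsU h0
    rw [hA U _ hU _ hsU] at h1
    exact hsq h0.ne' h1.symm

/-! ### Classification -/

lemma mem_of_toHalfPlane_mem {M : Set E3} {a : E3} {b : OrthonormalBasis (Fin 3) ℝ E3}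
    (hrot : IsRotationalAbout M a b) {p : E3} (hp : toHalfPlane a b p ∈ M) : p ∈ M := by
  obtain ⟨t, h1, h2⟩ := exists_polar (inner ℝ (b 1) (p - a)) (inner ℝ (b 2) (p - a))
  obtain ⟨e0, e1, e2⟩ := inner_toHalfPlane a b p
  convert hrot t _ hp using 1
  rw [rot, e0, e1, e2, mul_zero, mul_zero, sub_zero, add_zero, mul_comm (Real.cos t),
    mul_comm (Real.sin t), ← h1, ← h2,
    ← eq_sum_coords b (p - a), add_sub_cancel]

lemma toHalfPlane_eq_iff {a : E3} {b : OrthonormalBasis (Fin 3) ℝ E3} {p : E3} {x y : ℝ} :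
    toHalfPlane a b p = a + (x • b 0 + y • b 1) ↔ inner ℝ (b 0) (p - a) = x ∧
      √(inner ℝ (b 1) (p - a) ^ 2 + inner ℝ (b 2) (p - a) ^ 2) = y := by
  constructor
  · intro h
    obtain ⟨e0, e1, -⟩ := inner_toHalfPlane a b p
    rw [h] at e0 e1
    rw [← e0, ← e1]
    simp [inner_add_right, inner_smul_right]
  · rintro ⟨rfl, rfl⟩
    rfl

/-- A complete unit speed curve covers a neighbourhood of each of its points. -/
lemma IsUnitArc.range_mem_nhdsWithin {Q : Set E3} (hQ : HasUnitCharts Q) {γ : ℝ → E3}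
    (h : IsUnitArc Q Set.univ γ) (s : ℝ) : Set.range γ ∈ nhdsWithin (γ s) Q := by
  obtain ⟨W, δ, β, σ, hc, hu, hβ⟩ := hQ (γ s) (h.mem s trivial)
  have hW : γ s ∈ W := by
    rw [← hβ]; exact (hc.mem 0 ⟨neg_lt_zero.2 hc.pos, hc.pos⟩).2
  obtain ⟨ε, hε, hev, -⟩ := h.eventually_eq_chart hc hu isOpen_univ (s := s) trivial hW
  have hσ : ContinuousAt σ (γ s) := hc.contDiffOn_inv.continuousOn.continuousAt
    (hc.isOpen.mem_nhds hW)
  have ht : Filter.Tendsto (fun q => s + ε * (σ q - σ (γ s))) (nhds (γ s)) (nhds s) := by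
    have : ContinuousAt (fun q => s + ε * (σ q - σ (γ s))) (γ s) := by fun_prop
    simpa [ContinuousAt] using this
  filter_upwards [nhdsWithin_le_nhds (ht.eventually hev), nhdsWithin_le_nhds
    (hc.isOpen.mem_nhds hW), self_mem_nhdsWithin] with q h1 h2 h3
  refine ⟨s + ε * (σ q - σ (γ s)), ?_⟩
  rw [← hc.right_inv (γ _) ⟨h.mem _ trivial, h1.1⟩, h1.2]
  conv_rhs => rw [← hc.right_inv q ⟨h3, h2⟩]
  congr 1
  linear_combination (σ q - σ (γ s)) * hε

/-- A nonempty closed set that is relatively open in a connected set `M` contains `M`. -/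
lemma _root_.IsPreconnected.subset_of_isClosed_of_mem_nhdsWithin {α : Type*} [TopologicalSpace α]
    {M S : Set α} (hM : IsPreconnected M) (hS : IsClosed S) (hne : (M ∩ S).Nonempty)
    (ho : ∀ p ∈ M ∩ S, S ∈ nhdsWithin p M) : M ⊆ S := by
  by_contra hcon
  obtain ⟨q, hqM, hqS⟩ := Set.not_subset.1 hcon
  have hmem : ∀ p ∈ M, p ∈ S → p ∈ interior {x | x ∈ M → x ∈ S} := fun p hp hpS =>
    mem_interior_iff_mem_nhds.2 (mem_nhdsWithin_iff_eventually.1 (ho p ⟨hp, hpS⟩))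
  obtain ⟨p, hp⟩ := hne
  obtain ⟨x, hxM, hx1, hx2⟩ := hM _ _ isOpen_interior hS.isOpen_compl
    (fun x hx => by
      by_cases h : x ∈ S
      · exact Or.inl (hmem x hx h)
      · exact Or.inr h)
    ⟨p, hp.1, hmem p hp.1 hp.2⟩ ⟨q, hqM, hqS⟩
  exact hx2 (interior_subset hx1 hxM)

/-- If a complete meridian has an umbilic point, it is a circle centred on the axis, and `M` is the
sphere that it generates. -/
lemma isRoundSphere_of_umbilic {M : Set E3} (hconn : IsConnected M)
    (hs : IsEmbeddedC2Surface M) {a : E3} {b : OrthonormalBasis (Fin 3) ℝ E3}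
    (hrot : IsRotationalAbout M a b) {c : ℝ} (hc : 0 < c) {r z θ κ : ℝ → ℝ}
    (hP : IsProfile c r z θ κ)
    (h : IsUnitArc (meridianSet M a b) Set.univ fun s => a + (z s • b 0 + r s • b 1)) {s₀ : ℝ}
    (h0 : r s₀ * κ s₀ = Real.sin (θ s₀)) : IsRoundSphere M := by
  obtain ⟨k, hk, hkκ⟩ := hP.umbilic hc h0
  have hk0 : k ≠ 0 := by
    rintro rfl
    have := pow_pos hc 2
    linarith
  have hθ : ∀ s, θ s = θ 0 + k * s := by
    intro s
    have hd : ∀ s, HasDerivAt (fun s => θ s - k * s) 0 s := fun s =>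
      ((hP.deriv_θ s).sub ((hasDerivAt_id s).const_mul k)).congr_deriv (by rw [(hkκ s).1]; ring)
    have := is_const_of_deriv_eq_zero (fun s => (hd s).differentiableAt) (fun s => (hd s).deriv) s 0
    linarith
  -- The centre of the circle.
  obtain ⟨z₀, hz₀⟩ : ∃ z₀, ∀ s, Real.cos (θ s) = k * (z₀ - z s) := by
    refine ⟨z 0 + Real.cos (θ 0) / k, fun s => ?_⟩
    have hd : ∀ s, HasDerivAt (fun s => k * z s + Real.cos (θ s)) 0 s := fun s =>
      (((hP.deriv_z s).const_mul k).add (hP.deriv_θ s).cos).congr_deriv (by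
        rw [(hkκ s).1]; ring)
    have := is_const_of_deriv_eq_zero (fun s => (hd s).differentiableAt) (fun s => (hd s).deriv) s 0
    field_simp
    linarith
  set R := |k|⁻¹ with hR
  have hRpos : 0 < R := inv_pos.2 (abs_pos.2 hk0)
  have hkR : k ^ 2 * R ^ 2 = 1 := by
    rw [hR, inv_pow, sq_abs]; field_simp
  have hmem : ∀ p, p ∈ Metric.sphere (a + z₀ • b 0) R ↔
      (inner ℝ (b 0) (p - a) - z₀) ^ 2 + inner ℝ (b 1) (p - a) ^ 2 + inner ℝ (b 2) (p - a) ^ 2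
        = R ^ 2 := by
    intro p
    rw [mem_sphere_iff_norm, ← sub_sub]
    have h1 := norm_sq_eq_sum b (p - a - z₀ • b 0)
    simp only [inner_sub_right _ (p - a), inner_smul_right, inner_basis] at h1
    rw [if_pos trivial, if_neg (by decide), if_neg (by decide), mul_one, mul_zero, sub_zero,
      sub_zero] at h1
    constructor
    · intro h2
      rw [← h2, h1]
    · intro h2
      rw [h2] at h1
      exact (pow_left_inj₀ (norm_nonneg _) hRpos.le two_ne_zero).1 h1
  -- The sphere consists of the rotates of the points of the meridian.
  have hrange : ∀ p, p ∈ Metric.sphere (a + z₀ • b 0) R ↔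
      toHalfPlane a b p ∈ Set.range fun s => a + (z s • b 0 + r s • b 1) := by
    intro p
    rw [hmem]
    set x := inner ℝ (b 0) (p - a)
    have hρ := Real.sq_sqrt (by positivity :
      0 ≤ inner ℝ (b 1) (p - a) ^ 2 + inner ℝ (b 2) (p - a) ^ 2)
    constructor
    · intro h1
      set ρ := √(inner ℝ (b 1) (p - a) ^ 2 + inner ℝ (b 2) (p - a) ^ 2) with hρdef
      obtain ⟨t, ht1, ht2⟩ := exists_polar (k * (z₀ - x)) (k * ρ)
      have h2 : (k * (z₀ - x)) ^ 2 + (k * ρ) ^ 2 = 1 := by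
        linear_combination k ^ 2 * h1 + k ^ 2 * hρ + hkR
      rw [h2, Real.sqrt_one, one_mul] at ht1 ht2
      have hθt : θ ((t - θ 0) / k) = t := by rw [hθ]; field_simp; ring
      refine ⟨(t - θ 0) / k, (toHalfPlane_eq_iff.2 ⟨?_, ?_⟩).symm⟩
      · have h3 := hz₀ ((t - θ 0) / k)
        rw [hθt, ← ht1] at h3
        have := mul_left_cancel₀ hk0 h3
        change x = _
        linarith
      · have h3 := (hkκ ((t - θ 0) / k)).2
        rw [hθt, ← ht2] at h3
        exact mul_left_cancel₀ hk0 h3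
    · rintro ⟨s, hsp⟩
      obtain ⟨h1, h2⟩ := toHalfPlane_eq_iff.1 hsp.symm
      rw [h2] at hρ
      have h3 := Real.sin_sq_add_cos_sq (θ s)
      rw [(hkκ s).2, hz₀ s] at h3
      have h4 : k ^ 2 * ((x - z₀) ^ 2 + r s ^ 2) = k ^ 2 * R ^ 2 := by
        rw [hkR]; change x = z s at h1; rw [h1]; linear_combination h3
      have h5 := mul_left_cancel₀ (pow_ne_zero 2 hk0) h4
      linear_combination h5 - hρ
  refine ⟨a + z₀ • b 0, R, hRpos, Set.Subset.antisymm ?_ ?_⟩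
  · refine hconn.isPreconnected.subset_of_isClosed_of_mem_nhdsWithin Metric.isClosed_sphere
      ⟨a + (z s₀ • b 0 + r s₀ • b 1), (h.mem s₀ trivial).1, ?_⟩ ?_
    · rw [hmem]
      have h3 := Real.sin_sq_add_cos_sq (θ s₀)
      rw [(hkκ s₀).2, hz₀ s₀] at h3
      refine mul_left_cancel₀ (pow_ne_zero 2 hk0) ?_
      rw [hkR]
      simp [inner_add_right, inner_smul_right]
      linear_combination h3
    · rintro p ⟨hpM, hpS⟩
      obtain ⟨s, hsp⟩ := (hrange p).1 hpS
      have h1 := h.range_mem_nhdsWithin (hasUnitCharts_meridianSet hs hrot) s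
      have h2 : Filter.Tendsto (toHalfPlane a b) (nhdsWithin p M)
          (nhdsWithin (toHalfPlane a b p) (meridianSet M a b)) :=
        tendsto_nhdsWithin_iff.2 ⟨(continuous_toHalfPlane a b).continuousAt.tendsto.mono_left
          nhdsWithin_le_nhds, by
          filter_upwards [self_mem_nhdsWithin] with q hq using toHalfPlane_mem hrot hq⟩
      rw [← hsp] at h2
      filter_upwards [h2 h1] with q hq using (hrange q).2 hq
  · intro p hp
    obtain ⟨s, hsp⟩ := (hrange p).1 hp
    exact mem_of_toHalfPlane_mem hrot (hsp ▸ (h.mem s trivial).1)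

/-- A meridian without umbilic points that starts in the half-plane `r ≥ 0` is a line parallel to
the axis, at distance `1 / c`: otherwise it would cross itself. -/
lemma IsUnitArc.straight {M : Set E3} (hs : IsEmbeddedC2Surface M) {a : E3}
    {b : OrthonormalBasis (Fin 3) ℝ E3} (hrot : IsRotationalAbout M a b) {c : ℝ} (hc : 0 < c)
    {r z θ κ : ℝ → ℝ} (hP : IsProfile c r z θ κ)
    (h : IsUnitArc (meridianSet M a b) Set.univ fun s => a + (z s • b 0 + r s • b 1))
    (hne : ∀ s, r s * κ s ≠ Real.sin (θ s)) (h0 : 0 ≤ r 0) :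
    ∀ s, Real.cos (θ s) = 0 ∧ c * r s = 1 := by
  have hr0 : ∀ s, r s ≠ 0 := by
    intro s h1
    apply hne s
    have h2 := hP.eqn s
    rw [h1] at h2 ⊢
    have h3 : Real.sin (θ s) ^ 2 = 0 := by linarith
    rw [pow_eq_zero_iff two_ne_zero |>.1 h3, zero_mul]
  have hr : ∀ s, 0 < r s := by
    intro s
    by_contra hcon
    obtain ⟨t, -, ht⟩ := isPreconnected_univ.intermediate_value (Set.mem_univ s)
      (Set.mem_univ (0 : ℝ)) hP.continuous_r.continuousOn
      (⟨not_lt.1 hcon, h0⟩ : (0 : ℝ) ∈ Set.Icc (r s) (r 0))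
    exact hr0 t ht
  refine (hP.straight_or_crossing hc hr hne).resolve_right ?_
  rintro ⟨s, t, e1, e2, hcr⟩
  have hd : ∀ s, deriv (fun s => a + (z s • b 0 + r s • b 1)) s
      = Real.sin (θ s) • b 0 + Real.cos (θ s) • b 1 := fun s =>
    ((((hP.deriv_z s).smul_const (b 0)).add ((hP.deriv_r s).smul_const (b 1))).const_add a).deriv
  have h1 := h.deriv_eq_or_neg (hasUnitCharts_meridianSet hs hrot) isOpen_univ isOpen_univ h
    (s := s) (t := t) trivial trivial (by simp only [e1, e2])
  rw [hd, hd] at h1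
  apply hcr
  rcases h1 with h1 | h1
  · have i0 := congrArg (inner ℝ (b 0)) h1
    have i1 := congrArg (inner ℝ (b 1)) h1
    simp [inner_add_right, inner_smul_right] at i0 i1
    rw [i0, i1]
    ring
  · have i0 := congrArg (inner ℝ (b 0)) h1
    have i1 := congrArg (inner ℝ (b 1)) h1
    simp [inner_add_right, inner_smul_right] at i0 i1
    rw [i0, i1]
    ring

lemma isRoundSphere_or_isCircularCylinder {M : Set E3} (hconn : IsConnected M)
    (hs : IsEmbeddedC2Surface M) (hcomp : IsIntrinsicallyComplete M) (hrot : IsRotational M)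
    {c : ℝ} (hc : 0 < c) (hA : HasSecondFormLength M c) :
    IsRoundSphere M ∨ IsCircularCylinder M := by
  obtain ⟨a, b, hrot⟩ := hrot.exists_axis
  by_cases hU : ∃ r z θ κ, IsProfile c r z θ κ ∧
      IsUnitArc (meridianSet M a b) Set.univ (fun s => a + (z s • b 0 + r s • b 1)) ∧
      ∃ s, r s * κ s = Real.sin (θ s)
  · obtain ⟨r, z, θ, κ, hP, h, s₀, h0⟩ := hU
    exact Or.inl (isRoundSphere_of_umbilic hconn hs hrot hc hP h h0)
  right
  push Not at hU
  -- Through each point there is a line parallel to the axis, at distance `1 / c`.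
  have key : ∀ p ∈ M, √(inner ℝ (b 1) (p - a) ^ 2 + inner ℝ (b 2) (p - a) ^ 2) = 1 / c ∧
      ∀ x : ℝ, a + (x • b 0 + (1 / c) • b 1) ∈ M := by
    intro p hp
    obtain ⟨γ, hγ, hγ0⟩ := exists_complete_meridian hcomp (hasUnitCharts_meridianSet hs hrot)
      (toHalfPlane_mem hrot hp)
    obtain ⟨r, z, θ, κ, hP, e⟩ := hγ.exists_isProfile hs hrot hA
    rw [funext e] at hγ
    obtain ⟨e0, e1⟩ := toHalfPlane_eq_iff.1 (hγ0.symm.trans (e 0))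
    have hst := hγ.straight hs hrot hc hP (hU r z θ κ hP hγ) (e1 ▸ Real.sqrt_nonneg _)
    have hrc : ∀ s, r s = 1 / c := fun s => by
      rw [eq_div_iff hc.ne', mul_comm]; exact (hst s).2
    refine ⟨e1.trans (hrc 0), fun x => ?_⟩
    have hsin : ∀ s, Real.sin (θ s) = Real.sin (θ 0) := fun s =>
      is_const_of_deriv_eq_zero (fun s => (hP.deriv_θ s).sin.differentiableAt)
        (fun s => by rw [(hP.deriv_θ s).sin.deriv, (hst s).1, zero_mul]) s 0
    have hz : ∀ s, z s = z 0 + Real.sin (θ 0) * s := by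
      intro s
      have hd : ∀ s, HasDerivAt (fun s => z s - Real.sin (θ 0) * s) 0 s := fun s =>
        ((hP.deriv_z s).sub ((hasDerivAt_id s).const_mul _)).congr_deriv (by rw [hsin s]; ring)
      have := is_const_of_deriv_eq_zero (fun s => (hd s).differentiableAt)
        (fun s => (hd s).deriv) s 0
      linarith
    have hsq : Real.sin (θ 0) ^ 2 = 1 := by
      have := Real.sin_sq_add_cos_sq (θ 0)
      rw [(hst 0).1] at this
      linarith
    have := (hγ.mem (Real.sin (θ 0) * (x - z 0)) trivial).1
    rw [hrc, hz, show z 0 + Real.sin (θ 0) * (Real.sin (θ 0) * (x - z 0)) = x by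
      linear_combination (x - z 0) * hsq] at this
    exact this
  obtain ⟨p₀, hp₀⟩ := hconn.nonempty
  have hc' : 0 < 1 / c := one_div_pos.2 hc
  refine ⟨a, b 0, 1 / c, b.orthonormal.1 0, hc', ?_⟩
  rw [cylinder_eq_quadric hc']
  ext p
  have hiff : p ∈ quadric 0 (1 / c) a b ↔
      √(inner ℝ (b 1) (p - a) ^ 2 + inner ℝ (b 2) (p - a) ^ 2) = 1 / c := by
    rw [Real.sqrt_eq_iff_eq_sq (by positivity) hc'.le]
    simp [quadric]
  rw [hiff]
  refine ⟨fun hp => (key p hp).1, fun hp => mem_of_toHalfPlane_mem hrot ?_⟩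
  rw [toHalfPlane, hp]
  exact (key p₀ hp₀).2 _

end RotSurf

/-- A subset `M` of Euclidean 3-space is a connected complete embedded rotational `C²` surface
whose second fundamental form has constant positive length if and only if it is a round sphere or
a circular cylinder. -/
theorem corollary1p2 (M : Set RotSurf.E3) :
    (IsConnected M ∧ RotSurf.IsEmbeddedC2Surface M ∧ RotSurf.IsIntrinsicallyComplete M ∧
        RotSurf.IsRotational M ∧ ∃ c : ℝ, 0 < c ∧ RotSurf.HasSecondFormLength M c) ↔
      (RotSurf.IsRoundSphere M ∨ RotSurf.IsCircularCylinder M) :=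
  ⟨fun ⟨hconn, hs, hcomp, hrot, _, hc, hA⟩ =>
    RotSurf.isRoundSphere_or_isCircularCylinder hconn hs hcomp hrot hc hA,
    RotSurf.properties_of_sphere_or_cylinder⟩
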